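/- Middlebox deployment problem. Given are a network $G$ on $n$ nodes $V$ with nonnegative edge lengths (length $1$ per edge is a special case) and shortest-path distance $d$, a set $P\subseteq V\times V$ of communicating pairs, a set $U\subseteq V$ of possible locations, a capacity $\kappa\in\mathbb N$ and a stretch $\rho\ge 1$. A pair $p=(s,t)\in P$ can be routed via $m$ if $s,t$ are connected and $d(s,m)+d(m,t)\le\rho\, d(s,t)$. For $M\subseteq U$, let $B(M)$ be the bipartite graph of all edges $(m,p)$, $m\in M$, $p\in P$, such that $p$ can be routed via $m$. A feasible partial assignment for $M$ is a set $A$ of edges of $B(M)$ in which each pair has degree at most $1$ and each $m\in M$ has degree at most $\kappa$; pairs of degree $0$ are free. Let $\varphi(M)$ be the maximum size of such an $A$. A solution is a set $M\subseteq U$ with $\varphi(M)=|P|$; the goal is to minimize $|M|$. An augmenting path relative to $A$ is a simple path in $B(M)$ that starts at some $m\in M$ of degree less than $\kappa$ in $A$, ends at a free pair, and alternates between edges outside $A$ (the first and the last one among them) and edges of $A$; augmenting replaces $A$ by its symmetric difference with the path. Greedy incremental algorithm. Start with $M=\emptyset$, $A=\emptyset$. While there is a free pair, choose $m\in U\setminus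 M$ of maximum gain $\varphi(M\cup\{m\})-\varphi(M)>0$ (ties broken arbitrarily), add $m$ to $M$, and update $A$ by augmenting along augmenting paths in $B(M)$ until there is none. Theorem. There are absolute constants $C,c,k$ such that the following holds for every instance. 1. At every point reached by the algorithm just before or after an iteration, $A$ is a feasible partial assignment for $M\subseteq U$ with $|A|=\varphi(M)$. No deployed middlebox is ever moved or removed, and every pair served before an iteration is served after it. 2. If the instance has a solution, the algorithm never gets stuck before all pairs are served (so that it ends after at most $n$ iterations). 3. Whenever the algorithm ends with all pairs served, $M$ is a solution, and for every solution $M'$ $$|M|\le\bigl(1+C\log\min\{\kappa,n\}\bigr)\,|M'|\quad\text{and}\quad |M|\le\bigl(1+C\log n\bigr)\,|M'|$$ (with the convention $\log 0=0$). That is, the greedy algorithm is an $O(\log\min\{\kappa,n\})$-approximation, in particular an $O(\log n)$-approximation, for the minimum number of middleboxes. 4. The algorithm runs in polynomial time: if the edge lengths are natural numbers and $\rho=a/b$ with natural numbers $a$ and $b>0$, where the edge lengths, $a$ and $b$ have at most $L$ bits each, then an explicit program for a random access machine (unit cost for elementary operations, bit-length cost for multiplications), which computes $\varphi$ by breadth-first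 search for augmenting paths, outputs the deployed middleboxes in order of deployment and the assignment of a run of the greedy algorithm, with all pairs served if the instance has a solution, after at most $c\,(n+L+1)^k$ steps. -/

import Mathlib

open scoped NNReal ENNReal

namespace Middlebox

/-! ## The middlebox deployment problem -/

/-- An instance of the middlebox deployment problem on the `n` nodes `0, …, n - 1`: a network `G`
with nonnegative edge lengths, a set `P` of communicating (source, target) pairs, a set `U` of
possible middlebox locations, the capacity `κ` and the stretch `ρ ≥ 1`. Hop distances are the case
in which every edge has length `1`. -/
structure Instance (n : ℕ) where
  G : SimpleGraph (Fin n)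
  len : Sym2 (Fin n) → ℝ≥0
  P : Finset (Fin n × Fin n)
  U : Finset (Fin n)
  κ : ℕ
  ρ : ℝ≥0
  one_le_ρ : 1 ≤ ρ

/-- A potential assignment edge `(m, p)`: a middlebox location together with a node pair. -/
abbrev Edge (n : ℕ) : Type := Fin n × (Fin n × Fin n)

namespace Instance

variable {n : ℕ} (I : Instance n)

/-- The length of a shortest path from `u` to `v`; it is `∞` if there is no path. -/
noncomputable def d (u v : Fin n) : ℝ≥0∞ :=
  ⨅ q : I.G.Walk u v, (((q.edges.map I.len).sum : ℝ≥0) : ℝ≥0∞)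

/-- The pair `p = (s, t)` can be routed via `m`: there is a route from `s` via `m` to `t` of length
at most `ρ · d(s, t)`. If `s` and `t` are not connected, there is no route at all. -/
def Routable (m : Fin n) (p : Fin n × Fin n) : Prop :=
  I.d p.1 p.2 ≠ ∞ ∧ I.d p.1 m + I.d m p.2 ≤ (I.ρ : ℝ≥0∞) * I.d p.1 p.2

open Classical in
/-- The edge set of the bipartite graph `B(M)` between the middleboxes in `M` and the pairs. -/
noncomputable def B (M : Finset (Fin n)) : Finset (Edge n) :=
  Finset.univ.filter fun e => e.1 ∈ M ∧ e.2 ∈ I.P ∧ I.Routable e.1 e.2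

end Instance

/-- The load of the middlebox `m`: the number of pairs that `A` assigns to it. -/
def load {n : ℕ} (A : Finset (Edge n)) (m : Fin n) : ℕ :=
  (A.filter fun e => e.1 = m).card

/-- The pairs that are assigned by `A`. -/
def served {n : ℕ} (A : Finset (Edge n)) : Finset (Fin n × Fin n) :=
  A.image Prod.snd

namespace Instance

variable {n : ℕ} (I : Instance n)

/-- `A` is a feasible partial assignment of pairs to the middleboxes in `M`: a subgraph of `B(M)`
in which every pair has degree at most one and every middlebox has load at most `κ`. -/
structure IsPartial (M : Finset (Fin n)) (A : Finset (Edge n)) : Prop where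
  sub : A ⊆ I.B M
  unique : ∀ m m' p, (m, p) ∈ A → (m', p) ∈ A → m = m'
  cap : ∀ m, load A m ≤ I.κ

/-- No pair is left free by `A`. -/
def Complete (A : Finset (Edge n)) : Prop :=
  I.P ⊆ served A

/-- `M` is a solution: a set of legal locations to which all pairs can be assigned such that
stretch and capacities are respected. -/
def IsDeployment (M : Finset (Fin n)) : Prop :=
  M ⊆ I.U ∧ ∃ A, I.IsPartial M A ∧ I.Complete A

open Classical in
/-- The maximum number of pairs that can be assigned to `M`. -/
noncomputable def φ (M : Finset (Fin n)) : ℕ :=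
  ((I.B M).powerset.filter fun A => I.IsPartial M A).sup Finset.card

/-- The gain of `m` over `M` (no truncation happens, as `φ` is non-decreasing). -/
noncomputable def gain (M : Finset (Fin n)) (m : Fin n) : ℕ :=
  I.φ (insert m M) - I.φ M

end Instance

/-! ## Augmenting paths -/

/-- A path `m₁, p₁, m₂, p₂, …, m_k, p_k` is given by the list of its odd edges
`(m₁, p₁), …, (m_k, p_k)`; this is the list of its even edges `(m₂, p₁), …, (m_k, p_{k-1})`. -/
def evenEdges {n : ℕ} (π : List (Edge n)) : List (Edge n) :=
  (π.zip π.tail).map fun e => (e.2.1, e.1.2)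

/-- The symmetric difference of `A` and the path. -/
def flip {n : ℕ} (A : Finset (Edge n)) (π : List (Edge n)) : Finset (Edge n) :=
  symmDiff A (π ++ evenEdges π).toFinset

namespace Instance

variable {n : ℕ} (I : Instance n)

/-- `π` is an augmenting path in `B(M)` relative to `A`: it starts at a middlebox with free
capacity, ends at a free pair, visits no vertex twice, its odd edges are non-assignment edges and
its even edges are assignment edges. -/
structure IsAugPath (M : Finset (Fin n)) (A : Finset (Edge n)) (π : List (Edge n)) : Prop where
  start : ∃ e ∈ π.head?, load A e.1 < I.κ
  finish : ∃ e ∈ π.getLast?, e.2 ∉ served A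
  odd : ∀ e ∈ π, e ∈ I.B M ∧ e ∉ A
  even : ∀ e ∈ evenEdges π, e ∈ A
  nodup_left : (π.map Prod.fst).Nodup
  nodup_right : (π.map Prod.snd).Nodup

/-- One augmentation. -/
def AugStep (M : Finset (Fin n)) (A A' : Finset (Edge n)) : Prop :=
  ∃ π, I.IsAugPath M A π ∧ A' = flip A π

/-- `A'` arises from `A` by augmentations along augmenting paths in `B(M)`, performed until there
is no augmenting path any more. -/
def AugmentTo (M : Finset (Fin n)) (A A' : Finset (Edge n)) : Prop :=
  Relation.ReflTransGen (I.AugStep M) A A' ∧ ¬ ∃ π, I.IsAugPath M A' π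

end Instance

/-! ## The greedy incremental algorithm -/

/-- A configuration: the middleboxes in the order of their deployment, and the current partial
assignment. -/
structure Config (n : ℕ) where
  order : List (Fin n)
  assign : Finset (Edge n)

/-- The set of deployed middleboxes. -/
def Config.placed {n : ℕ} (x : Config n) : Finset (Fin n) :=
  x.order.toFinset

namespace Instance

variable {n : ℕ} (I : Instance n)

/-- One iteration of the greedy algorithm: as long as there is a free pair, deploy one more
middlebox, of maximum gain, and update the assignment by augmenting paths. Ties may be broken
arbitrarily. -/
def Step (x y : Config n) : Prop :=
  ¬ I.Complete x.assign ∧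
  ∃ m ∈ I.U \ x.placed,
    0 < I.gain x.placed m ∧
    (∀ m' ∈ I.U \ x.placed, I.gain x.placed m' ≤ I.gain x.placed m) ∧
    y.order = x.order ++ [m] ∧
    I.AugmentTo (insert m x.placed) x.assign y.assign

/-- The configurations that the greedy algorithm can reach from the empty one. -/
def Reach (x : Config n) : Prop :=
  Relation.ReflTransGen I.Step ⟨[], ∅⟩ x

end Instance

/-! ## A random access machine

Programs of a small imperative language with finitely many registers (names in `X`) and finitely
many two-dimensional arrays (names in `Y`) that hold natural numbers of arbitrary size. Every
elementary operation costs one step, except that a multiplication costs in addition the bit lengths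
of its factors. Numbers thus grow by at most as many bits as there are steps, up to the longest
number in the input and in the program, so that running times are polynomially related to those of
Turing machines. -/

inductive Expr (X Y : Type) where
  | lit (k : ℕ)
  | reg (x : X)
  | get (a : Y) (i j : Expr X Y)
  | add (e f : Expr X Y)
  | mul (e f : Expr X Y)
  | sub (e f : Expr X Y)
  | le (e f : Expr X Y)
  | eq (e f : Expr X Y)
  | and (e f : Expr X Y)
  | or (e f : Expr X Y)

inductive Stmt (X Y : Type) where
  | skip
  | set (x : X) (e : Expr X Y)
  | put (a : Y) (i j e : Expr X Y)
  | seq (s t : Stmt X Y)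
  | ite (e : Expr X Y) (s t : Stmt X Y)
  | loop (x : X) (e : Expr X Y) (s : Stmt X Y)

structure State (X Y : Type) where
  reg : X → ℕ
  arr : Y → ℕ → ℕ → ℕ

namespace Expr

variable {X Y : Type}

/-- The value of an expression. Comparisons have the values `0` and `1`, and a number is read as
a truth value by comparing it with `0`. -/
def eval (σ : State X Y) : Expr X Y → ℕ
  | lit k => k
  | reg x => σ.reg x
  | get a i j => σ.arr a (i.eval σ) (j.eval σ)
  | add e f => e.eval σ + f.eval σ
  | mul e f => e.eval σ * f.eval σ
  | sub e f => e.eval σ - f.eval σ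
  | le e f => if e.eval σ ≤ f.eval σ then 1 else 0
  | eq e f => if e.eval σ = f.eval σ then 1 else 0
  | and e f => if e.eval σ ≠ 0 ∧ f.eval σ ≠ 0 then 1 else 0
  | or e f => if e.eval σ ≠ 0 ∨ f.eval σ ≠ 0 then 1 else 0

/-- The number of steps it takes to evaluate an expression. -/
def cost (σ : State X Y) : Expr X Y → ℕ
  | lit _ => 1
  | reg _ => 1
  | get _ i j => i.cost σ + j.cost σ + 1
  | add e f => e.cost σ + f.cost σ + 1
  | mul e f => e.cost σ + f.cost σ + (e.eval σ).size + (f.eval σ).size + 1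
  | sub e f => e.cost σ + f.cost σ + 1
  | le e f => e.cost σ + f.cost σ + 1
  | eq e f => e.cost σ + f.cost σ + 1
  | and e f => e.cost σ + f.cost σ + 1
  | or e f => e.cost σ + f.cost σ + 1

end Expr

namespace State

variable {X Y : Type} [DecidableEq X] [DecidableEq Y]

def setReg (σ : State X Y) (x : X) (v : ℕ) : State X Y :=
  { σ with reg := fun x' => if x' = x then v else σ.reg x' }

def setArr (σ : State X Y) (a : Y) (i j v : ℕ) : State X Y :=
  { σ with arr := fun a' i' j' => if a' = a ∧ i' = i ∧ j' = j then v else σ.arr a' i' j' }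

end State

namespace Stmt

variable {X Y : Type} [DecidableEq X] [DecidableEq Y]

/-- Runs `f 0`, `f 1`, …, `f (k - 1)` one after the other and adds up the steps. -/
def iter (f : ℕ → State X Y → State X Y × ℕ) (σ : State X Y) : ℕ → State X Y × ℕ
  | 0 => (σ, 0)
  | k + 1 =>
    let r := iter f σ k
    let r' := f k r.1
    (r'.1, r.2 + r'.2)

/-- The final state and the number of steps of a program. In `loop x e s` the bound `e` is
evaluated once, and `s` is run with `x = 0, 1, …, e - 1`. -/
def run : Stmt X Y → State X Y → State X Y × ℕ
  | skip, σ => (σ, 1)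
  | set x e, σ => (σ.setReg x (e.eval σ), e.cost σ + 1)
  | put a i j e, σ =>
    (σ.setArr a (i.eval σ) (j.eval σ) (e.eval σ), i.cost σ + j.cost σ + e.cost σ + 1)
  | seq s t, σ =>
    let r := s.run σ
    let r' := t.run r.1
    (r'.1, r.2 + r'.2)
  | ite e s t, σ =>
    let r := if e.eval σ ≠ 0 then s.run σ else t.run σ
    (r.1, e.cost σ + r.2 + 1)
  | loop x e s, σ =>
    let r := iter (fun k τ => s.run (τ.setReg x k)) σ (e.eval σ)
    (r.1, e.cost σ + r.2 + e.eval σ + 1)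

/-- Sequential composition of a list of statements. -/
def block : List (Stmt X Y) → Stmt X Y
  | [] => skip
  | s :: l => seq s (block l)

/-- A conditional without alternative. -/
def when (e : Expr X Y) (l : List (Stmt X Y)) : Stmt X Y :=
  ite e (block l) skip

end Stmt

/-! ## The implementation -/

/-- The registers. The input is in `n`, `kappa`, `num`, `den`, where the stretch is `num / den`;
`cnt` is the number of deployed middleboxes. -/
inductive Reg where
  | n | kappa | num | den
  | total | cnt | done | doneT | opt | best
  | found | fs | ft | cs | ct | act | cur | tmp
  | it | q | r | m | a | s | t | u | v | w
  deriving DecidableEq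

/-- The arrays. The input is in `adj`, `len`, `pairs`, `loc`; the output is in `ord`, the list of
deployed middleboxes, and `asg`, where `asg[s][t]` is `m + 1` if `(s, t)` is assigned to `m`, and `0`
if `(s, t)` is free. One-dimensional arrays use the second index `0` only. -/
inductive Arr where
  | adj | len | pairs | loc
  | dist | lo | hi
  | ord | inM | asg | load | asgT | loadT
  | lev | pre | ps | pt
  deriving DecidableEq

namespace Prog

abbrev E : Type := Expr Reg Arr
abbrev S : Type := Stmt Reg Arr

abbrev rd (x : Reg) : E := .reg x
abbrev num (k : ℕ) : E := .lit k
/-- Read from a one-dimensional array. -/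
abbrev get1 (a : Arr) (i : Reg) : E := .get a (.reg i) (.lit 0)
/-- Read from a two-dimensional array. -/
abbrev get2 (a : Arr) (i j : Reg) : E := .get a (.reg i) (.reg j)
/-- Write to a one-dimensional array. -/
abbrev put1 (a : Arr) (i : Reg) (e : E) : S := .put a (.reg i) (.lit 0) e
/-- Write to a two-dimensional array. -/
abbrev put2 (a : Arr) (i j : Reg) (e : E) : S := .put a (.reg i) (.reg j) e
/-- Loop over all nodes. -/
abbrev forNodes (x : Reg) (l : List S) : S := .loop x (.reg .n) (.block l)
/-- Conjunction of a list of conditions. -/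
def all : List E → E
  | [] => .lit 1
  | e :: l => .and e (all l)

/-- All-pairs shortest paths: `dist[u][v]` becomes `1 + d(u, v)`, or `0` if `v` cannot be reached
from `u`. Then `lo` and `hi` become the distances multiplied by `den` and `num`. -/
def shortestPaths : S := .block [
  forNodes .u [put2 .dist .u .u (num 1)],
  forNodes .r [forNodes .u [forNodes .v [forNodes .w [
    .when (all [get2 .adj .v .w, get2 .dist .u .v]) [
      .set .tmp (.add (get2 .dist .u .v) (get2 .len .v .w)),
      .when (.or (.eq (get2 .dist .u .w) (num 0))
          (.le (.add (rd .tmp) (num 1)) (get2 .dist .u .w))) [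
        put2 .dist .u .w (rd .tmp)]]]]]],
  forNodes .u [forNodes .v [
    put2 .lo .u .v (.mul (rd .den) (.sub (get2 .dist .u .v) (num 1))),
    put2 .hi .u .v (.mul (rd .num) (.sub (get2 .dist .u .v) (num 1)))]]]

/-- The number of pairs. -/
def countPairs : S :=
  forNodes .s [forNodes .t [
    .when (get2 .pairs .s .t) [.set .total (.add (rd .total) (num 1))]]]

/-- The test whether `(a, (s, t))` is an edge of the bipartite graph. -/
def edgeTest : E := all [
  get2 .pairs .s .t, get2 .dist .s .t, get2 .dist .s .a, get2 .dist .a .t,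
  .le (.add (get2 .lo .s .a) (get2 .lo .a .t)) (get2 .hi .s .t)]

/-- Breadth-first search in the bipartite graph of the middleboxes in `inM` and the pairs, relative
to the assignment `asgT` with loads `loadT`, from all middleboxes with free capacity. A middlebox on
the `k`-th level (the first being `1`) gets `lev = k`. If `(s, t)` is reached from `a`, then
`pre[s][t] = a + 1`; if `b` is reached from `(s, t)`, then `ps[b] = s` and `pt[b] = t`. The first
free pair that is reached is recorded in `fs`, `ft`. -/
def search : S := .block [
  .set .found (num 0),
  forNodes .s [forNodes .t [put2 .pre .s .t (num 0)]],
  forNodes .a [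
    put1 .lev .a (num 0),
    .when (all [get1 .inM .a, .le (.add (get1 .loadT .a) (num 1)) (rd .kappa)]) [
      put1 .lev .a (num 1)]],
  forNodes .r [forNodes .a [
    .when (.eq (get1 .lev .a) (.add (rd .r) (num 1))) [
      forNodes .s [forNodes .t [
        .when (all [edgeTest, .eq (get2 .pre .s .t) (num 0),
            .eq (.eq (get2 .asgT .s .t) (.add (rd .a) (num 1))) (num 0)]) [
          put2 .pre .s .t (.add (rd .a) (num 1)),
          .ite (.eq (get2 .asgT .s .t) (num 0))
            (.when (.eq (rd .found) (num 0)) [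
              .set .found (num 1), .set .fs (rd .s), .set .ft (rd .t)])
            (.block [
              .set .cur (.sub (get2 .asgT .s .t) (num 1)),
              .when (.eq (get1 .lev .cur) (num 0)) [
                put1 .lev .cur (.add (rd .r) (num 2)),
                put1 .ps .cur (rd .s),
                put1 .pt .cur (rd .t)]])]]]]]]]

/-- Exchange assignment and non-assignment edges along the path that has been found. -/
def exchange : S :=
  .when (rd .found) [
    .set .doneT (.add (rd .doneT) (num 1)),
    .set .cs (rd .fs),
    .set .ct (rd .ft),
    .set .act (num 1),
    forNodes .r [
      .when (rd .act) [
        .set .cur (.sub (get2 .pre .cs .ct) (num 1)),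
        put2 .asgT .cs .ct (.add (rd .cur) (num 1)),
        .ite (.eq (get1 .lev .cur) (num 1))
          (.block [
            put1 .loadT .cur (.add (get1 .loadT .cur) (num 1)),
            .set .act (num 0)])
          (.block [
            .set .cs (get1 .ps .cur),
            .set .ct (get1 .pt .cur)])]]]

/-- Starting from the current assignment, compute a maximum assignment `asgT` for the middleboxes
in `inM`, with loads `loadT` and size `doneT`, by augmenting paths. -/
def augment : S := .block [
  forNodes .s [put1 .loadT .s (get1 .load .s),
    forNodes .t [put2 .asgT .s .t (get2 .asg .s .t)]],
  .set .doneT (rd .done),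
  .loop .q (rd .total) (.block [search, exchange])]

/-- One iteration of the greedy algorithm. -/
def greedyStep : S := .block [
  .set .opt (num 0),
  forNodes .m [
    .when (all [get1 .loc .m, .eq (get1 .inM .m) (num 0)]) [
      put1 .inM .m (num 1),
      augment,
      put1 .inM .m (num 0),
      .set .tmp (.sub (rd .doneT) (rd .done)),
      .when (.le (.add (rd .opt) (num 1)) (rd .tmp)) [
        .set .opt (rd .tmp),
        .set .best (rd .m)]]],
  .when (rd .opt) [
    put1 .inM .best (num 1),
    put1 .ord .cnt (rd .best),
    .set .cnt (.add (rd .cnt) (num 1)),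
    augment,
    forNodes .s [put1 .load .s (get1 .loadT .s),
      forNodes .t [put2 .asg .s .t (get2 .asgT .s .t)]],
    .set .done (rd .doneT)]]

/-- The greedy algorithm. As every iteration deploys a new middlebox, `n` iterations suffice. -/
def greedy : S := .block [
  shortestPaths,
  countPairs,
  forNodes .it [
    .when (.le (.add (rd .done) (num 1)) (rd .total)) [greedyStep]]]

end Prog

open Classical in
/-- The initial state of the machine on the instance `I` with edge lengths `ℓ` and stretch `a / b`:
everything but the input is zero. -/
noncomputable def Instance.input {n : ℕ} (I : Instance n) (ℓ : Sym2 (Fin n) → ℕ) (a b : ℕ) :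
    State Reg Arr where
  reg
    | .n => n
    | .kappa => I.κ
    | .num => a
    | .den => b
    | _ => 0
  arr
    | .adj => fun i j =>
        if h : i < n ∧ j < n then (if I.G.Adj ⟨i, h.1⟩ ⟨j, h.2⟩ then 1 else 0) else 0
    | .len => fun i j => if h : i < n ∧ j < n then ℓ s(⟨i, h.1⟩, ⟨j, h.2⟩) else 0
    | .pairs => fun i j =>
        if h : i < n ∧ j < n then
          (if ((⟨i, h.1⟩, ⟨j, h.2⟩) : Fin n × Fin n) ∈ I.P then 1 else 0) else 0
    | .loc => fun i j =>
        if h : i < n ∧ j = 0 then (if (⟨i, h.1⟩ : Fin n) ∈ I.U then 1 else 0) else 0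
    | _ => fun _ _ => 0

/-- The configuration that the machine has written as its output. -/
def Outputs {n : ℕ} (σ : State Reg Arr) (x : Config n) : Prop :=
  σ.reg .cnt = x.order.length ∧
  (∀ (i : ℕ) (hi : i < x.order.length), σ.arr .ord i 0 = ((x.order[i] : Fin n) : ℕ)) ∧
  ∀ m s t : Fin n, σ.arr .asg s t = (m : ℕ) + 1 ↔ (m, (s, t)) ∈ x.assign

end Middlebox

namespace Middlebox

/-! ## Augmenting paths -/

section AugmentingPaths

variable {n : ℕ}

/-! Assignments are matchings in `B(M)` with capacities, and everything rests on two facts about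
augmentation. First, flipping a path serves one further pair, keeps the served pairs served, and
increases the load of the path's first middlebox by one while leaving every other load unchanged
(`served_flip`, `load_flip`). Secondly, an assignment without augmenting path is maximum
(`IsPartial.card_eq_φ`). The certificate is a cut: a set of middleboxes all of whose neighbours are
assigned within the set, while every middlebox outside is full (`card_le_of_cut`).

Monotone loads give the inequality behind the greedy bound, `card_le_sum_gain`. Take a maximum
assignment for `M` and augment it to a maximum one for `M ∪ M'`, where `M'` is a solution; now all
pairs are served. The members of `M` still carry at least `φ(M)` pairs, so restricting to `M ∪ {m}`
shows that `m` carries at most its gain. They also carry at most `φ(M)` pairs, so the gains of the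
members of `M'` add up to at least the number `r` of free pairs. Hence some gain is positive while
`r > 0`, and with `K = |M'| > 0` the largest gain is at least `r / K`.

The number of iterations is bounded by a potential, equal to `r` for `r ≤ K` and to `K (1 + log (r /
K))` beyond, which drops by at least one per iteration. Its initial value is controlled by `|P| ≤ K
κ` and by `|P| ≤ n² ≤ K n²`; the square is the reason for the constant `C = 2`.

For the program, invariants show that `n` rounds of relaxation give all distances, that the search
either exhibits the cut above or leaves pointers along an augmenting path, and that `|P|` searches
give a maximum assignment. Trial augmentations thus compute exact gains, so the program performs a
genuine run of the greedy algorithm. Its running time is read off from its syntax: loops are bounded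
by `n` or `|P|`, so the nesting depth bounds the exponent; only the multiplications in `scale` need
bounds on the contents of the memory. -/

@[simp] theorem evenEdges_singleton (e : Edge n) : evenEdges [e] = [] := rfl

@[simp] theorem evenEdges_cons_cons (e f : Edge n) (l : List (Edge n)) :
    evenEdges (e :: f :: l) = (f.1, e.2) :: evenEdges (f :: l) := rfl

/-- An even edge joins the pair of one odd edge to the middlebox of the next. The even edges
therefore miss only the first middlebox and, as the next lemma says, only the last pair. This is why
a flip changes the load at the start only and the service status at the end only. -/
theorem evenEdges_map_fst (π : List (Edge n)) :
    (evenEdges π).map Prod.fst = π.tail.map Prod.fst := by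
  induction π with
  | nil => rfl
  | cons e π ih =>
    cases π with
    | nil => rfl
    | cons f l => simpa using ih

theorem evenEdges_map_snd (π : List (Edge n)) :
    (evenEdges π).map Prod.snd = π.dropLast.map Prod.snd := by
  induction π with
  | nil => rfl
  | cons e π ih =>
    cases π with
    | nil => rfl
    | cons f l => simpa using ih

theorem evenEdges_concat (π : List (Edge n)) (f e : Edge n) :
    evenEdges (π ++ [f] ++ [e]) = evenEdges (π ++ [f]) ++ [(e.1, f.2)] := by
  induction π with
  | nil => rfl
  | cons g π ih =>
    cases π with
    | nil => rfl
    | cons h l => simpa using ih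

/-- On a path each middlebox lies on at most one odd and at most one even edge, so the two lists
contribute 0 or 1 to each load; `load_flip` compares these contributions. -/
theorem card_filter_fst_toFinset (l : List (Edge n)) (h : (l.map Prod.fst).Nodup) (m : Fin n) :
    (l.toFinset.filter fun e => e.1 = m).card = if m ∈ l.map Prod.fst then 1 else 0 := by
  induction l with
  | nil => simp
  | cons e l ih =>
    rw [List.map_cons, List.nodup_cons] at h
    have ih := ih h.2
    have he : e ∉ l.toFinset := fun he => h.1 (List.mem_map_of_mem (List.mem_toFinset.1 he))
    rw [List.toFinset_cons, Finset.filter_insert]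
    by_cases hm : e.1 = m
    · subst hm
      rw [if_neg h.1] at ih
      rw [if_pos rfl, Finset.card_insert_of_notMem (by simp [he]), ih]
      simp
    · rw [if_neg hm, ih, List.map_cons]
      have : m ≠ e.1 := fun h => hm h.symm
      simp [this]

theorem mem_served {A : Finset (Edge n)} {p : Fin n × Fin n} :
    p ∈ served A ↔ ∃ m, (m, p) ∈ A := by
  simp [served]

namespace Instance

variable {I : Instance n} {M M' : Finset (Fin n)} {A A' : Finset (Edge n)} {π : List (Edge n)}

theorem mem_B {e : Edge n} : e ∈ I.B M ↔ e.1 ∈ M ∧ e.2 ∈ I.P ∧ I.Routable e.1 e.2 := by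
  simp [B]

/-! ### Feasible assignments and their maximum size -/

theorem IsPartial.empty : I.IsPartial M ∅ :=
  ⟨by simp, by simp, by simp [load]⟩

theorem IsPartial.mono (h : I.IsPartial M A) (hM : M ⊆ M') : I.IsPartial M' A :=
  ⟨fun _ he => mem_B.2 ⟨hM (mem_B.1 (h.sub he)).1, (mem_B.1 (h.sub he)).2⟩, h.unique, h.cap⟩

theorem IsPartial.card_served (h : I.IsPartial M A) : (served A).card = A.card := by
  apply Finset.card_image_of_injOn
  rintro ⟨m, p⟩ h1 ⟨m', p'⟩ h2 rfl
  rw [h.unique m m' p h1 h2]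

theorem IsPartial.served_subset (h : I.IsPartial M A) : served A ⊆ I.P := by
  intro p hp
  obtain ⟨m, hm⟩ := mem_served.1 hp
  exact (mem_B.1 (h.sub hm)).2.1

theorem IsPartial.complete_iff (h : I.IsPartial M A) : I.Complete A ↔ I.P.card ≤ A.card := by
  rw [← h.card_served]
  exact ⟨Finset.card_le_card, fun hc => (Finset.eq_of_subset_of_card_le h.served_subset hc).ge⟩

theorem IsPartial.card_le (h : I.IsPartial M A) : A.card ≤ I.P.card :=
  h.card_served ▸ Finset.card_le_card h.served_subset

theorem IsPartial.card_le_φ (h : I.IsPartial M A) : A.card ≤ I.φ M := by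
  classical
  exact Finset.le_sup (f := Finset.card)
    (Finset.mem_filter.2 ⟨Finset.mem_powerset.2 h.sub, h⟩)

theorem exists_card_eq_φ (I : Instance n) (M : Finset (Fin n)) :
    ∃ A, I.IsPartial M A ∧ A.card = I.φ M := by
  classical
  obtain ⟨A, hA, h⟩ := Finset.exists_mem_eq_sup
    ((I.B M).powerset.filter fun A => I.IsPartial M A) ⟨∅, by simp [IsPartial.empty]⟩ Finset.card
  exact ⟨A, (Finset.mem_filter.1 hA).2, h.symm⟩

theorem φ_mono (I : Instance n) (h : M ⊆ M') : I.φ M ≤ I.φ M' := by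
  obtain ⟨A, hA, hc⟩ := I.exists_card_eq_φ M
  exact hc ▸ (hA.mono h).card_le_φ

theorem φ_le (I : Instance n) (M : Finset (Fin n)) : I.φ M ≤ I.P.card := by
  obtain ⟨A, hA, hc⟩ := I.exists_card_eq_φ M
  exact hc ▸ hA.card_le

theorem IsDeployment.φ_eq (h : I.IsDeployment M) : I.φ M = I.P.card := by
  obtain ⟨-, A, hA, hc⟩ := h
  exact le_antisymm (I.φ_le M) ((hA.complete_iff.1 hc).trans hA.card_le_φ)

theorem card_eq_sum_load (h : ∀ e ∈ A, e.1 ∈ M) : A.card = ∑ m ∈ M, load A m :=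
  Finset.card_eq_sum_card_fiberwise h

theorem IsPartial.card_le_mul (h : I.IsPartial M A) : A.card ≤ M.card * I.κ := by
  rw [card_eq_sum_load fun e he => (mem_B.1 (h.sub he)).1]
  exact (Finset.sum_le_sum fun m _ => h.cap m).trans (by simp)

/-! ### The effect of one augmentation -/

theorem IsAugPath.eq_concat (h : I.IsAugPath M A π) :
    ∃ ρ e, π = ρ ++ [e] ∧ e.2 ∉ served A := by
  obtain ⟨e, he, hs⟩ := h.finish
  obtain ⟨ρ, rfl⟩ := List.getLast?_eq_some_iff.1 (Option.mem_def.1 he)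
  exact ⟨ρ, e, rfl, hs⟩

theorem IsAugPath.eq_cons (h : I.IsAugPath M A π) :
    ∃ e ρ, π = e :: ρ ∧ load A e.1 < I.κ := by
  obtain ⟨e, he, hs⟩ := h.start
  obtain ⟨ρ, rfl⟩ := List.head?_eq_some_iff.1 (Option.mem_def.1 he)
  exact ⟨e, ρ, rfl, hs⟩

theorem evenEdges_snd_mem {e : Edge n} (h : e ∈ evenEdges π) : e.2 ∈ π.map Prod.snd := by
  have h1 := List.mem_map_of_mem (f := Prod.snd) h
  rw [evenEdges_map_snd] at h1
  obtain ⟨f, hf, hf'⟩ := List.mem_map.1 h1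
  exact List.mem_map.2 ⟨f, List.dropLast_subset _ hf, hf'⟩

/-- If an edge of `A` has its pair on the path, the pair is not the last one, which is free. So the
pair also lies on an even edge, and uniqueness in `A` identifies the two edges. A flip is thus a
reassignment of the path's pairs along the odd edges, with no reference to the even ones; the
program performs it in this form. -/
theorem flip_eq (hA : I.IsPartial M A) (h : I.IsAugPath M A π) :
    flip A π = A.filter (fun e => e.2 ∉ π.map Prod.snd) ∪ π.toFinset := by
  ext e
  simp only [flip, Finset.mem_symmDiff, List.mem_toFinset, List.mem_append, Finset.mem_union,
    Finset.mem_filter]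
  constructor
  · rintro (⟨he, hn⟩ | ⟨he | he, hn⟩)
    · left
      refine ⟨he, fun hmem => ?_⟩
      obtain ⟨ρ, g, hπ, hg⟩ := h.eq_concat
      have : e.2 ∈ (evenEdges π).map Prod.snd := by
        rw [evenEdges_map_snd, hπ, List.dropLast_concat]
        rw [hπ, List.map_append, List.mem_append] at hmem
        rcases hmem with hmem | hmem
        · exact hmem
        · simp only [List.map_cons, List.map_nil, List.mem_singleton] at hmem
          exact absurd (mem_served.2 ⟨e.1, by simpa [← hmem] using he⟩) hg
      obtain ⟨f, hf, hf'⟩ := List.mem_map.1 this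
      have hfe : f = e :=
        Prod.ext (hA.unique f.1 e.1 e.2 (by rw [← hf']; exact h.even f hf) he) hf'
      exact hn (Or.inr (hfe ▸ hf))
    · exact Or.inr he
    · exact absurd (h.even e he) hn
  · rintro (⟨he, hn⟩ | he)
    · refine Or.inl ⟨he, ?_⟩
      rintro (h1 | h1)
      · exact hn (List.mem_map_of_mem h1)
      · exact hn (evenEdges_snd_mem h1)
    · exact Or.inr ⟨Or.inl he, (h.odd e he).2⟩

/-- The new pair is the end of the path. Every other pair of the path lies on an even edge, so it
was served before, and its odd edge serves it afterwards. -/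
theorem served_flip (hA : I.IsPartial M A) (h : I.IsAugPath M A π) :
    ∃ p, p ∉ served A ∧ served (flip A π) = insert p (served A) := by
  obtain ⟨ρ, g, hπ, hg⟩ := h.eq_concat
  refine ⟨g.2, hg, ?_⟩
  ext p
  simp only [mem_served, flip_eq hA h, Finset.mem_union, Finset.mem_filter, List.mem_toFinset,
    Finset.mem_insert]
  constructor
  · rintro ⟨m, ⟨hm, -⟩ | hm⟩
    · exact Or.inr ⟨m, hm⟩
    · have hm2 : p ∈ π.map Prod.snd := List.mem_map_of_mem (f := Prod.snd) hm
      rw [hπ, List.map_append, List.mem_append] at hm2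
      rcases hm2 with hm2 | hm2
      · right
        have : p ∈ (evenEdges π).map Prod.snd := by
          rwa [evenEdges_map_snd, hπ, List.dropLast_concat]
        obtain ⟨f, hf, rfl⟩ := List.mem_map.1 this
        exact ⟨f.1, h.even f hf⟩
      · exact Or.inl (by simpa using hm2)
  · rintro (rfl | ⟨m, hm⟩)
    · exact ⟨g.1, Or.inr (by simp [hπ])⟩
    · by_cases hp : p ∈ π.map Prod.snd
      · obtain ⟨f, hf, rfl⟩ := List.mem_map.1 hp
        exact ⟨f.1, Or.inr hf⟩
      · exact ⟨m, Or.inl ⟨hm, hp⟩⟩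

/-- A middlebox inside the path exchanges one even edge for one odd edge; only the first one gains
an edge without losing one. -/
theorem load_flip (h : I.IsAugPath M A π) (m : Fin n) :
    load (flip A π) m = load A m + if π.head?.map Prod.fst = some m then 1 else 0 := by
  have hsub : (evenEdges π).toFinset ⊆ A := fun e he => h.even e (List.mem_toFinset.1 he)
  have hdis : Disjoint (A \ (evenEdges π).toFinset) π.toFinset :=
    Finset.disjoint_right.2 fun e he he' =>
      (h.odd e (List.mem_toFinset.1 he)).2 (Finset.mem_sdiff.1 he').1
  have hflip : flip A π = (A \ (evenEdges π).toFinset) ∪ π.toFinset := by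
    ext e
    have h1 := h.odd e
    have h2 := h.even e
    simp only [flip, Finset.mem_symmDiff, List.mem_toFinset, List.mem_append, Finset.mem_union,
      Finset.mem_sdiff]
    tauto
  have hnd := h.nodup_left
  have hev : ((evenEdges π).map Prod.fst).Nodup := by
    rw [evenEdges_map_fst, List.map_tail]
    exact hnd.tail
  have hcard : load (A \ (evenEdges π).toFinset) m +
      (if m ∈ (evenEdges π).map Prod.fst then 1 else 0) = load A m := by
    rw [← card_filter_fst_toFinset _ hev, load, load,
      ← Finset.card_union_of_disjoint (Finset.disjoint_filter_filter Finset.sdiff_disjoint),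
      ← Finset.filter_union, Finset.sdiff_union_of_subset hsub]
  have hload : load (flip A π) m = load (A \ (evenEdges π).toFinset) m +
      if m ∈ π.map Prod.fst then 1 else 0 := by
    rw [← card_filter_fst_toFinset _ hnd, hflip, load, load, Finset.filter_union,
      Finset.card_union_of_disjoint (Finset.disjoint_filter_filter hdis)]
  rw [hload, ← hcard, evenEdges_map_fst]
  obtain ⟨e, ρ, rfl, -⟩ := h.eq_cons
  rw [List.map_cons, List.nodup_cons] at hnd
  by_cases h1 : m = e.1
  · subst h1
    simp only [List.tail_cons, hnd.1, if_false, List.map_cons, List.mem_cons, true_or, if_true]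
    simp
  · have h2 : e.1 ≠ m := fun h => h1 h.symm
    simp [h1, h2]

theorem load_le_load_flip (h : I.IsAugPath M A π) (m : Fin n) :
    load A m ≤ load (flip A π) m := by
  rw [load_flip h]; omega

theorem IsPartial.flip (hA : I.IsPartial M A) (h : I.IsAugPath M A π) :
    I.IsPartial M (flip A π) := by
  refine ⟨?_, ?_, ?_⟩
  · intro e he
    rw [flip_eq hA h, Finset.mem_union, Finset.mem_filter, List.mem_toFinset] at he
    rcases he with he | he
    · exact hA.sub he.1
    · exact (h.odd e he).1
  · intro m m' p h1 h2
    rw [flip_eq hA h, Finset.mem_union, Finset.mem_filter, List.mem_toFinset] at h1 h2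
    rcases h1 with h1 | h1 <;> rcases h2 with h2 | h2
    · exact hA.unique m m' p h1.1 h2.1
    · exact absurd (List.mem_map_of_mem (f := Prod.snd) h2) h1.2
    · exact absurd (List.mem_map_of_mem (f := Prod.snd) h1) h2.2
    · exact congrArg Prod.fst (List.inj_on_of_nodup_map h.nodup_right h1 h2 rfl)
  · intro m
    rw [load_flip h]
    split_ifs with hm
    · obtain ⟨e, ρ, rfl, he⟩ := h.eq_cons
      simp only [List.head?_cons, Option.map_some, Option.some.injEq] at hm
      subst hm
      exact he
    · exact hA.cap m

theorem card_flip (hA : I.IsPartial M A) (h : I.IsAugPath M A π) :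
    (Middlebox.flip A π).card = A.card + 1 := by
  obtain ⟨p, hp, hs⟩ := served_flip hA h
  rw [← (hA.flip h).card_served, hs, Finset.card_insert_of_notMem hp, hA.card_served]

/-! ## Maximum assignments -/

/-- A set `Z` of middleboxes outside of which all middleboxes are fully loaded, and such that all
neighbours of `Z` are assigned to `Z`, certifies that the assignment is maximum. -/
theorem IsPartial.card_le_of_cut (hA : I.IsPartial M A) (hA' : I.IsPartial M A')
    (Z : Fin n → Prop) (hfull : ∀ m ∈ M, ¬ Z m → I.κ ≤ load A m)
    (hclosed : ∀ m p, Z m → (m, p) ∈ I.B M → ∃ m', Z m' ∧ (m', p) ∈ A) :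
    A'.card ≤ A.card := by
  classical
  rw [← Finset.card_filter_add_card_filter_not (s := A') fun e => Z e.1,
    ← Finset.card_filter_add_card_filter_not (s := A) fun e => Z e.1]
  refine add_le_add ?_ ?_
  -- Edges of `A'` at `Z` are determined by their pairs, and by closedness each of these pairs is
  -- also assigned within `Z` by `A`.
  · have hinj : Set.InjOn Prod.snd (A'.filter fun e => Z e.1 : Set (Edge n)) := by
      rintro ⟨m, p⟩ h1 ⟨m', p'⟩ h2 rfl
      rw [hA'.unique m m' p (Finset.mem_filter.1 h1).1 (Finset.mem_filter.1 h2).1]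
    rw [← Finset.card_image_of_injOn hinj]
    refine (Finset.card_le_card fun p hp => ?_).trans
      (Finset.card_image_le (s := A.filter fun e => Z e.1) (f := Prod.snd))
    obtain ⟨e, he, rfl⟩ := Finset.mem_image.1 hp
    rw [Finset.mem_filter] at he
    obtain ⟨m', hm', hmem⟩ := hclosed e.1 e.2 he.2 (hA'.sub he.1)
    exact Finset.mem_image.2 ⟨(m', e.2), Finset.mem_filter.2 ⟨hmem, hm'⟩, rfl⟩
  -- Outside `Z` the edges are counted by loads: those of `A'` are at most `κ`, those of `A` at
  -- least `κ`.
  · have key : ∀ A₁, I.IsPartial M A₁ → (A₁.filter fun e => ¬ Z e.1).card =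
        ∑ m ∈ M.filter fun m => ¬ Z m, load A₁ m := by
      intro A₁ h₁
      rw [card_eq_sum_load (M := M.filter fun m => ¬ Z m)]
      · refine Finset.sum_congr rfl fun m hm => ?_
        rw [load, load, Finset.filter_filter]
        congr 1
        ext e
        have := (Finset.mem_filter.1 hm).2
        simp only [Finset.mem_filter]
        constructor
        · tauto
        · rintro ⟨h1, rfl⟩
          tauto
      · intro e he
        rw [Finset.mem_filter] at he ⊢
        exact ⟨(mem_B.1 (h₁.sub he.1)).1, he.2⟩
    rw [key A' hA', key A hA]
    refine Finset.sum_le_sum fun m hm => ?_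
    rw [Finset.mem_filter] at hm
    exact (hA'.cap m).trans (hfull m hm.1 hm.2)

/-- An alternating path that starts at the middlebox `m` and ends at a free pair. -/
structure IsAltPath (I : Instance n) (M : Finset (Fin n)) (A : Finset (Edge n)) (m : Fin n)
    (π : List (Edge n)) : Prop where
  head : ∃ e ∈ π.head?, e.1 = m
  finish : ∃ e ∈ π.getLast?, e.2 ∉ served A
  odd : ∀ e ∈ π, e ∈ I.B M ∧ e ∉ A
  even : ∀ e ∈ evenEdges π, e ∈ A
  nodup_left : (π.map Prod.fst).Nodup

theorem IsAltPath.tail {m : Fin n} {e f : Edge n} {ρ : List (Edge n)}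
    (h : I.IsAltPath M A m (e :: f :: ρ)) : I.IsAltPath M A f.1 (f :: ρ) :=
  ⟨by simp, by simpa using h.finish, fun e' he' => h.odd e' (List.mem_cons_of_mem _ he'),
    fun e' he' => h.even e' (by rw [evenEdges_cons_cons]; exact List.mem_cons_of_mem _ he'),
    (List.nodup_cons.1 h.nodup_left).2⟩

theorem IsAltPath.exists_of_mem {m m' : Fin n} (h : I.IsAltPath M A m π)
    (hm : m' ∈ π.map Prod.fst) : ∃ ρ, I.IsAltPath M A m' ρ := by
  induction π generalizing m with
  | nil => simp at hm
  | cons e π ih =>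
    rw [List.map_cons, List.mem_cons] at hm
    rcases hm with rfl | hm
    · exact ⟨e :: π, ⟨by simp, h.finish, h.odd, h.even, h.nodup_left⟩⟩
    · cases π with
      | nil => simp at hm
      | cons f l => exact ih h.tail hm

/-- All pairs but the last lie on even edges. These edges have distinct middleboxes, hence are
distinct edges of `A`, hence have distinct pairs; the last pair is free and so differs from all of
them. Consequently only the middleboxes need watching when paths are built. -/
theorem nodup_right_of_nodup_left {ρ : List (Edge n)} {e : Edge n}
    (hA : I.IsPartial M A) (hfree : e.2 ∉ served A)
    (heven : ∀ e' ∈ evenEdges (ρ ++ [e]), e' ∈ A)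
    (hnd : ((ρ ++ [e]).map Prod.fst).Nodup) : ((ρ ++ [e]).map Prod.snd).Nodup := by
  have h1 : (ρ.map Prod.snd) = (evenEdges (ρ ++ [e])).map Prod.snd := by
    rw [evenEdges_map_snd, List.dropLast_concat]
  have h2 : (evenEdges (ρ ++ [e])).Nodup := by
    apply List.Nodup.of_map Prod.fst
    rw [evenEdges_map_fst, List.map_tail]
    exact hnd.tail
  rw [List.map_append, h1, List.nodup_append']
  refine ⟨h2.map_on ?_, by simp, ?_⟩
  · intro x hx y hy hxy
    exact Prod.ext (hA.unique _ _ x.2 (heven x hx) (by rw [hxy]; exact heven y hy)) hxy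
  · intro p hp hp'
    simp only [List.map_cons, List.map_nil, List.mem_singleton] at hp'
    obtain ⟨f, hf, rfl⟩ := List.mem_map.1 hp
    exact hfree (mem_served.2 ⟨f.1, by rw [← hp']; exact heven f hf⟩)

theorem IsAltPath.isAugPath {m : Fin n} (hA : I.IsPartial M A) (h : I.IsAltPath M A m π)
    (hm : load A m < I.κ) : I.IsAugPath M A π := by
  refine ⟨?_, h.finish, h.odd, h.even, h.nodup_left, ?_⟩
  · obtain ⟨e, he, rfl⟩ := h.head
    exact ⟨e, he, hm⟩
  · obtain ⟨e, he, hs⟩ := h.finish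
    obtain ⟨ρ, rfl⟩ := List.getLast?_eq_some_iff.1 (Option.mem_def.1 he)
    exact nodup_right_of_nodup_left hA hs h.even h.nodup_left

/-- An assignment without augmenting path is maximum. -/
theorem IsPartial.card_eq_φ (hA : I.IsPartial M A) (h : ¬ ∃ π, I.IsAugPath M A π) :
    A.card = I.φ M := by
  refine le_antisymm hA.card_le_φ ?_
  obtain ⟨A', hA', hc⟩ := I.exists_card_eq_φ M
  rw [← hc]
  -- The cut consists of the middleboxes from which no alternating path leads to a free pair. A
  -- middlebox outside it must be full, since its alternating path would otherwise be augmenting.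
  refine hA.card_le_of_cut hA' (fun m => ¬ ∃ π, I.IsAltPath M A m π) ?_ ?_
  · intro m hm hZ
    obtain ⟨π, hπ⟩ := not_not.1 hZ
    by_contra hlt
    exact h ⟨π, hπ.isAugPath hA (not_le.1 hlt)⟩
  · intro m p hm hmp
    by_cases hmA : (m, p) ∈ A
    · exact ⟨m, hm, hmA⟩
    by_cases hp : p ∈ served A
    · obtain ⟨m', hm'⟩ := mem_served.1 hp
      refine ⟨m', ?_, hm'⟩
      rintro ⟨π, hπ⟩
      apply hm
      -- A path from the owner `m'` of `p` would yield one from `m`: cut it at `m` if it passes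
      -- through `m`, otherwise prepend `(m, p)`, whose link to the path is the assignment edge
      -- `(m', p)`.
      by_cases hmem : m ∈ π.map Prod.fst
      · exact hπ.exists_of_mem hmem
      · obtain ⟨e, he, hem⟩ := hπ.head
        obtain ⟨ρ, rfl⟩ := List.head?_eq_some_iff.1 (Option.mem_def.1 he)
        refine ⟨(m, p) :: e :: ρ, by simp, by simpa using hπ.finish, ?_, ?_, ?_⟩
        · intro f hf
          rcases List.mem_cons.1 hf with rfl | hf
          · exact ⟨hmp, hmA⟩
          · exact hπ.odd f hf
        · intro f hf
          rw [evenEdges_cons_cons] at hf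
          rcases List.mem_cons.1 hf with rfl | hf
          · rw [hem]; exact hm'
          · exact hπ.even f hf
        · rw [List.map_cons, List.nodup_cons]
          exact ⟨hmem, hπ.nodup_left⟩
    · exact absurd ⟨[(m, p)], by simp, by simpa using hp, by simp [hmp, hmA], by simp, by simp⟩ hm

theorem IsPartial.not_isAugPath (hA : I.IsPartial M A) (h : I.φ M ≤ A.card) :
    ¬ ∃ π, I.IsAugPath M A π := by
  rintro ⟨π, hπ⟩
  have h1 := (hA.flip hπ).card_le_φ
  rw [card_flip hA hπ] at h1
  omega

/-- What is preserved by augmentations. -/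
theorem IsPartial.reflTransGen (hA : I.IsPartial M A)
    (h : Relation.ReflTransGen (I.AugStep M) A A') :
    I.IsPartial M A' ∧ served A ⊆ served A' ∧ ∀ m, load A m ≤ load A' m := by
  induction h with
  | refl => exact ⟨hA, subset_rfl, fun _ => le_rfl⟩
  | tail _ hstep ih =>
    obtain ⟨ih1, ih2, ih3⟩ := ih
    obtain ⟨π, hπ, rfl⟩ := hstep
    refine ⟨ih1.flip hπ, ih2.trans ?_, fun m => (ih3 m).trans (load_le_load_flip hπ m)⟩
    obtain ⟨p, -, hs⟩ := served_flip ih1 hπ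
    rw [hs]
    exact Finset.subset_insert _ _

theorem IsPartial.exists_augmentTo (hA : I.IsPartial M A) : ∃ A', I.AugmentTo M A A' := by
  obtain ⟨k, hk⟩ : ∃ k, I.φ M - A.card = k := ⟨_, rfl⟩
  induction k generalizing A with
  | zero => exact ⟨A, .refl, hA.not_isAugPath (by omega)⟩
  | succ k ih =>
    by_cases h : ∃ π, I.IsAugPath M A π
    · obtain ⟨π, hπ⟩ := h
      obtain ⟨A', h1, h2⟩ := ih (hA.flip hπ) (by rw [card_flip hA hπ]; omega)
      exact ⟨A', .head ⟨π, hπ, rfl⟩ h1, h2⟩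
    · exact ⟨A, .refl, h⟩

theorem IsPartial.augmentTo (hA : I.IsPartial M A) (h : I.AugmentTo M A A') :
    I.IsPartial M A' ∧ A'.card = I.φ M ∧ served A ⊆ served A' ∧ ∀ m, load A m ≤ load A' m := by
  obtain ⟨h1, h2, h3⟩ := hA.reflTransGen h.1
  exact ⟨h1, h1.card_eq_φ h.2, h2, h3⟩

end Instance

end AugmentingPaths

/-! ## The greedy algorithm -/

section Greedy

namespace Instance

variable {n : ℕ} {I : Instance n} {M M' : Finset (Fin n)} {A A' : Finset (Edge n)}
  {x y : Config n}

theorem IsPartial.restrict (h : I.IsPartial M' A) (M : Finset (Fin n)) :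
    I.IsPartial M (A.filter fun e => e.1 ∈ M) ∧
      (A.filter fun e => e.1 ∈ M).card = ∑ m ∈ M, load A m := by
  refine ⟨⟨fun e he => ?_, fun m m' p h1 h2 => ?_, fun m => ?_⟩, ?_⟩
  · rw [Finset.mem_filter] at he
    exact mem_B.2 ⟨he.2, (mem_B.1 (h.sub he.1)).2⟩
  · exact h.unique m m' p (Finset.mem_filter.1 h1).1 (Finset.mem_filter.1 h2).1
  · exact (Finset.card_le_card (Finset.filter_subset_filter _ (Finset.filter_subset _ _))).trans
      (h.cap m)
  · rw [card_eq_sum_load (M := M) fun e he => (Finset.mem_filter.1 he).2]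
    refine Finset.sum_congr rfl fun m hm => ?_
    rw [load, load, Finset.filter_filter]
    congr 1
    ext e
    simp only [Finset.mem_filter]
    constructor
    · tauto
    · rintro ⟨h1, rfl⟩
      tauto

theorem φ_add_gain (I : Instance n) (M : Finset (Fin n)) (m : Fin n) :
    I.φ M + I.gain M m = I.φ (insert m M) :=
  Nat.add_sub_cancel' (I.φ_mono (Finset.subset_insert m M))

theorem gain_of_mem {m : Fin n} (h : m ∈ M) : I.gain M m = 0 := by
  rw [gain, Finset.insert_eq_of_mem h, Nat.sub_self]

/-- The middleboxes of a solution can together serve all pairs that are still free. -/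
theorem IsDeployment.card_le_sum_gain (h : I.IsDeployment M') (M : Finset (Fin n)) :
    I.P.card ≤ I.φ M + ∑ m ∈ M', I.gain M m := by
  classical
  obtain ⟨A, hA, hc⟩ := I.exists_card_eq_φ M
  -- Starting from the maximum assignment `A` for `M`, rather than taking any maximum assignment for
  -- the union, ensures that no load falls below its value in `A`.
  obtain ⟨A', hA'⟩ := (hA.mono (Finset.subset_union_left (s₂ := M'))).exists_augmentTo
  obtain ⟨hp, hc', -, hl⟩ := (hA.mono (Finset.subset_union_left (s₂ := M'))).augmentTo hA'
  have h1 : I.P.card ≤ A'.card := by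
    rw [hc', ← h.φ_eq]
    exact I.φ_mono Finset.subset_union_right
  rw [card_eq_sum_load fun e he => (mem_B.1 (hp.sub he)).1, ← Finset.union_sdiff_self_eq_union,
    Finset.sum_union Finset.disjoint_sdiff] at h1
  have h2 : ∑ m ∈ M, load A' m ≤ I.φ M := by
    rw [← (hp.restrict M).2]
    exact (hp.restrict M).1.card_le_φ
  -- On `insert m M` the assignment `A'` has `load A' m` edges at `m` and at least `|A| = φ M` edges
  -- at `M`, and together these are at most `φ (insert m M)`.
  have h3 : ∀ m ∈ M' \ M, load A' m ≤ I.gain M m := by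
    intro m hm
    have h4 := (hp.restrict (insert m M)).1.card_le_φ
    rw [(hp.restrict (insert m M)).2, Finset.sum_insert (Finset.mem_sdiff.1 hm).2,
      ← φ_add_gain, ← hc, card_eq_sum_load fun e he => (mem_B.1 (hA.sub he)).1] at h4
    have := Finset.sum_le_sum fun m (_ : m ∈ M) => hl m
    omega
  have h5 := (Finset.sum_le_sum h3).trans
    (Finset.sum_le_sum_of_subset (f := fun m => I.gain M m) (Finset.sdiff_subset (s := M') (t := M)))
  omega

theorem placed_concat {m : Fin n} (h : y.order = x.order ++ [m]) :
    y.placed = insert m x.placed := by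
  ext; simp [Config.placed, h]

/-- The invariant of the greedy algorithm. -/
structure IsGreedy (I : Instance n) (x : Config n) : Prop where
  nodup : x.order.Nodup
  sub : x.placed ⊆ I.U
  isPartial : I.IsPartial x.placed x.assign
  card_eq : x.assign.card = I.φ x.placed

theorem IsGreedy.nil : I.IsGreedy ⟨[], ∅⟩ := by
  refine ⟨by simp, by simp [Config.placed], IsPartial.empty, ?_⟩
  obtain ⟨A, hA, hc⟩ := I.exists_card_eq_φ (Config.placed ⟨[], ∅⟩)
  have : A = ∅ := Finset.eq_empty_of_forall_notMem fun e he => by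
    simpa [Config.placed] using (mem_B.1 (hA.sub he)).1
  rw [← hc, this]

theorem IsGreedy.step (h : I.IsGreedy x) (hs : I.Step x y) :
    I.IsGreedy y ∧ served x.assign ⊆ served y.assign := by
  obtain ⟨-, m, hm, -, -, ho, ha⟩ := hs
  have hpl := placed_concat ho
  rw [Finset.mem_sdiff] at hm
  obtain ⟨h1, h2, h3, -⟩ := (h.isPartial.mono (Finset.subset_insert m _)).augmentTo ha
  refine ⟨⟨?_, ?_, hpl ▸ h1, hpl ▸ h2⟩, h3⟩
  · rw [ho, List.nodup_append']
    refine ⟨h.nodup, by simp, ?_⟩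
    rw [List.disjoint_singleton]
    simpa [Config.placed] using hm.2
  · rw [hpl]
    exact Finset.insert_subset hm.1 h.sub

theorem Reach.isGreedy (h : I.Reach x) : I.IsGreedy x := by
  induction h with
  | refl => exact .nil
  | tail _ hs ih => exact (ih.step hs).1

theorem IsGreedy.complete_iff (h : I.IsGreedy x) :
    I.Complete x.assign ↔ I.P.card ≤ I.φ x.placed := by
  rw [h.isPartial.complete_iff, h.card_eq]

/-- By `card_le_sum_gain`, a solution whose members all have gain zero would leave no pair free. -/
theorem IsGreedy.exists_step (h : I.IsGreedy x) (hM : I.IsDeployment M)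
    (hx : ¬ I.Complete x.assign) : ∃ y, I.Step x y := by
  have h1 := hM.card_le_sum_gain x.placed
  have h2 : ∃ m ∈ M, 0 < I.gain x.placed m := by
    by_contra! hcon
    rw [Finset.sum_eq_zero fun m hm => Nat.le_zero.1 (hcon m hm)] at h1
    exact hx (h.complete_iff.2 h1)
  obtain ⟨m₀, hm₀, hpos⟩ := h2
  have hmem : m₀ ∈ I.U \ x.placed := by
    rw [Finset.mem_sdiff]
    refine ⟨hM.1 hm₀, fun hp => ?_⟩
    rw [gain_of_mem hp] at hpos
    exact lt_irrefl _ hpos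
  obtain ⟨m, hm, hmax⟩ := Finset.exists_max_image (I.U \ x.placed) (I.gain x.placed) ⟨m₀, hmem⟩
  obtain ⟨A', hA'⟩ := (h.isPartial.mono (Finset.subset_insert m _)).exists_augmentTo
  exact ⟨⟨x.order ++ [m], A'⟩, hx, m, hm, hpos.trans_le (hmax m₀ hmem), hmax, rfl, hA'⟩

/-- Every iteration serves at least the average number of pairs served by a middlebox of an optimal
solution. -/
theorem Step.card_le (hM : I.IsDeployment M) (h : I.Step x y) :
    I.P.card + M.card * I.φ x.placed ≤ I.φ x.placed + M.card * I.φ y.placed := by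
  obtain ⟨-, m, hm, -, hmax, ho, -⟩ := h
  rw [placed_concat ho, ← φ_add_gain, mul_add]
  -- Members of the solution that are already deployed have gain zero, so the maximum over the
  -- remaining locations dominates every term.
  have h1 : ∑ m' ∈ M, I.gain x.placed m' ≤ M.card * I.gain x.placed m := by
    rw [← smul_eq_mul]
    refine Finset.sum_le_card_nsmul _ _ _ fun m' hm' => ?_
    by_cases hp : m' ∈ x.placed
    · rw [gain_of_mem hp]
      exact Nat.zero_le _
    · exact hmax m' (Finset.mem_sdiff.2 ⟨hM.1 hm', hp⟩)
  have h2 := hM.card_le_sum_gain x.placed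
  omega

end Instance

/-! ### The potential function for the number of iterations -/

/-- An upper bound for the number of greedy iterations that are needed to serve `r` further pairs
if there is a solution with `K` middleboxes. -/
noncomputable def greedyPotential (K r : ℝ) : ℝ :=
  if r ≤ K then r else K * (1 + Real.log (r / K))

/-- Here `r` and `r'` count the free pairs before and after an iteration, and `h2` is the averaging
bound. While `r' > K`, the drop is `K log (r / r') ≥ K (1 - r' / r) ≥ 1`; when `r ≤ K`, it is `r -
r' ≥ 1`. If the threshold is crossed, `log (r / K) ≥ 1 - K / r` combines with `r' ≤ K`. -/
theorem greedyPotential_add_one_le {K r r' : ℝ} (hK : 0 < K) (hr' : 0 ≤ r') (h1 : r' + 1 ≤ r)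
    (h2 : r ≤ K * (r - r')) : greedyPotential K r' + 1 ≤ greedyPotential K r := by
  have hr : 0 < r := by linarith
  unfold greedyPotential
  have hstep : 1 ≤ K / r * (r - r') := by
    rw [div_mul_eq_mul_div, le_div_iff₀ hr]
    linarith
  have hexp : K / r * (r - r') = K - K * (r' / r) := by field_simp
  by_cases hrK : r ≤ K
  · rw [if_pos hrK, if_pos (by linarith)]
    exact h1
  rw [if_neg hrK]
  by_cases hrK' : r' ≤ K
  · rw [if_pos hrK']
    have hlog := Real.log_le_sub_one_of_pos (div_pos hK hr)
    have hinv : Real.log (r / K) = - Real.log (K / r) := by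
      rw [← Real.log_inv, inv_div]
    have h3 : r' * (1 - K / r) ≤ K * (1 - K / r) := by
      refine mul_le_mul_of_nonneg_right hrK' ?_
      rw [sub_nonneg, div_le_one hr]
      exact (not_le.1 hrK).le
    have h4 : K * (1 - K / r) ≤ K * Real.log (r / K) :=
      mul_le_mul_of_nonneg_left (by linarith) hK.le
    have h5 : K * (r' / r) = r' * (K / r) := by ring
    linarith
  · rw [if_neg hrK']
    have hr'0 : 0 < r' := hK.trans (not_le.1 hrK')
    have hlog := Real.log_le_sub_one_of_pos (div_pos hr'0 hr)
    rw [Real.log_div hr'0.ne' hr.ne'] at hlog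
    rw [Real.log_div hr'0.ne' hK.ne', Real.log_div hr.ne' hK.ne']
    have h3 := mul_le_mul_of_nonneg_left hlog hK.le
    linarith

theorem greedyPotential_le {K r B : ℝ} (hK : 0 < K) (hB : 1 ≤ B) (h : r ≤ K * B) :
    greedyPotential K r ≤ (1 + Real.log B) * K := by
  unfold greedyPotential
  split_ifs with hr
  · nlinarith [Real.log_nonneg hB]
  · rw [mul_comm]
    refine mul_le_mul_of_nonneg_right ?_ hK.le
    have hr0 : 0 < r := hK.trans (not_le.1 hr)
    have : Real.log (r / K) ≤ Real.log B :=
      Real.log_le_log (div_pos hr0 hK) ((div_le_iff₀ hK).2 (by linarith))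
    linarith

namespace Instance

variable {n : ℕ} {I : Instance n} {M : Finset (Fin n)} {x : Config n}

/-- Amortization: deployed middleboxes plus remaining potential never increase along a run. -/
theorem Reach.length_add_le (h : I.Reach x) (hM : I.IsDeployment M) (hpos : 0 < M.card) :
    (x.order.length : ℝ) + greedyPotential M.card ((I.P.card : ℝ) - I.φ x.placed) ≤
      greedyPotential M.card I.P.card := by
  induction h with
  | refl =>
    have h0 : I.φ (Config.placed ⟨[], ∅⟩) = 0 := by
      rw [← (IsGreedy.nil (I := I)).card_eq]; rfl
    simp [h0]
  | @tail y z hxy hs ih =>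
    have hg : I.IsGreedy y := Reach.isGreedy hxy
    have h1 : (I.P.card : ℝ) + M.card * I.φ y.placed ≤ I.φ y.placed + M.card * I.φ z.placed := by
      exact_mod_cast Step.card_le hM hs
    have h2 : (I.φ z.placed : ℝ) ≤ I.P.card := by exact_mod_cast I.φ_le _
    obtain ⟨-, m, -, hgain, -, ho, -⟩ := hs
    have h3 : (I.φ y.placed : ℝ) + 1 ≤ I.φ z.placed := by
      rw [placed_concat ho, ← φ_add_gain]
      exact_mod_cast Nat.add_le_add_left hgain _
    have h4 := greedyPotential_add_one_le (K := M.card) (r := (I.P.card : ℝ) - I.φ y.placed)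
      (r' := (I.P.card : ℝ) - I.φ z.placed) (by exact_mod_cast hpos) (by linarith) (by linarith)
      (by linarith)
    rw [ho, List.length_append, List.length_singleton]
    push_cast
    linarith

/-- The approximation ratio of the greedy algorithm. -/
theorem Reach.length_le (h : I.Reach x) (hc : I.Complete x.assign) (hM : I.IsDeployment M) :
    (x.order.length : ℝ) ≤ (1 + 2 * Real.log (min I.κ n : ℕ)) * M.card ∧
      (x.order.length : ℝ) ≤ (1 + 2 * Real.log n) * M.card := by
  have hκ : I.P.card ≤ M.card * I.κ := by
    obtain ⟨-, A, hA, hcA⟩ := hM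
    exact (hA.complete_iff.1 hcA).trans hA.card_le_mul
  have hlog : ∀ k : ℕ, 0 ≤ Real.log k := fun k => Real.log_natCast_nonneg k
  -- Without pairs the empty set is a solution and the potential, which needs `K > 0`, is not
  -- available; but then the algorithm makes no iteration.
  by_cases hP : I.P.card = 0
  · have hx : x.order = [] := by
      rcases Relation.ReflTransGen.cases_head h with rfl | ⟨y, hy, -⟩
      · rfl
      · exact absurd ((IsGreedy.nil (I := I)).complete_iff.2 (by omega)) hy.1
    rw [hx]
    simp only [List.length_nil, Nat.cast_zero]
    exact ⟨mul_nonneg (by linarith [hlog (min I.κ n)]) (Nat.cast_nonneg _),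
      mul_nonneg (by linarith [hlog n]) (Nat.cast_nonneg _)⟩
  have hpos : 0 < M.card := Nat.pos_of_ne_zero fun h0 => by rw [h0] at hκ; omega
  have hκ1 : 1 ≤ I.κ := Nat.pos_of_ne_zero fun h0 => by rw [h0] at hκ; omega
  have hn1 : 1 ≤ n := (hpos.trans_le (Finset.card_le_univ M)).trans_eq (Fintype.card_fin n)
  have hn : I.P.card ≤ M.card * n ^ 2 := by
    have h1 : I.P.card ≤ n ^ 2 := by
      refine (Finset.card_le_univ I.P).trans_eq ?_
      rw [Fintype.card_prod, Fintype.card_fin, sq]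
    exact h1.trans (Nat.le_mul_of_pos_left _ hpos)
  have hK : (0 : ℝ) < M.card := by exact_mod_cast hpos
  have h0 : greedyPotential M.card ((I.P.card : ℝ) - I.φ x.placed) = 0 := by
    have h1 : I.φ x.placed = I.P.card :=
      le_antisymm (I.φ_le _) ((Reach.isGreedy h).complete_iff.1 hc)
    rw [h1, sub_self, greedyPotential, if_pos hK.le]
  have hlen := Reach.length_add_le h hM hpos
  rw [h0, add_zero] at hlen
  have hbn : (x.order.length : ℝ) ≤ (1 + 2 * Real.log n) * M.card := by
    have h1 := greedyPotential_le (r := I.P.card) (B := (n : ℝ) ^ 2) hK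
      (one_le_pow₀ (by exact_mod_cast hn1)) (by exact_mod_cast hn)
    rw [Real.log_pow] at h1
    exact hlen.trans (by exact_mod_cast h1)
  refine ⟨?_, hbn⟩
  -- For `κ ≤ n` the bound `|P| ≤ K κ` gives even the factor `1 + log κ`; otherwise the minimum is
  -- `n`, and the bound through `n²` applies.
  rcases le_total I.κ n with h1 | h1
  · rw [min_eq_left h1]
    have h2 := greedyPotential_le (r := I.P.card) (B := (I.κ : ℝ)) hK
      (by exact_mod_cast hκ1) (by exact_mod_cast hκ)
    refine (hlen.trans h2).trans (mul_le_mul_of_nonneg_right ?_ hK.le)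
    linarith [hlog I.κ]
  · rwa [min_eq_right h1]

theorem IsGreedy.isDeployment (h : I.IsGreedy x) (hc : I.Complete x.assign) :
    I.IsDeployment x.placed :=
  ⟨h.sub, x.assign, h.isPartial, hc⟩

end Instance

end Greedy

/-! ## Reasoning about programs -/

section Machine

variable {X Y : Type}

namespace Expr

/-- All factors of multiplications have at most `N` bits. -/
def SmallFactors (N : ℕ) (σ : State X Y) : Expr X Y → Prop
  | lit _ => True
  | reg _ => True
  | get _ i j => i.SmallFactors N σ ∧ j.SmallFactors N σ
  | add e f => e.SmallFactors N σ ∧ f.SmallFactors N σ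
  | mul e f => e.SmallFactors N σ ∧ f.SmallFactors N σ ∧
      (e.eval σ).size ≤ N ∧ (f.eval σ).size ≤ N
  | sub e f => e.SmallFactors N σ ∧ f.SmallFactors N σ
  | le e f => e.SmallFactors N σ ∧ f.SmallFactors N σ
  | eq e f => e.SmallFactors N σ ∧ f.SmallFactors N σ
  | and e f => e.SmallFactors N σ ∧ f.SmallFactors N σ
  | or e f => e.SmallFactors N σ ∧ f.SmallFactors N σ

/-- Every unit step and every bit length is charged `N`; the 3 for a multiplication stands for the
operation and its two factors. -/
def weight : Expr X Y → ℕ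
  | lit _ => 1
  | reg _ => 1
  | get _ i j => i.weight + j.weight + 1
  | add e f => e.weight + f.weight + 1
  | mul e f => e.weight + f.weight + 3
  | sub e f => e.weight + f.weight + 1
  | le e f => e.weight + f.weight + 1
  | eq e f => e.weight + f.weight + 1
  | and e f => e.weight + f.weight + 1
  | or e f => e.weight + f.weight + 1

theorem cost_le {N : ℕ} (hN : 1 ≤ N) {σ : State X Y} (e : Expr X Y) (h : e.SmallFactors N σ) :
    e.cost σ ≤ e.weight * N := by
  induction e with
  | lit _ => simpa [cost, weight] using hN
  | reg _ => simpa [cost, weight] using hN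
  | mul e f ihe ihf =>
    simp only [SmallFactors] at h
    have := ihe h.1
    have := ihf h.2.1
    simp only [cost, weight, add_mul]
    omega
  | _ =>
    rename_i ihe ihf
    simp only [SmallFactors] at h
    have := ihe h.1
    have := ihf h.2
    simp only [cost, weight, add_mul]
    omega

/-- The expression contains no multiplications. -/
def mulFree : Expr X Y → Bool
  | lit _ => true
  | reg _ => true
  | get _ i j => i.mulFree && j.mulFree
  | add e f => e.mulFree && f.mulFree
  | mul _ _ => false
  | sub e f => e.mulFree && f.mulFree
  | le e f => e.mulFree && f.mulFree
  | eq e f => e.mulFree && f.mulFree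
  | and e f => e.mulFree && f.mulFree
  | or e f => e.mulFree && f.mulFree

theorem SmallFactors.of_mulFree {e : Expr X Y} (h : e.mulFree = true) (N : ℕ) (σ : State X Y) :
    e.SmallFactors N σ := by
  induction e with
  | lit _ => trivial
  | reg _ => trivial
  | mul _ _ _ _ => cases h
  | _ =>
    rename_i ihe ihf
    simp only [mulFree, Bool.and_eq_true] at h
    exact ⟨ihe h.1, ihf h.2⟩

end Expr

/-- The array `f` with the entry at `(i, j)` replaced by `v`. -/
def update₂ (f : ℕ → ℕ → ℕ) (i j v : ℕ) : ℕ → ℕ → ℕ :=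
  fun i' j' => if i' = i ∧ j' = j then v else f i' j'

theorem update₂_apply (f : ℕ → ℕ → ℕ) (i j v i' j' : ℕ) :
    update₂ f i j v i' j' = if i' = i ∧ j' = j then v else f i' j' := rfl

namespace State

@[simp] theorem setReg_reg [DecidableEq X] (σ : State X Y) (x y : X) (v : ℕ) :
    (σ.setReg x v).reg y = if y = x then v else σ.reg y := rfl

@[simp] theorem setReg_arr [DecidableEq X] (σ : State X Y) (x : X) (v : ℕ) :
    (σ.setReg x v).arr = σ.arr := rfl

@[simp] theorem setArr_reg [DecidableEq Y] (σ : State X Y) (a : Y) (i j v : ℕ) :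
    (σ.setArr a i j v).reg = σ.reg := rfl

@[simp] theorem setArr_arr [DecidableEq Y] (σ : State X Y) (a b : Y) (i j v : ℕ) :
    (σ.setArr a i j v).arr b = if b = a then update₂ (σ.arr a) i j v else σ.arr b := by
  funext i' j'
  by_cases h : b = a
  · subst h; simp [setArr, update₂]
  · simp [setArr, h]

end State

variable [DecidableEq X] [DecidableEq Y]

namespace Stmt

/-- The final state of a program. -/
def ev (s : Stmt X Y) (σ : State X Y) : State X Y := (s.run σ).1

variable (σ : State X Y)

@[simp] theorem ev_skip : (skip : Stmt X Y).ev σ = σ := rfl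

@[simp] theorem ev_set (x : X) (e : Expr X Y) : (set x e).ev σ = σ.setReg x (e.eval σ) := rfl

@[simp] theorem ev_put (a : Y) (i j e : Expr X Y) :
    (put a i j e).ev σ = σ.setArr a (i.eval σ) (j.eval σ) (e.eval σ) := rfl

@[simp] theorem ev_seq (s t : Stmt X Y) : (seq s t).ev σ = t.ev (s.ev σ) := rfl

@[simp] theorem ev_ite (e : Expr X Y) (s t : Stmt X Y) :
    (ite e s t).ev σ = if e.eval σ ≠ 0 then s.ev σ else t.ev σ := by
  simp only [ev, run]; split_ifs <;> rfl

@[simp] theorem ev_block_nil : (block [] : Stmt X Y).ev σ = σ := rfl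

@[simp] theorem ev_block_cons (s : Stmt X Y) (l : List (Stmt X Y)) :
    (block (s :: l)).ev σ = (block l).ev (s.ev σ) := rfl

@[simp] theorem ev_when (e : Expr X Y) (l : List (Stmt X Y)) :
    (Stmt.when e l).ev σ = if e.eval σ ≠ 0 then (block l).ev σ else σ := by
  rw [Stmt.when, ev_ite, ev_skip]

/-- Whether a program does not write to the register `x`. -/
def keepsReg (x : X) : Stmt X Y → Bool
  | skip => true
  | set y _ => x != y
  | put _ _ _ _ => true
  | seq s t => s.keepsReg x && t.keepsReg x
  | ite _ s t => s.keepsReg x && t.keepsReg x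
  | loop y _ s => x != y && s.keepsReg x

/-- Whether a program does not write to the array `a`. -/
def keepsArr (a : Y) : Stmt X Y → Bool
  | skip => true
  | set _ _ => true
  | put b _ _ _ => a != b
  | seq s t => s.keepsArr a && t.keepsArr a
  | ite _ s t => s.keepsArr a && t.keepsArr a
  | loop _ _ s => s.keepsArr a

theorem iter_fst_succ (s : Stmt X Y) (x : X) (k : ℕ) :
    (iter (fun k τ => s.run (τ.setReg x k)) σ (k + 1)).1 =
      s.ev ((iter (fun k τ => s.run (τ.setReg x k)) σ k).1.setReg x k) := rfl

theorem ev_reg {s : Stmt X Y} {x : X} (h : s.keepsReg x = true) : (s.ev σ).reg x = σ.reg x := by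
  induction s generalizing σ with
  | skip => rfl
  | set y e =>
    simp only [keepsReg, bne_iff_ne, ne_eq] at h
    simp [h]
  | put b i j e => simp
  | seq s t ihs iht =>
    simp only [keepsReg, Bool.and_eq_true] at h
    rw [ev_seq, iht _ h.2, ihs _ h.1]
  | ite e s t ihs iht =>
    simp only [keepsReg, Bool.and_eq_true] at h
    rw [ev_ite]
    split_ifs
    · exact ihs _ h.1
    · exact iht _ h.2
  | loop y e s ih =>
    simp only [keepsReg, Bool.and_eq_true, bne_iff_ne, ne_eq] at h
    change (iter (fun k τ => s.run (τ.setReg y k)) σ (e.eval σ)).1.reg x = _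
    induction e.eval σ with
    | zero => rfl
    | succ k ihk =>
      rw [iter_fst_succ, ih _ h.2, State.setReg_reg, if_neg h.1, ihk]

theorem ev_arr {s : Stmt X Y} {a : Y} (h : s.keepsArr a = true) : (s.ev σ).arr a = σ.arr a := by
  induction s generalizing σ with
  | skip => rfl
  | set y e => rfl
  | put b i j e =>
    simp only [keepsArr, bne_iff_ne, ne_eq] at h
    simp [h]
  | seq s t ihs iht =>
    simp only [keepsArr, Bool.and_eq_true] at h
    rw [ev_seq, iht _ h.2, ihs _ h.1]
  | ite e s t ihs iht =>
    simp only [keepsArr, Bool.and_eq_true] at h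
    rw [ev_ite]
    split_ifs
    · exact ihs _ h.1
    · exact iht _ h.2
  | loop y e s ih =>
    simp only [keepsArr] at h
    change (iter (fun k τ => s.run (τ.setReg y k)) σ (e.eval σ)).1.arr a = _
    induction e.eval σ with
    | zero => rfl
    | succ k ihk => rw [iter_fst_succ, ih _ h, State.setReg_arr, ihk]

/-- The states `σ` and `τ` differ only in the registers and arrays that `s` writes to. -/
def Frame (s : Stmt X Y) (σ τ : State X Y) : Prop :=
  (∀ x, s.keepsReg x = true → τ.reg x = σ.reg x) ∧
    ∀ a, s.keepsArr a = true → τ.arr a = σ.arr a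

theorem frame_ev (s : Stmt X Y) : s.Frame σ (s.ev σ) :=
  ⟨fun _ h => ev_reg σ h, fun _ h => ev_arr σ h⟩

variable {σ}

/-- The invariant rule for loops. -/
theorem ev_loop_induction {x : X} {e : Expr X Y} {s : Stmt X Y} (P : ℕ → State X Y → Prop)
    (h0 : P 0 σ)
    (hs : ∀ k τ, k < e.eval σ → (loop x e s).Frame σ τ → P k τ →
      P (k + 1) (s.ev (τ.setReg x k))) :
    P (e.eval σ) ((loop x e s).ev σ) := by
  change P (e.eval σ) (iter (fun k τ => s.run (τ.setReg x k)) σ (e.eval σ)).1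
  -- The frame condition is carried along with `P`, so that every pass may use the values of all
  -- registers and arrays that the loop does not write.
  have key : ∀ k ≤ e.eval σ,
      (loop x e s).Frame σ (iter (fun k τ => s.run (τ.setReg x k)) σ k).1 ∧
        P k (iter (fun k τ => s.run (τ.setReg x k)) σ k).1 := by
    intro k
    induction k with
    | zero => exact fun _ => ⟨⟨fun _ _ => rfl, fun _ _ => rfl⟩, h0⟩
    | succ k ih =>
      intro hk
      obtain ⟨⟨f1, f2⟩, hP⟩ := ih (by omega)
      rw [iter_fst_succ]
      refine ⟨⟨fun y hy => ?_, fun a ha => ?_⟩, hs k _ (by omega) ⟨f1, f2⟩ hP⟩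
      · have hy' := hy
        simp only [keepsReg, Bool.and_eq_true, bne_iff_ne, ne_eq] at hy'
        rw [ev_reg _ hy'.2, State.setReg_reg, if_neg hy'.1, f1 y hy]
      · have ha' := ha
        simp only [keepsArr] at ha'
        rw [ev_arr _ ha', State.setReg_arr, f2 a ha]
  exact (key _ le_rfl).2

/-! ### Running times -/

def weight : Stmt X Y → ℕ
  | skip => 1
  | set _ e => e.weight + 1
  | put _ i j e => i.weight + j.weight + e.weight + 1
  | seq s t => s.weight + t.weight
  | ite e s t => e.weight + s.weight + t.weight + 1
  | loop _ e s => e.weight + s.weight + 2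

/-- The exponent of the polynomial that bounds the running time. -/
def depth : Stmt X Y → ℕ
  | skip => 0
  | set _ _ => 1
  | put _ _ _ _ => 1
  | seq s t => max s.depth t.depth
  | ite _ s t => max 1 (max s.depth t.depth)
  | loop _ _ s => s.depth + 1

/-- The program preserves `J`, and `J` guarantees that loops are run at most `N` times and that
factors have at most `N` bits. -/
def Safe (J : State X Y → Prop) (N : ℕ) : Stmt X Y → Prop
  | skip => True
  | set x e => ∀ σ, J σ → e.SmallFactors N σ ∧ J (σ.setReg x (e.eval σ))
  | put a i j e => ∀ σ, J σ → i.SmallFactors N σ ∧ j.SmallFactors N σ ∧ e.SmallFactors N σ ∧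
      J (σ.setArr a (i.eval σ) (j.eval σ) (e.eval σ))
  | seq s t => s.Safe J N ∧ t.Safe J N
  | ite e s t => (∀ σ, J σ → e.SmallFactors N σ) ∧ s.Safe J N ∧ t.Safe J N
  | loop x e s => (∀ σ, J σ → e.SmallFactors N σ ∧ e.eval σ ≤ N ∧ ∀ k, J (σ.setReg x k)) ∧
      s.Safe J N

/-- Structural induction: a loop multiplies the time of its body by at most `N` and so raises the
exponent by one. Since `J` is preserved, the bounds on loops and factors are available in every
state that occurs. -/
theorem Safe.cost_le {J : State X Y → Prop} {N : ℕ} (hN : 1 ≤ N) {s : Stmt X Y}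
    (h : s.Safe J N) {σ : State X Y} (hσ : J σ) :
    J (s.ev σ) ∧ (s.run σ).2 ≤ s.weight * N ^ s.depth := by
  have hpow : ∀ {d d' : ℕ}, d ≤ d' → N ^ d ≤ N ^ d' := fun h => Nat.pow_le_pow_right hN h
  induction s generalizing σ with
  | skip => exact ⟨hσ, by simp [run, weight, depth]⟩
  | set x e =>
    refine ⟨(h σ hσ).2, ?_⟩
    have := e.cost_le hN (h σ hσ).1
    simp only [run, weight, depth, pow_one, add_mul]
    omega
  | put a i j e =>
    obtain ⟨h1, h2, h3, h4⟩ := h σ hσ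
    refine ⟨h4, ?_⟩
    have := i.cost_le hN h1
    have := j.cost_le hN h2
    have := e.cost_le hN h3
    simp only [run, weight, depth, pow_one, add_mul]
    omega
  | seq s t ihs iht =>
    obtain ⟨h1, h2⟩ := ihs h.1 hσ
    obtain ⟨h3, h4⟩ := iht h.2 h1
    refine ⟨h3, ?_⟩
    have h5 := h2.trans (Nat.mul_le_mul_left _ (hpow (le_max_left s.depth t.depth)))
    have h6 := h4.trans (Nat.mul_le_mul_left _ (hpow (le_max_right s.depth t.depth)))
    simp only [weight, depth, add_mul]
    exact add_le_add h5 h6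
  | ite e s t ihs iht =>
    have h0 := (e.cost_le hN (h.1 σ hσ)).trans
      (Nat.mul_le_mul_left e.weight ((pow_one N).symm.le.trans
        (hpow (le_max_left 1 (max s.depth t.depth)))))
    have h1 : 1 ≤ N ^ (max 1 (max s.depth t.depth)) := Nat.one_le_pow _ _ hN
    by_cases he : e.eval σ ≠ 0
    · obtain ⟨h2, h3⟩ := ihs h.2.1 hσ
      have h4 := h3.trans (Nat.mul_le_mul_left _ (hpow
        ((le_max_left s.depth t.depth).trans (le_max_right 1 _))))
      refine ⟨by rwa [ev_ite, if_pos he], ?_⟩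
      simp only [run, if_pos he, weight, depth, add_mul]
      omega
    · obtain ⟨h2, h3⟩ := iht h.2.2 hσ
      have h4 := h3.trans (Nat.mul_le_mul_left _ (hpow
        ((le_max_right s.depth t.depth).trans (le_max_right 1 _))))
      refine ⟨by rwa [ev_ite, if_neg he], ?_⟩
      simp only [run, if_neg he, weight, depth, add_mul]
      omega
  | loop x e s ih =>
    obtain ⟨h1, h2, -⟩ := h.1 σ hσ
    have key : ∀ k, J (iter (fun k τ => s.run (τ.setReg x k)) σ k).1 ∧
        (iter (fun k τ => s.run (τ.setReg x k)) σ k).2 ≤ k * (s.weight * N ^ s.depth) := by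
      intro k
      induction k with
      | zero => exact ⟨hσ, by simp [iter]⟩
      | succ k ihk =>
        obtain ⟨h3, h4⟩ := ih h.2 ((h.1 _ ihk.1).2.2 k)
        refine ⟨h3, ?_⟩
        rw [add_mul, one_mul]
        exact add_le_add ihk.2 h4
    refine ⟨(key _).1, ?_⟩
    have h5 := e.cost_le hN h1
    have h6 := (key (e.eval σ)).2.trans (Nat.mul_le_mul_right _ h2)
    have h7 : 1 ≤ N ^ s.depth := Nat.one_le_pow _ _ hN
    have h8 : N * (s.weight * N ^ s.depth) = s.weight * N ^ (s.depth + 1) := by ring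
    have h9 : N ≤ N ^ (s.depth + 1) := Nat.le_self_pow (by omega) N
    have h10 := h5.trans (Nat.mul_le_mul_left e.weight h9)
    simp only [run, weight, depth, add_mul]
    omega

end Stmt

end Machine

/-! ### Loops over all nodes -/

namespace Prog

open Stmt

variable {n : ℕ} {σ : State Reg Arr}

theorem forNodes_induction {x : Reg} {l : List S} (hn : σ.reg .n = n)
    (P : ℕ → State Reg Arr → Prop) (h0 : P 0 σ)
    (hs : ∀ (k : Fin n) τ, (forNodes x l).Frame σ τ → P k τ →
      P (k + 1) ((block l).ev (τ.setReg x k))) :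
    P n ((forNodes x l).ev σ) := by
  have := ev_loop_induction (σ := σ) (x := x) (e := .reg .n) (s := block l) P h0
    fun k τ hk hf hP => hs ⟨k, hn ▸ hk⟩ τ hf hP
  rwa [Expr.eval, hn] at this

/-- A loop rule for bodies that preserve `Inv` and establish `Vis k` for the node `k`, where
`Vis k` remains true under the changes of the state described by `R`. -/
theorem forNodes_forall {x : Reg} {l : List S} (hn : σ.reg .n = n)
    {Inv : State Reg Arr → Prop} {Vis : Fin n → State Reg Arr → Prop}
    {R : State Reg Arr → State Reg Arr → Prop} (hrefl : ∀ τ, R τ τ)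
    (htrans : ∀ τ₁ τ₂ τ₃, R τ₁ τ₂ → R τ₂ τ₃ → R τ₁ τ₃)
    (hVis : ∀ k τ τ', R τ τ' → Vis k τ → Vis k τ') (h0 : Inv σ)
    (hs : ∀ (k : Fin n) τ, (forNodes x l).Frame σ τ → Inv τ →
      Inv ((block l).ev (τ.setReg x k)) ∧ Vis k ((block l).ev (τ.setReg x k)) ∧
        R τ ((block l).ev (τ.setReg x k))) :
    Inv ((forNodes x l).ev σ) ∧ (∀ k, Vis k ((forNodes x l).ev σ)) ∧
      R σ ((forNodes x l).ev σ) := by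
  have := forNodes_induction (n := n) (x := x) (l := l) hn
    (fun k τ => Inv τ ∧ (∀ j : Fin n, (j : ℕ) < k → Vis j τ) ∧ R σ τ)
    ⟨h0, fun j hj => absurd hj (Nat.not_lt_zero _), hrefl σ⟩ ?_
  · exact ⟨this.1, fun j => this.2.1 j j.2, this.2.2⟩
  · rintro k τ hf ⟨h1, h2, h3⟩
    obtain ⟨h4, h5, h6⟩ := hs k τ hf h1
    refine ⟨h4, fun j hj => ?_, htrans _ _ _ h3 h6⟩
    rcases Nat.lt_succ_iff_lt_or_eq.1 hj with hj | hj
    · exact hVis _ _ _ h6 (h2 j hj)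
    · rwa [Fin.ext hj]

end Prog

/-! ## Shortest paths -/

namespace Prog

open Stmt

variable {n : ℕ} {I : Instance n} {ℓ : Sym2 (Fin n) → ℕ} {σ : State Reg Arr}

@[simp] theorem eval_lit (k : ℕ) : (Expr.lit k : E).eval σ = k := rfl

@[simp] theorem eval_reg (x : Reg) : (Expr.reg x : E).eval σ = σ.reg x := rfl

@[simp] theorem eval_get (a : Arr) (e f : E) :
    (Expr.get a e f).eval σ = σ.arr a (e.eval σ) (f.eval σ) := rfl

@[simp] theorem eval_add (e f : E) : (Expr.add e f).eval σ = e.eval σ + f.eval σ := rfl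

@[simp] theorem eval_sub (e f : E) : (Expr.sub e f).eval σ = e.eval σ - f.eval σ := rfl

-- Conditionals ask only whether a value is nonzero, so conditions are characterized by when they
-- vanish.
@[simp] theorem eval_le_eq_zero (e f : E) :
    (Expr.le e f).eval σ = 0 ↔ ¬ e.eval σ ≤ f.eval σ := by
  simp [Expr.eval]

@[simp] theorem eval_eq_eq_zero (e f : E) :
    (Expr.eq e f).eval σ = 0 ↔ ¬ e.eval σ = f.eval σ := by
  simp [Expr.eval]

@[simp] theorem eval_or_eq_zero (e f : E) :
    (Expr.or e f).eval σ = 0 ↔ ¬ (e.eval σ ≠ 0 ∨ f.eval σ ≠ 0) := by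
  simp only [Expr.eval, ite_eq_right_iff, one_ne_zero, imp_false]

@[simp] theorem eval_all_nil_eq_zero : (all []).eval σ = 0 ↔ False := by
  simp [all]

@[simp] theorem eval_all_cons_eq_zero (e : E) (l : List E) :
    (all (e :: l)).eval σ = 0 ↔ ¬ (e.eval σ ≠ 0 ∧ (all l).eval σ ≠ 0) := by
  simp only [all, Expr.eval, ite_eq_right_iff, one_ne_zero, imp_false]

def distInit : S := forNodes .u [put2 .dist .u .u (num 1)]

def relax : S :=
  .when (all [get2 .adj .v .w, get2 .dist .u .v]) [
    .set .tmp (.add (get2 .dist .u .v) (get2 .len .v .w)),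
    .when (.or (.eq (get2 .dist .u .w) (num 0))
        (.le (.add (rd .tmp) (num 1)) (get2 .dist .u .w))) [
      put2 .dist .u .w (rd .tmp)]]

def relaxAll : S := forNodes .u [forNodes .v [forNodes .w [relax]]]

def scale : S := forNodes .u [forNodes .v [
  put2 .lo .u .v (.mul (rd .den) (.sub (get2 .dist .u .v) (num 1))),
  put2 .hi .u .v (.mul (rd .num) (.sub (get2 .dist .u .v) (num 1)))]]

theorem shortestPaths_eq :
    shortestPaths = .block [distInit, forNodes .r [relaxAll], scale] := rfl

/-- The length of a walk. -/
def walkLen (ℓ : Sym2 (Fin n) → ℕ) {u v : Fin n} (q : I.G.Walk u v) : ℕ := (q.edges.map ℓ).sum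

/-- Upper bound `c` for the entry of the distance array at `(u, v)`, in which distances are
increased by one. -/
def DistLE (τ : State Reg Arr) (u v : Fin n) (c : ℕ) : Prop :=
  τ.arr .dist u v ≠ 0 ∧ τ.arr .dist u v ≤ c + 1

/-- The distance array contains lengths of walks that are at most those of the walks with at most
`r` edges. -/
structure Approx (I : Instance n) (ℓ : Sym2 (Fin n) → ℕ) (r : ℕ) (τ : State Reg Arr) : Prop where
  adj : ∀ u v : Fin n, τ.arr .adj u v ≠ 0 ↔ I.G.Adj u v
  len : ∀ u v : Fin n, τ.arr .len u v = ℓ s(u, v)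
  sound : ∀ u v : Fin n, τ.arr .dist u v ≠ 0 →
    ∃ q : I.G.Walk u v, τ.arr .dist u v = walkLen ℓ q + 1
  le : ∀ (u v : Fin n) (q : I.G.Walk u v), q.length ≤ r → DistLE τ u v (walkLen ℓ q)

theorem walkLen_concat {u v w : Fin n} (q : I.G.Walk u v) (h : I.G.Adj v w) :
    walkLen ℓ (q.concat h) = walkLen ℓ q + ℓ s(v, w) := by
  simp [walkLen, SimpleGraph.Walk.edges_concat]

/-- A written entry belongs to a known walk to `v` extended by the edge to `w`. Adding the edge
length to an entry carries the offset of one along. Because nonzero entries are only ever lowered,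
upper bounds persist; updates in place may run ahead of the round number, so only an inequality is
claimed for walks with at most `r` edges. -/
theorem relax_spec {r : ℕ} (h : Approx I ℓ r σ) (u v w : Fin n) (hu : σ.reg .u = u)
    (hv : σ.reg .v = v) (hw : σ.reg .w = w) :
    Approx I ℓ r (relax.ev σ) ∧
      (I.G.Adj v w → ∀ q : I.G.Walk u v, q.length ≤ r →
        DistLE (relax.ev σ) u w (walkLen ℓ q + ℓ s(v, w))) ∧
      ∀ (u v : Fin n) c, DistLE σ u v c → DistLE (relax.ev σ) u v c := by
  by_cases h1 : σ.arr .adj v w ≠ 0 ∧ σ.arr .dist u v ≠ 0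
  swap
  · have : relax.ev σ = σ := by
      rw [relax, ev_when, if_neg (by simpa [hu, hv, hw] using h1)]
    rw [this]
    exact ⟨h, fun hadj q hq => absurd ⟨(h.adj v w).2 hadj, (h.le u v q hq).1⟩ h1,
      fun _ _ _ => id⟩
  obtain ⟨hadj, hd⟩ := h1
  obtain ⟨q, hq⟩ := h.sound u v hd
  have hlen := h.len v w
  -- An entry is overwritten if it is 0, meaning not yet reached, or if the new value is strictly
  -- smaller.
  by_cases h2 : σ.arr .dist u w = 0 ∨ σ.arr .dist u v + σ.arr .len v w + 1 ≤ σ.arr .dist u w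
  · have harr : (relax.ev σ).arr = fun a => if a = .dist then
        update₂ (σ.arr .dist) u w (σ.arr .dist u v + σ.arr .len v w) else σ.arr a := by
      funext a
      rw [relax, ev_when, if_pos (by simp [hu, hv, hw, hadj, hd])]
      simp only [ev_block_cons, ev_block_nil, ev_when, ev_set]
      rw [if_pos (by simpa [hu, hv, hw, Nat.succ_le_iff, or_iff_not_imp_left] using h2)]
      simp [hu, hv, hw]
    have hmono : ∀ (u v : Fin n) c, DistLE σ u v c → DistLE (relax.ev σ) u v c := by
      intro u' v' c hc
      simp only [DistLE, harr, if_true, update₂_apply] at hc ⊢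
      split_ifs with h3
      · rw [Fin.val_inj, Fin.val_inj] at h3
        obtain ⟨rfl, rfl⟩ := h3
        omega
      · exact hc
    refine ⟨⟨?_, ?_, ?_, fun u v q hq => hmono _ _ _ (h.le u v q hq)⟩, ?_, hmono⟩
    · simpa [harr] using h.adj
    · simpa [harr] using h.len
    · intro u' v'
      simp only [harr, if_true, update₂_apply]
      split_ifs with h3
      · rw [Fin.val_inj, Fin.val_inj] at h3
        obtain ⟨rfl, rfl⟩ := h3
        intro
        refine ⟨q.concat ((h.adj v v').1 hadj), ?_⟩
        rw [walkLen_concat, hq, hlen]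
        ring
      · exact h.sound u' v'
    · intro hadj' q' hq'
      have := h.le u v q' hq'
      simp only [DistLE, harr, if_true, update₂_apply] at this ⊢
      simp only [and_self, if_true]
      omega
  · have harr : (relax.ev σ).arr = σ.arr := by
      funext a
      rw [relax, ev_when, if_pos (by simp [hu, hv, hw, hadj, hd])]
      simp only [ev_block_cons, ev_block_nil, ev_when, ev_set]
      rw [if_neg (by simpa [hu, hv, hw, Nat.succ_le_iff] using h2)]
      simp
    have hmono : ∀ (u v : Fin n) c, DistLE σ u v c → DistLE (relax.ev σ) u v c := by
      intro u' v' c hc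
      simpa [DistLE, harr] using hc
    refine ⟨⟨by simpa [harr] using h.adj, by simpa [harr] using h.len,
      by simpa [harr] using h.sound, fun u v q hq => hmono _ _ _ (h.le u v q hq)⟩, ?_, hmono⟩
    intro hadj' q' hq'
    have := h.le u v q' hq'
    simp only [DistLE, harr] at this ⊢
    omega

theorem relaxAll_spec {r : ℕ} (hn : σ.reg .n = n) (h : Approx I ℓ r σ) :
    Approx I ℓ (r + 1) (relaxAll.ev σ) := by
  have hrefl : ∀ τ : State Reg Arr, ∀ (u v : Fin n) c, DistLE τ u v c → DistLE τ u v c :=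
    fun _ _ _ _ => id
  have htrans : ∀ τ₁ τ₂ τ₃ : State Reg Arr,
      (∀ (u v : Fin n) c, DistLE τ₁ u v c → DistLE τ₂ u v c) →
      (∀ (u v : Fin n) c, DistLE τ₂ u v c → DistLE τ₃ u v c) →
      (∀ (u v : Fin n) c, DistLE τ₁ u v c → DistLE τ₃ u v c) :=
    fun _ _ _ h1 h2 u v c h => h2 u v c (h1 u v c h)
  have key := forNodes_forall (σ := σ) (x := .u) (l := [forNodes .v [forNodes .w [relax]]]) hn
    (Inv := Approx I ℓ r)
    (Vis := fun u τ => ∀ v w, I.G.Adj v w → ∀ q : I.G.Walk u v, q.length ≤ r →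
        DistLE τ u w (walkLen ℓ q + ℓ s(v, w)))
    (R := fun τ τ' => ∀ (u v : Fin n) c, DistLE τ u v c → DistLE τ' u v c) hrefl htrans
    (fun k τ τ' hR hV v w hvw q hq => hR _ _ _ (hV v w hvw q hq)) h ?_
  · obtain ⟨h1, h2, -⟩ := key
    refine ⟨h1.adj, h1.len, h1.sound, fun u v q hq => ?_⟩
    -- A walk with `r + 1` edges is one with `r` edges followed by an edge that was relaxed at some
    -- point of the round; the bound obtained then survives the rest of the round.
    rcases Nat.lt_or_ge r q.length with hlt | hle
    · cases q using SimpleGraph.Walk.concatRec with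
      | Hnil => simp at hlt
      | Hconcat q hvw =>
        rw [walkLen_concat]
        rw [SimpleGraph.Walk.length_concat] at hq
        exact h2 u _ _ hvw q (by omega)
    · exact h1.le u v q hle
  intro u τ hfu hτ
  have key := forNodes_forall (σ := τ.setReg .u u) (x := .v) (l := [forNodes .w [relax]]) (n := n)
    (by simpa using (hfu.1 .n rfl).trans hn)
    (Inv := Approx I ℓ r)
    (Vis := fun v τ => ∀ w, I.G.Adj v w → ∀ q : I.G.Walk u v, q.length ≤ r →
        DistLE τ u w (walkLen ℓ q + ℓ s(v, w)))
    (R := fun τ τ' => ∀ (u v : Fin n) c, DistLE τ u v c → DistLE τ' u v c) hrefl htrans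
    (fun k τ τ' hR hV w hvw q hq => hR _ _ _ (hV w hvw q hq)) ⟨hτ.adj, hτ.len, hτ.sound, hτ.le⟩ ?_
  · exact key
  intro v τ' hfv hτ'
  have key := forNodes_forall (σ := τ'.setReg .v v) (x := .w) (l := [relax]) (n := n)
    (by simpa using (hfv.1 .n rfl).trans (by simpa using (hfu.1 .n rfl).trans hn))
    (Inv := Approx I ℓ r)
    (Vis := fun w τ => I.G.Adj v w → ∀ q : I.G.Walk u v, q.length ≤ r →
        DistLE τ u w (walkLen ℓ q + ℓ s(v, w)))
    (R := fun τ τ' => ∀ (u v : Fin n) c, DistLE τ u v c → DistLE τ' u v c) hrefl htrans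
    (fun k τ τ' hR hV hvw q hq => hR _ _ _ (hV hvw q hq)) ⟨hτ'.adj, hτ'.len, hτ'.sound, hτ'.le⟩ ?_
  · exact key
  intro w τ'' hfw hτ''
  have hu : τ''.reg .u = u := by
    rw [hfw.1 .u rfl]
    simpa using hfv.1 .u rfl
  have hv : τ''.reg .v = v := by
    rw [hfw.1 .v rfl]
    simp
  exact relax_spec (σ := τ''.setReg .w w) ⟨hτ''.adj, hτ''.len, hτ''.sound, hτ''.le⟩ u v w
    (by simpa using hu) (by simpa using hv) (by simp)

theorem distInit_spec (hn : σ.reg .n = n) (hadj : ∀ u v : Fin n, σ.arr .adj u v ≠ 0 ↔ I.G.Adj u v)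
    (hlen : ∀ u v : Fin n, σ.arr .len u v = ℓ s(u, v)) (hdist : ∀ u v, σ.arr .dist u v = 0) :
    Approx I ℓ 0 (distInit.ev σ) := by
  have key := forNodes_induction (σ := σ) (x := .u) (l := [put2 .dist .u .u (num 1)]) hn
    (fun k τ => ∀ u v : Fin n, τ.arr .dist u v = if (u : ℕ) < k ∧ u = v then 1 else 0)
    (by simp [hdist]) ?_
  · have hd : ∀ u v : Fin n, (distInit.ev σ).arr .dist u v = if u = v then 1 else 0 := by
      intro u v
      have := key u v
      rw [distInit]
      simpa using this
    refine ⟨?_, ?_, fun u v huv => ?_, fun u v q hq => ?_⟩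
    · rw [ev_arr (s := distInit) σ (a := .adj) rfl]
      exact hadj
    · rw [ev_arr (s := distInit) σ (a := .len) rfl]
      exact hlen
    · rw [hd] at huv ⊢
      have : u = v := by simpa using huv
      subst this
      exact ⟨.nil, by simp [walkLen]⟩
    · have hq' : q.length = 0 := by omega
      have huv := SimpleGraph.Walk.eq_of_length_eq_zero hq'
      simp [DistLE, hd, huv]
  · intro k τ _ hτ u v
    have h1 : ((u : ℕ) = k ∧ (v : ℕ) = k) ↔ (u = k ∧ v = k) := by simp [Fin.val_inj]
    simp only [ev_block_cons, ev_block_nil, ev_put, State.setArr_arr, if_true, update₂_apply,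
      Expr.eval, State.setReg_reg, State.setReg_arr, hτ u v, Fin.val_inj]
    have h2 := Fin.val_inj (a := u) (b := k)
    split_ifs <;> grind

theorem relaxRounds_spec {σ : State Reg Arr} (hn : σ.reg .n = n) (h : Approx I ℓ 0 σ) :
    Approx I ℓ n ((forNodes .r [relaxAll]).ev σ) :=
  forNodes_induction hn (Approx I ℓ) h fun k τ hf hτ =>
    relaxAll_spec (by simpa using (hf.1 .n rfl).trans hn) ⟨hτ.adj, hτ.len, hτ.sound, hτ.le⟩

theorem scale_spec (hn : σ.reg .n = n) (u v : Fin n) :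
    (scale.ev σ).arr .lo u v = σ.reg .den * (σ.arr .dist u v - 1) ∧
      (scale.ev σ).arr .hi u v = σ.reg .num * (σ.arr .dist u v - 1) := by
  have key := forNodes_induction (σ := σ) (x := .u) (l := [forNodes .v [
      put2 .lo .u .v (.mul (rd .den) (.sub (get2 .dist .u .v) (num 1))),
      put2 .hi .u .v (.mul (rd .num) (.sub (get2 .dist .u .v) (num 1)))]]) hn
    (fun k τ => ∀ u v : Fin n, (u : ℕ) < k →
      τ.arr .lo u v = σ.reg .den * (σ.arr .dist u v - 1) ∧
      τ.arr .hi u v = σ.reg .num * (σ.arr .dist u v - 1))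
    (fun u v h => absurd h (Nat.not_lt_zero _)) ?_
  · exact key u v u.2
  intro k τ hf hτ
  have hn' : (τ.setReg .u k).reg .n = n := by simpa using (hf.1 .n rfl).trans hn
  have hden := hf.1 .den rfl
  have hnum := hf.1 .num rfl
  have hdist := hf.2 .dist rfl
  have key := forNodes_induction (σ := τ.setReg .u k) (x := .v) (l := [
      put2 .lo .u .v (.mul (rd .den) (.sub (get2 .dist .u .v) (num 1))),
      put2 .hi .u .v (.mul (rd .num) (.sub (get2 .dist .u .v) (num 1)))]) hn'
    (fun j τ => ∀ u v : Fin n, (u : ℕ) < k ∨ (u = k ∧ (v : ℕ) < j) →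
      τ.arr .lo u v = σ.reg .den * (σ.arr .dist u v - 1) ∧
      τ.arr .hi u v = σ.reg .num * (σ.arr .dist u v - 1))
    (fun u v h => hτ u v (by simpa using h)) ?_
  · intro u v huv
    refine key u v ?_
    rcases Nat.lt_succ_iff_lt_or_eq.1 huv with h | h
    · exact Or.inl h
    · exact Or.inr ⟨Fin.ext h, v.2⟩
  intro j τ' hf' hτ' u v huv
  have hu' : τ'.reg .u = k := by simpa using hf'.1 .u rfl
  have hden' : τ'.reg .den = σ.reg .den := by rw [hf'.1 .den rfl]; simpa using hden
  have hnum' : τ'.reg .num = σ.reg .num := by rw [hf'.1 .num rfl]; simpa using hnum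
  have hdist' : τ'.arr .dist = σ.arr .dist := by rw [hf'.2 .dist rfl]; simpa using hdist
  simp only [ev_block_cons, ev_block_nil, ev_put, Expr.eval, State.setArr_arr, State.setReg_arr,
    State.setReg_reg, State.setArr_reg, if_true, update₂_apply, hdist', reduceCtorEq, if_false,
    hu', hden', hnum', Fin.val_inj]
  by_cases h : u = k ∧ v = j
  · obtain ⟨rfl, rfl⟩ := h
    simp
  · have := hτ' u v (by
      rcases huv with h1 | ⟨h1, h2⟩
      · exact Or.inl h1
      · rcases Nat.lt_succ_iff_lt_or_eq.1 h2 with h3 | h3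
        · exact Or.inr ⟨h1, h3⟩
        · exact absurd ⟨h1, Fin.ext h3⟩ h)
    simpa [h] using this

end Prog

/-! ## The test for edges of the bipartite graph -/

namespace Prog

open Stmt

variable {n : ℕ} {I : Instance n} {ℓ : Sym2 (Fin n) → ℕ} {σ : State Reg Arr}

theorem d_eq_iInf (hℓ : ∀ e, I.len e = ℓ e) (u v : Fin n) :
    I.d u v = ⨅ q : I.G.Walk u v, ((walkLen ℓ q : ℕ) : ℝ≥0∞) := by
  refine iInf_congr fun q => ?_
  have : I.len = fun e => (ℓ e : ℝ≥0) := funext hℓ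
  have h : ∀ l : List (Sym2 (Fin n)), (l.map I.len).sum = ((l.map ℓ).sum : ℕ) := by
    intro l
    induction l with
    | nil => simp
    | cons e l ih => simp [ih, hℓ]
  rw [walkLen, h, ENNReal.coe_natCast]

/-- Lengths are nonnegative, so bypassing repeated vertices does not lengthen a walk, and a path has
fewer than `n` edges. This is why `n` rounds suffice. -/
theorem exists_length_le_walkLen_le {u v : Fin n} (q : I.G.Walk u v) :
    ∃ q' : I.G.Walk u v, q'.length < n ∧ walkLen ℓ q' ≤ walkLen ℓ q := by
  refine ⟨q.bypass, ?_, ?_⟩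
  · simpa using q.bypass_isPath.length_lt
  · exact (q.edges_bypass_sublist_edges.map ℓ).sum_le_sum fun _ _ => Nat.zero_le _

theorem Approx.d_eq (hℓ : ∀ e, I.len e = ℓ e) (h : Approx I ℓ n σ) (u v : Fin n) :
    I.d u v = if σ.arr .dist u v = 0 then ∞ else ((σ.arr .dist u v - 1 : ℕ) : ℝ≥0∞) := by
  rw [d_eq_iInf hℓ]
  split_ifs with h0
  · rw [iInf_eq_top]
    intro q
    obtain ⟨q', hq', -⟩ := exists_length_le_walkLen_le (ℓ := ℓ) q
    exact absurd h0 (h.le u v q' hq'.le).1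
  · refine le_antisymm ?_ (le_iInf fun q => ?_)
    · obtain ⟨q, hq⟩ := h.sound u v h0
      rw [hq, Nat.add_sub_cancel]
      exact iInf_le _ q
    · obtain ⟨q', hq', hle⟩ := exists_length_le_walkLen_le (ℓ := ℓ) q
      have := (h.le u v q' hq'.le).2
      exact_mod_cast (by omega : σ.arr .dist u v - 1 ≤ walkLen ℓ q)

/-- A shortest path consists of fewer than `n < 2 ^ n` edges of length less than `2 ^ L`. The bound
pays for the multiplications in `scale`. -/
theorem Approx.size_dist_le {L : ℕ} (hL : ∀ e, (ℓ e).size ≤ L) (h : Approx I ℓ n σ) (u v : Fin n) :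
    (σ.arr .dist u v - 1).size ≤ n + L := by
  by_cases h0 : σ.arr .dist u v = 0
  · simp [h0]
  obtain ⟨q, -⟩ := h.sound u v h0
  obtain ⟨q', hq', -⟩ := exists_length_le_walkLen_le (ℓ := ℓ) q
  have h1 := (h.le u v q' hq'.le).2
  have h2 : walkLen ℓ q' ≤ q'.length * 2 ^ L := by
    rw [← q'.length_edges, walkLen, ← smul_eq_mul, ← List.length_map (f := ℓ)]
    refine List.sum_le_card_nsmul _ _ fun x hx => ?_
    obtain ⟨e, -, rfl⟩ := List.mem_map.1 hx
    exact (Nat.size_le.1 (hL e)).le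
  rw [Nat.size_le, pow_add]
  have h3 : n < 2 ^ n := Nat.lt_two_pow_self
  have h4 : 0 < 2 ^ L := by positivity
  calc _ ≤ q'.length * 2 ^ L := by omega
    _ < 2 ^ n * 2 ^ L := Nat.mul_lt_mul_of_pos_right (hq'.trans h3) h4

/-- The condition that is tested by `edgeTest`. -/
def EdgeCond (σ : State Reg Arr) (a s t : ℕ) : Prop :=
  σ.arr .pairs s t ≠ 0 ∧ σ.arr .dist s t ≠ 0 ∧ σ.arr .dist s a ≠ 0 ∧ σ.arr .dist a t ≠ 0 ∧
    σ.arr .lo s a + σ.arr .lo a t ≤ σ.arr .hi s t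

theorem eval_edgeTest :
    edgeTest.eval σ ≠ 0 ↔ EdgeCond σ (σ.reg .a) (σ.reg .s) (σ.reg .t) := by
  simp [edgeTest, EdgeCond]

/-- What is known about the state after the preprocessing. -/
structure Ready (I : Instance n) (σ : State Reg Arr) : Prop where
  n_eq : σ.reg .n = n
  kappa_eq : σ.reg .kappa = I.κ
  total_eq : σ.reg .total = I.P.card
  loc_iff : ∀ m : Fin n, σ.arr .loc m 0 ≠ 0 ↔ m ∈ I.U
  edge_iff : ∀ a s t : Fin n, EdgeCond σ a s t ↔ (s, t) ∈ I.P ∧ I.Routable a (s, t)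

/-- The conditions on `s` are Boolean checks of its syntax, so for concrete programs they hold by
`rfl`. -/
theorem Ready.of_frame {s : S} {τ : State Reg Arr} (h : Ready I σ) (hf : s.Frame σ τ)
    (h1 : ([.n, .kappa, .total].all fun x => s.keepsReg x) = true)
    (h2 : ([.loc, .pairs, .dist, .lo, .hi].all fun a => s.keepsArr a) = true) : Ready I τ := by
  simp only [List.all_cons, List.all_nil, Bool.and_eq_true, and_true] at h1 h2
  refine ⟨?_, ?_, ?_, ?_, ?_⟩
  · rw [hf.1 _ h1.1, h.n_eq]
  · rw [hf.1 _ h1.2.1, h.kappa_eq]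
  · rw [hf.1 _ h1.2.2, h.total_eq]
  · rw [hf.2 _ h2.1]
    exact h.loc_iff
  · simp only [EdgeCond, hf.2 _ h2.2.1, hf.2 _ h2.2.2.1, hf.2 _ h2.2.2.2.1, hf.2 _ h2.2.2.2.2]
    exact h.edge_iff

theorem Ready.setReg (h : Ready I σ) {x : Reg} (hx : ([.n, .kappa, .total].all fun y => y != x) = true)
    (v : ℕ) : Ready I (σ.setReg x v) := by
  simp only [List.all_cons, List.all_nil, Bool.and_eq_true, and_true, bne_iff_ne, ne_eq] at hx
  exact ⟨by simpa [hx] using h.n_eq, by simpa [hx] using h.kappa_eq,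
    by simpa [hx] using h.total_eq, h.loc_iff, h.edge_iff⟩

theorem countPairs_spec (hn : σ.reg .n = n) (h0 : σ.reg .total = 0)
    (hP : ∀ s t : Fin n, σ.arr .pairs s t ≠ 0 ↔ (s, t) ∈ I.P) :
    (countPairs.ev σ).reg .total = I.P.card := by
  have key := forNodes_induction (σ := σ) (x := .s) (l := [forNodes .t [
      .when (get2 .pairs .s .t) [.set .total (.add (rd .total) (num 1))]]]) hn
    (fun k τ => τ.reg .total = (I.P.filter fun p => (p.1 : ℕ) < k).card) (by simp [h0]) ?_
  · refine key.trans (congrArg _ (Finset.filter_true_of_mem fun p _ => p.1.2))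
  intro k τ hf hτ
  have key := forNodes_induction (n := n) (σ := τ.setReg .s k) (x := .t) (l := [
      .when (get2 .pairs .s .t) [.set .total (.add (rd .total) (num 1))]])
    (by simpa using (hf.1 .n rfl).trans hn)
    (fun j τ => τ.reg .total =
      (I.P.filter fun p => (p.1 : ℕ) < k ∨ (p.1 = k ∧ (p.2 : ℕ) < j)).card) (by simpa using hτ) ?_
  · refine key.trans (congrArg _ (Finset.filter_congr fun p _ => ?_))
    have := Fin.val_inj (a := p.1) (b := k)
    have := p.2.2
    grind
  intro j τ' hf' hτ'
  have hs : τ'.reg .s = k := by simpa using hf'.1 .s rfl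
  have hpairs : τ'.arr .pairs = σ.arr .pairs := by
    rw [hf'.2 .pairs rfl]; simpa using hf.2 .pairs rfl
  have hiff := hP k j
  rw [← hpairs] at hiff
  simp only [ev_block_cons, ev_block_nil, ev_when, Expr.eval, ev_set, State.setReg_arr,
    State.setReg_reg, reduceCtorEq, if_false, if_true, hs, hiff]
  split_ifs with hmem
  · simp only [State.setReg_reg, reduceCtorEq, if_false, if_true]
    rw [hτ', ← Finset.card_insert_of_notMem (a := (k, j))]
    · congr 1
      ext ⟨s, t⟩
      have := Fin.val_inj (a := s) (b := k)
      have := Fin.val_inj (a := t) (b := j)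
      simp only [Finset.mem_insert, Finset.mem_filter, Prod.mk.injEq]
      grind
    · simp
  · simp only [State.setReg_reg, reduceCtorEq, if_false]
    rw [hτ']
    congr 1
    ext ⟨s, t⟩
    have := Fin.val_inj (a := s) (b := k)
    have := Fin.val_inj (a := t) (b := j)
    simp only [Finset.mem_filter]
    grind

/-- Clearing the denominator `b` turns the stretch condition into a comparison of natural numbers,
those stored in `lo` and `hi`. -/
theorem routable_iff (hℓ : ∀ e, I.len e = ℓ e) {a b : ℕ} (hb : 0 < b) (hρ : I.ρ = a / b)
    (h : Approx I ℓ n σ) (m s t : Fin n) :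
    I.Routable m (s, t) ↔ σ.arr .dist s t ≠ 0 ∧ σ.arr .dist s m ≠ 0 ∧ σ.arr .dist m t ≠ 0 ∧
      b * (σ.arr .dist s m - 1) + b * (σ.arr .dist m t - 1) ≤ a * (σ.arr .dist s t - 1) := by
  simp only [Instance.Routable, h.d_eq hℓ]
  by_cases h1 : σ.arr .dist s t = 0
  · simp [h1]
  -- Once `s` and `t` are connected the right-hand side is finite, so a route with an unreachable
  -- leg fails the inequality by itself.
  have hfin : (I.ρ : ℝ≥0∞) * ((σ.arr .dist s t - 1 : ℕ) : ℝ≥0∞) ≠ ∞ :=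
    ENNReal.mul_ne_top ENNReal.coe_ne_top (ENNReal.natCast_ne_top _)
  by_cases h2 : σ.arr .dist s m = 0
  · simp only [h1, h2, if_true, if_false, top_add, top_le_iff]
    exact iff_of_false (fun h => hfin h.2) (by simp)
  by_cases h3 : σ.arr .dist m t = 0
  · simp only [h1, h2, h3, if_true, if_false, add_top, top_le_iff]
    exact iff_of_false (fun h => hfin h.2) (by simp)
  simp only [h1, h2, h3, if_false, ne_eq, not_false_eq_true, true_and, ENNReal.natCast_ne_top]
  generalize σ.arr .dist s t - 1 = x
  generalize σ.arr .dist s m - 1 = y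
  generalize σ.arr .dist m t - 1 = z
  have hb' : (0 : ℝ≥0) < b := by exact_mod_cast hb
  have h4 : ((y : ℝ≥0∞) + z ≤ I.ρ * x) ↔ ((y : ℝ≥0) + z ≤ I.ρ * x) := by
    exact_mod_cast ENNReal.coe_le_coe (r := (y : ℝ≥0) + z) (q := I.ρ * x)
  rw [h4, hρ, div_mul_eq_mul_div, le_div_iff₀ hb']
  constructor
  · intro h5
    have : (y + z) * b ≤ a * x := by exact_mod_cast h5
    linarith
  · intro h5
    have : (y + z) * b ≤ a * x := by linarith
    exact_mod_cast this

/-- The state before the greedy iterations. -/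
theorem ready_preprocess (hℓ : ∀ e, I.len e = ℓ e) {a b : ℕ} (hb : 0 < b) (hρ : I.ρ = a / b) :
    Ready I ((block [shortestPaths, countPairs]).ev (I.input ℓ a b)) := by
  set σ₀ := I.input ℓ a b with hσ₀
  have hn0 : σ₀.reg .n = n := rfl
  have hpairs0 : ∀ s t : Fin n, σ₀.arr .pairs s t ≠ 0 ↔ (s, t) ∈ I.P := by
    intro s t
    simp [hσ₀, Instance.input]
  have hloc0 : ∀ m : Fin n, σ₀.arr .loc m 0 ≠ 0 ↔ m ∈ I.U := by
    intro m
    simp [hσ₀, Instance.input]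
  set σ₁ := distInit.ev σ₀
  have hf1 : distInit.Frame σ₀ σ₁ := frame_ev _ _
  have h1 : Approx I ℓ 0 σ₁ := distInit_spec hn0 (by intro u v; simp [hσ₀, Instance.input])
    (by intro u v; simp [hσ₀, Instance.input]) (by intro u v; simp [hσ₀, Instance.input])
  set σ₂ := (forNodes .r [relaxAll]).ev σ₁
  have hf2 : (forNodes .r [relaxAll]).Frame σ₁ σ₂ := frame_ev _ _
  have h2 : Approx I ℓ n σ₂ := relaxRounds_spec ((hf1.1 .n rfl).trans hn0) h1
  have hn2 : σ₂.reg .n = n := by rw [hf2.1 .n rfl, hf1.1 .n rfl]; rfl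
  have hden : σ₂.reg .den = b := by rw [hf2.1 .den rfl, hf1.1 .den rfl]; rfl
  have hnum : σ₂.reg .num = a := by rw [hf2.1 .num rfl, hf1.1 .num rfl]; rfl
  set σ₃ := scale.ev σ₂
  have hf3 : scale.Frame σ₂ σ₃ := frame_ev _ _
  have h3 := scale_spec hn2
  have hev : (block [shortestPaths, countPairs]).ev σ₀ = countPairs.ev σ₃ := by
    rw [ev_block_cons, ev_block_cons, ev_block_nil, shortestPaths_eq, ev_block_cons, ev_block_cons,
      ev_block_cons, ev_block_nil]
  rw [hev]
  have hf4 : countPairs.Frame σ₃ (countPairs.ev σ₃) := frame_ev _ _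
  have hpairs : σ₃.arr .pairs = σ₀.arr .pairs := by
    rw [hf3.2 .pairs rfl, hf2.2 .pairs rfl, hf1.2 .pairs rfl]
  have hn3 : σ₃.reg .n = n := by rw [hf3.1 .n rfl, hn2]
  refine ⟨?_, ?_, ?_, ?_, ?_⟩
  · rw [hf4.1 .n rfl, hn3]
  · rw [hf4.1 .kappa rfl, hf3.1 .kappa rfl, hf2.1 .kappa rfl, hf1.1 .kappa rfl]; rfl
  · refine countPairs_spec hn3 ?_ (by rwa [hpairs])
    rw [hf3.1 .total rfl, hf2.1 .total rfl, hf1.1 .total rfl]; rfl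
  · rw [hf4.2 .loc rfl, hf3.2 .loc rfl, hf2.2 .loc rfl, hf1.2 .loc rfl]
    exact hloc0
  · intro m s t
    simp only [EdgeCond]
    rw [hf4.2 .pairs rfl, hf4.2 .dist rfl, hf4.2 .lo rfl, hf4.2 .hi rfl, hpairs, hpairs0,
      (h3 _ _).1, (h3 _ _).1, (h3 _ _).2, hf3.2 .dist rfl, hden, hnum, routable_iff hℓ hb hρ h2]

end Prog

/-! ## Breadth-first search for an augmenting path -/

namespace Prog

open Stmt

variable {n : ℕ} {I : Instance n} {M : Finset (Fin n)} {A : Finset (Edge n)}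
  {σ : State Reg Arr}

theorem update₂_fin (f : ℕ → ℕ → ℕ) (i j i' j' : Fin n) (v : ℕ) :
    update₂ f i j v i' j' = if i' = i ∧ j' = j then v else f i' j' := by
  simp only [update₂_apply, Fin.val_inj]

theorem update₂_fin_zero (f : ℕ → ℕ → ℕ) (i i' : Fin n) (v : ℕ) :
    update₂ f i 0 v i' 0 = if i' = i then v else f i' 0 := by
  simp only [update₂_apply, Fin.val_inj, and_true]

/-- The array `f` represents the assignment `A`. -/
def RepAssign (f : ℕ → ℕ → ℕ) (A : Finset (Edge n)) : Prop :=
  (∀ m s t : Fin n, f s t = m + 1 ↔ (m, (s, t)) ∈ A) ∧ ∀ s t : Fin n, f s t ≤ n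

theorem RepAssign.eq_zero_or {f : ℕ → ℕ → ℕ} (h : RepAssign f A) (s t : Fin n) :
    f s t = 0 ∧ (s, t) ∉ served A ∨ ∃ m : Fin n, f s t = m + 1 ∧ (m, (s, t)) ∈ A := by
  rcases Nat.eq_zero_or_eq_succ_pred (f s t) with h0 | h0
  · refine Or.inl ⟨h0, fun hs => ?_⟩
    obtain ⟨m, hm⟩ := mem_served.1 hs
    rw [← h.1, h0] at hm
    omega
  · have := h.2 s t
    refine Or.inr ⟨⟨f s t - 1, by omega⟩, ?_⟩
    have h1 : f s t = ((⟨f s t - 1, by omega⟩ : Fin n) : ℕ) + 1 := h0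
    exact ⟨h1, (h.1 _ s t).1 h1⟩

/-- The one-dimensional array `f` represents the set `M`. -/
def RepSet (f : ℕ → ℕ → ℕ) (M : Finset (Fin n)) : Prop := ∀ m : Fin n, f m 0 ≠ 0 ↔ m ∈ M

/-- The one-dimensional array `f` contains the loads of the assignment `A`. -/
def RepLoad (f : ℕ → ℕ → ℕ) (A : Finset (Edge n)) : Prop := ∀ m : Fin n, f m 0 = load A m

/-- What the search relies on. -/
structure SearchInput (I : Instance n) (M : Finset (Fin n)) (A : Finset (Edge n))
    (σ : State Reg Arr) : Prop where
  ready : Ready I σ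
  inM : RepSet (σ.arr .inM) M
  asg : RepAssign (σ.arr .asgT) A
  load : RepLoad (σ.arr .loadT) A
  isPartial : I.IsPartial M A

theorem SearchInput.of_frame {s : S} {τ : State Reg Arr} (h : SearchInput I M A σ)
    (hf : s.Frame σ τ) (h1 : ([.n, .kappa, .total].all fun x => s.keepsReg x) = true)
    (h2 : ([.loc, .pairs, .dist, .lo, .hi].all fun a => s.keepsArr a) = true)
    (h3 : ([.inM, .asgT, .loadT].all fun a => s.keepsArr a) = true) : SearchInput I M A τ := by
  simp only [List.all_cons, List.all_nil, Bool.and_eq_true, and_true] at h3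
  refine ⟨h.ready.of_frame hf h1 h2, ?_, ?_, ?_, h.isPartial⟩
  · rw [hf.2 _ h3.1]; exact h.inM
  · rw [hf.2 _ h3.2.1]; exact h.asg
  · rw [hf.2 _ h3.2.2]; exact h.load

theorem SearchInput.setReg (h : SearchInput I M A σ) {x : Reg}
    (hx : ([.n, .kappa, .total].all fun y => y != x) = true) (v : ℕ) :
    SearchInput I M A (σ.setReg x v) :=
  ⟨h.ready.setReg hx v, h.inM, h.asg, h.load, h.isPartial⟩

/-- An edge between a middlebox and a pair that does not belong to the assignment. -/
def IsFreeEdge (I : Instance n) (A : Finset (Edge n)) (a s t : Fin n) : Prop :=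
  ((s, t) ∈ I.P ∧ I.Routable a (s, t)) ∧ (a, (s, t)) ∉ A

/-- The invariant of the search. -/
structure Search (I : Instance n) (M : Finset (Fin n)) (A : Finset (Edge n))
    (lev pre ps pt : ℕ → ℕ → ℕ) (found fs ft : ℕ) : Prop where
  start : ∀ a : Fin n, lev a 0 = 1 ↔ a ∈ M ∧ load A a < I.κ
  mem : ∀ a : Fin n, lev a 0 ≠ 0 → a ∈ M
  parent : ∀ b : Fin n, 2 ≤ lev b 0 → ∃ a s t : Fin n, ps b 0 = s ∧ pt b 0 = t ∧
    (b, (s, t)) ∈ A ∧ pre s t = a + 1 ∧ lev a 0 + 1 = lev b 0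
  pre_spec : ∀ s t : Fin n, pre s t ≠ 0 → (∃ a : Fin n, pre s t = a + 1 ∧ lev a 0 ≠ 0 ∧
    IsFreeEdge I A a s t) ∧ (∀ b : Fin n, (b, (s, t)) ∈ A → lev b 0 ≠ 0) ∧
    ((s, t) ∉ served A → found ≠ 0)
  found_spec : found ≠ 0 → ∃ s t : Fin n, fs = s ∧ ft = t ∧ (s, t) ∉ served A ∧ pre s t ≠ 0

def SearchState (I : Instance n) (M : Finset (Fin n)) (A : Finset (Edge n))
    (τ : State Reg Arr) : Prop :=
  Search I M A (τ.arr .lev) (τ.arr .pre) (τ.arr .ps) (τ.arr .pt) (τ.reg .found) (τ.reg .fs)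
    (τ.reg .ft)

/-- The changes of the state in round `r` of the search. -/
def SearchLE (n r : ℕ) (τ τ' : State Reg Arr) : Prop :=
  (∀ a : Fin n, τ.arr .lev a 0 ≠ 0 → τ'.arr .lev a 0 = τ.arr .lev a 0) ∧
  (∀ a : Fin n, τ.arr .lev a 0 = 0 → τ'.arr .lev a 0 = 0 ∨ τ'.arr .lev a 0 = r + 2) ∧
  ∀ s t : Fin n, τ.arr .pre s t ≠ 0 → τ'.arr .pre s t ≠ 0

theorem SearchLE.refl (r : ℕ) (τ : State Reg Arr) : SearchLE n r τ τ :=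
  ⟨fun _ _ => rfl, fun _ h => Or.inl h, fun _ _ h => h⟩

theorem SearchLE.trans {r : ℕ} (τ₁ τ₂ τ₃ : State Reg Arr) (h : SearchLE n r τ₁ τ₂)
    (h' : SearchLE n r τ₂ τ₃) : SearchLE n r τ₁ τ₃ := by
  refine ⟨fun a ha => ?_, fun a ha => ?_, fun s t hst => h'.2.2 s t (h.2.2 s t hst)⟩
  · rw [h'.1 a (by rwa [h.1 a ha]), h.1 a ha]
  · rcases h.2.1 a ha with h1 | h1
    · exact h'.2.1 a h1
    · rw [h'.1 a (by omega)]
      exact Or.inr h1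

/-- The edge from `a` to `(s, t)` has been inspected if `a` is on level `r + 1`. -/
def Visited (I : Instance n) (A : Finset (Edge n)) (r : ℕ) (a s t : Fin n)
    (τ : State Reg Arr) : Prop :=
  τ.arr .lev a 0 = r + 1 → IsFreeEdge I A a s t → τ.arr .pre s t ≠ 0

/-- Levels assigned during round `r` equal `r + 2`, so a middlebox found on level `r + 1` later in
the round was there already. -/
theorem Visited.mono {r : ℕ} {a s t : Fin n} {τ τ' : State Reg Arr} (h : SearchLE n r τ τ')
    (hv : Visited I A r a s t τ) : Visited I A r a s t τ' := by
  intro h1 h2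
  refine h.2.2 s t (hv ?_ h2)
  by_cases h0 : τ.arr .lev a 0 = 0
  · rcases h.2.1 a h0 with h3 | h3 <;> omega
  · rw [← h.1 a h0, h1]

def visit : S :=
  .when (all [edgeTest, .eq (get2 .pre .s .t) (num 0),
      .eq (.eq (get2 .asgT .s .t) (.add (rd .a) (num 1))) (num 0)]) [
    put2 .pre .s .t (.add (rd .a) (num 1)),
    .ite (.eq (get2 .asgT .s .t) (num 0))
      (.when (.eq (rd .found) (num 0)) [
        .set .found (num 1), .set .fs (rd .s), .set .ft (rd .t)])
      (.block [
        .set .cur (.sub (get2 .asgT .s .t) (num 1)),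
        .when (.eq (get1 .lev .cur) (num 0)) [
          put1 .lev .cur (.add (rd .r) (num 2)),
          put1 .ps .cur (rd .s),
          put1 .pt .cur (rd .t)]])]

def searchInit : S := .block [
  .set .found (num 0),
  forNodes .s [forNodes .t [put2 .pre .s .t (num 0)]],
  forNodes .a [
    put1 .lev .a (num 0),
    .when (all [get1 .inM .a, .le (.add (get1 .loadT .a) (num 1)) (rd .kappa)]) [
      put1 .lev .a (num 1)]]]

def searchRound : S := forNodes .a [
    .when (.eq (get1 .lev .a) (.add (rd .r) (num 1))) [forNodes .s [forNodes .t [visit]]]]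

theorem search_ev (σ : State Reg Arr) :
    search.ev σ = (forNodes .r [searchRound]).ev (searchInit.ev σ) := by
  simp only [search, searchInit, searchRound, visit, ev_block_cons, ev_block_nil]

/-! ### The three outcomes of inspecting an edge -/

section Visit

variable {lev pre ps pt : ℕ → ℕ → ℕ} {found fs ft : ℕ}

/-- The inspected pair may be free, as here, or belong to a middlebox already reached, or to a new
one. In all three cases the entry of `pre` that is written was 0, whereas parent pointers run
through pairs with nonzero `pre`; older pointers therefore remain valid. -/
theorem Search.visit_free (h : Search I M A lev pre ps pt found fs ft) {a s t : Fin n}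
    (ha : lev a 0 ≠ 0) (he : IsFreeEdge I A a s t) (hpre : pre s t = 0)
    (hfree : (s, t) ∉ served A) :
    Search I M A lev (update₂ pre s t (a + 1)) ps pt (if found = 0 then 1 else found)
      (if found = 0 then s else fs) (if found = 0 then t else ft) := by
  refine ⟨h.start, h.mem, fun b hb => ?_, fun s' t' hst => ?_, fun _ => ?_⟩
  · obtain ⟨a', s', t', h1, h2, h3, h4, h5⟩ := h.parent b hb
    refine ⟨a', s', t', h1, h2, h3, ?_, h5⟩
    rw [update₂_fin, if_neg, h4]
    rintro ⟨rfl, rfl⟩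
    omega
  · simp only [update₂_apply, Fin.val_inj] at hst ⊢
    split_ifs at hst ⊢ with h1
    · obtain ⟨rfl, rfl⟩ := h1
      exact ⟨⟨a, rfl, ha, he⟩, fun b hb => absurd (mem_served.2 ⟨b, hb⟩) hfree,
        fun _ => one_ne_zero⟩
    · obtain ⟨rfl, rfl⟩ := h1
      exact ⟨⟨a, rfl, ha, he⟩, fun b hb => absurd (mem_served.2 ⟨b, hb⟩) hfree,
        fun _ => by assumption⟩
    · obtain ⟨h2, h3, h4⟩ := h.pre_spec s' t' hst
      exact ⟨h2, h3, fun _ => one_ne_zero⟩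
    · exact h.pre_spec s' t' hst
  · split_ifs with h0
    · exact ⟨s, t, rfl, rfl, hfree, by simp [update₂_apply]⟩
    · obtain ⟨s', t', h1, h2, h3, h4⟩ := h.found_spec h0
      refine ⟨s', t', h1, h2, h3, ?_⟩
      rw [update₂_apply]
      split_ifs
      · omega
      · exact h4

theorem Search.visit_reached (h : Search I M A lev pre ps pt found fs ft) {a s t c : Fin n}
    (ha : lev a 0 ≠ 0) (he : IsFreeEdge I A a s t) (hpre : pre s t = 0)
    (hA : I.IsPartial M A) (hc : (c, (s, t)) ∈ A) (hlev : lev c 0 ≠ 0) :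
    Search I M A lev (update₂ pre s t (a + 1)) ps pt found fs ft := by
  refine ⟨h.start, h.mem, fun b hb => ?_, fun s' t' hst => ?_, fun h0 => ?_⟩
  · obtain ⟨a', s', t', h1, h2, h3, h4, h5⟩ := h.parent b hb
    refine ⟨a', s', t', h1, h2, h3, ?_, h5⟩
    rw [update₂_fin, if_neg, h4]
    rintro ⟨rfl, rfl⟩
    omega
  · simp only [update₂_apply, Fin.val_inj] at hst ⊢
    split_ifs at hst ⊢ with h1
    · obtain ⟨rfl, rfl⟩ := h1
      refine ⟨⟨a, rfl, ha, he⟩, fun b hb => ?_, fun hn => absurd (mem_served.2 ⟨c, hc⟩) hn⟩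
      rwa [hA.unique b c _ hb hc]
    · exact h.pre_spec s' t' hst
  · obtain ⟨s', t', h1, h2, h3, h4⟩ := h.found_spec h0
    refine ⟨s', t', h1, h2, h3, ?_⟩
    rw [update₂_apply]
    split_ifs
    · omega
    · exact h4

/-- The new level `r + 2` is at least 2, so `c` is not mistaken for a middlebox with free capacity,
and it exceeds the level of its parent `a` by exactly one. -/
theorem Search.visit_new (h : Search I M A lev pre ps pt found fs ft) {a s t c : Fin n} {r : ℕ}
    (ha : lev a 0 = r + 1) (he : IsFreeEdge I A a s t) (hpre : pre s t = 0)
    (hA : I.IsPartial M A) (hc : (c, (s, t)) ∈ A) (hlev : lev c 0 = 0) :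
    Search I M A (update₂ lev c 0 (r + 2)) (update₂ pre s t (a + 1)) (update₂ ps c 0 s)
      (update₂ pt c 0 t) found fs ft := by
  have hmono : ∀ b : Fin n, lev b 0 ≠ 0 → update₂ lev c 0 (r + 2) b 0 = lev b 0 := by
    intro b hb
    rw [update₂_apply, if_neg]
    rintro ⟨hbc, -⟩
    rw [hbc] at hb
    exact hb hlev
  refine ⟨fun b => ?_, fun b hb => ?_, fun b hb => ?_, fun s' t' hst => ?_, fun h0 => ?_⟩
  · rw [← h.start, update₂_fin_zero]
    split_ifs with hbc
    · rw [hbc, hlev]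
      omega
    · rfl
  · rw [update₂_fin_zero] at hb
    split_ifs at hb with hbc
    · rw [hbc]
      exact (Instance.mem_B.1 (hA.sub hc)).1
    · exact h.mem b hb
  · by_cases hbc : b = c
    · subst hbc
      refine ⟨a, s, t, by simp [update₂_apply], by simp [update₂_apply], hc,
        by simp [update₂_apply], ?_⟩
      rw [hmono a (by omega), ha]
      simp [update₂_apply]
    · simp only [update₂_fin_zero, if_neg hbc] at hb ⊢
      obtain ⟨a', s', t', h1, h2, h3, h4, h5⟩ := h.parent b hb
      refine ⟨a', s', t', h1, h2, h3, ?_, ?_⟩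
      · rw [update₂_fin, if_neg, h4]
        rintro ⟨rfl, rfl⟩
        omega
      · rw [← h5]
        have := hmono a' (by omega)
        rw [update₂_fin_zero] at this
        rw [this]
  · by_cases h1 : s' = s ∧ t' = t
    · obtain ⟨rfl, rfl⟩ := h1
      refine ⟨⟨a, by simp [update₂_apply], ?_, he⟩, fun b hb => ?_,
        fun hn => absurd (mem_served.2 ⟨c, hc⟩) hn⟩
      · rw [hmono a (by omega)]
        omega
      · rw [hA.unique b c _ hb hc]
        simp [update₂_apply]
    · have h1' : ¬ ((s' : ℕ) = s ∧ (t' : ℕ) = t) := by rwa [Fin.val_inj, Fin.val_inj]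
      rw [update₂_apply, if_neg h1'] at hst ⊢
      obtain ⟨⟨a', h2, h3, h4⟩, h5, h6⟩ := h.pre_spec s' t' hst
      refine ⟨⟨a', h2, by rwa [hmono a' h3], h4⟩, fun b hb => ?_, h6⟩
      rw [hmono b (h5 b hb)]
      exact h5 b hb
  · obtain ⟨s', t', h1, h2, h3, h4⟩ := h.found_spec h0
    refine ⟨s', t', h1, h2, h3, ?_⟩
    rw [update₂_apply]
    split_ifs
    · omega
    · exact h4

end Visit

theorem visit_spec (hσ : SearchInput I M A σ) (h : SearchState I M A σ) {r : ℕ} {a s t : Fin n}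
    (hr : σ.reg .r = r) (ha : σ.reg .a = a) (hs : σ.reg .s = s) (ht : σ.reg .t = t)
    (hlev : σ.arr .lev a 0 = r + 1) :
    SearchState I M A (visit.ev σ) ∧ Visited I A r a s t (visit.ev σ) ∧
      SearchLE n r σ (visit.ev σ) := by
  have hcond : (all [edgeTest, .eq (get2 .pre .s .t) (num 0),
      .eq (.eq (get2 .asgT .s .t) (.add (rd .a) (num 1))) (num 0)]).eval σ ≠ 0 ↔
      IsFreeEdge I A a s t ∧ σ.arr .pre s t = 0 := by
    have h1 := eval_edgeTest (σ := σ)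
    rw [ha, hs, ht, hσ.ready.edge_iff] at h1
    simp only [ne_eq, eval_all_cons_eq_zero, eval_all_nil_eq_zero, not_not, eval_eq_eq_zero,
      eval_get, eval_reg, eval_lit, eval_add, ha, hs, ht] at h1 ⊢
    rw [h1, hσ.asg.1, IsFreeEdge]
    tauto
  by_cases hc : IsFreeEdge I A a s t ∧ σ.arr .pre s t = 0
  swap
  · have : visit.ev σ = σ := by rw [visit, ev_when, if_neg (fun hx => hc (hcond.1 hx))]
    rw [this]
    exact ⟨h, fun _ h2 h3 => hc ⟨h2, h3⟩, .refl r σ⟩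
  have hev := ev_when σ (all [edgeTest, .eq (get2 .pre .s .t) (num 0),
      .eq (.eq (get2 .asgT .s .t) (.add (rd .a) (num 1))) (num 0)]) [
    put2 .pre .s .t (.add (rd .a) (num 1)),
    .ite (.eq (get2 .asgT .s .t) (num 0))
      (.when (.eq (rd .found) (num 0)) [
        .set .found (num 1), .set .fs (rd .s), .set .ft (rd .t)])
      (.block [
        .set .cur (.sub (get2 .asgT .s .t) (num 1)),
        .when (.eq (get1 .lev .cur) (num 0)) [
          put1 .lev .cur (.add (rd .r) (num 2)),
          put1 .ps .cur (rd .s),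
          put1 .pt .cur (rd .t)]])]
  rw [if_pos (hcond.2 hc)] at hev
  change visit.ev σ = _ at hev
  obtain ⟨hfe, hpre⟩ := hc
  simp only [ev_block_cons, ev_block_nil, ev_put, eval_reg, eval_add, eval_lit, ha, hs, ht] at hev
  set σ' := σ.setArr .pre s t (a + 1) with hσ'
  have hupd : ∀ s' t' : Fin n, σ.arr .pre s' t' ≠ 0 →
      update₂ (σ.arr .pre) s t (a + 1) s' t' ≠ 0 := by
    intro s' t' h'
    rw [update₂_apply]
    split_ifs
    · omega
    · exact h'
  rcases hσ.asg.eq_zero_or s t with ⟨h0, hfree⟩ | ⟨c, h0, hmem⟩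
  · have hasg : (Expr.eq (get2 .asgT .s .t) (num 0) : E).eval σ' ≠ 0 := by
      simp [hσ', hs, ht, h0]
    rw [ev_ite, if_pos hasg] at hev
    have hval : (visit.ev σ).arr = σ'.arr ∧
        (visit.ev σ).reg .found = (if σ.reg .found = 0 then 1 else σ.reg .found) ∧
        (visit.ev σ).reg .fs = (if σ.reg .found = 0 then (s : ℕ) else σ.reg .fs) ∧
        (visit.ev σ).reg .ft = (if σ.reg .found = 0 then (t : ℕ) else σ.reg .ft) := by
      rw [hev, ev_when]
      by_cases hf : σ.reg .found = 0
      · rw [if_pos (by simp [hσ', hf])]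
        simp [hσ', hs, ht, hf]
      · rw [if_neg (by simp [hσ', hf])]
        simp [hσ', hf]
    obtain ⟨h1, h2, h3, h4⟩ := hval
    have hpre' : σ'.arr .pre = update₂ (σ.arr .pre) s t (a + 1) := by simp [hσ']
    have hlev' : σ'.arr .lev = σ.arr .lev := by simp [hσ']
    refine ⟨?_, ?_, ?_⟩
    · have := h.visit_free (a := a) (by omega) hfe hpre hfree
      rw [← hpre', ← hlev'] at this
      rw [SearchState, h1, h2, h3, h4]
      simpa [hσ'] using this
    · intro _ _
      rw [h1, hpre']
      simp [update₂_apply]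
    · rw [SearchLE, h1, hpre', hlev']
      exact ⟨fun _ _ => rfl, fun _ h => Or.inl h, hupd⟩
  · have hasg : ¬ (Expr.eq (get2 .asgT .s .t) (num 0) : E).eval σ' ≠ 0 := by
      simp [hσ', hs, ht, h0]
    rw [ev_ite, if_neg hasg] at hev
    have hcur : σ.arr .asgT s t - 1 = c := by omega
    simp only [ev_block_cons, ev_block_nil, ev_set, ev_when] at hev
    have hpre' : σ'.arr .pre = update₂ (σ.arr .pre) s t (a + 1) := by simp [hσ']
    by_cases hl : σ.arr .lev c 0 = 0
    · rw [if_pos (by simp [hσ', hs, ht, hcur, hl])] at hev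
      have hval : (visit.ev σ).arr .lev = update₂ (σ.arr .lev) c 0 (r + 2) ∧
          (visit.ev σ).arr .pre = update₂ (σ.arr .pre) s t (a + 1) ∧
          (visit.ev σ).arr .ps = update₂ (σ.arr .ps) c 0 s ∧
          (visit.ev σ).arr .pt = update₂ (σ.arr .pt) c 0 t ∧
          (visit.ev σ).reg .found = σ.reg .found ∧ (visit.ev σ).reg .fs = σ.reg .fs ∧
          (visit.ev σ).reg .ft = σ.reg .ft := by
        rw [hev]
        simp [hσ', hs, ht, hcur, hr]
      obtain ⟨h1, h2, h3, h4, h5, h6, h7⟩ := hval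
      refine ⟨?_, ?_, ?_⟩
      · rw [SearchState, h1, h2, h3, h4, h5, h6, h7]
        exact h.visit_new hlev hfe hpre hσ.isPartial hmem hl
      · intro _ _
        rw [h2]
        simp [update₂_apply]
      · rw [SearchLE, h1, h2]
        refine ⟨fun b hb => ?_, fun b hb => ?_, hupd⟩
        · rw [update₂_apply, if_neg]
          rintro ⟨hbc, -⟩
          rw [hbc] at hb
          exact hb hl
        · rw [update₂_apply]
          split_ifs
          · exact Or.inr rfl
          · exact Or.inl hb
    · rw [if_neg (by simp [hσ', hs, ht, hcur, hl])] at hev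
      have hval : (visit.ev σ).arr = σ'.arr ∧
          (visit.ev σ).reg .found = σ.reg .found ∧ (visit.ev σ).reg .fs = σ.reg .fs ∧
          (visit.ev σ).reg .ft = σ.reg .ft := by
        rw [hev]
        simp [hσ']
      obtain ⟨h1, h2, h3, h4⟩ := hval
      have hlev' : σ'.arr .lev = σ.arr .lev := by simp [hσ']
      refine ⟨?_, ?_, ?_⟩
      · have := h.visit_reached (a := a) (by omega) hfe hpre hσ.isPartial hmem hl
        rw [← hpre', ← hlev'] at this
        rw [SearchState, h1, h2, h3, h4]
        simpa [hσ'] using this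
      · intro _ _
        rw [h1, hpre']
        simp [update₂_apply]
      · rw [SearchLE, h1, hpre', hlev']
        exact ⟨fun _ _ => rfl, fun _ h => Or.inl h, hupd⟩

/-- All edges at middleboxes on the levels up to `r` have been inspected. -/
def SearchDone (I : Instance n) (A : Finset (Edge n)) (r : ℕ) (τ : State Reg Arr) : Prop :=
  ∀ a s t : Fin n, τ.arr .lev a 0 ≠ 0 → τ.arr .lev a 0 ≤ r → IsFreeEdge I A a s t →
    τ.arr .pre s t ≠ 0

/-- Round `r` scans the edges at level `r + 1`. Middleboxes discovered meanwhile go to level `r + 2`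
and make no claim on this round. -/
theorem searchRound_spec {r : ℕ} (hσ : SearchInput I M A σ) (h : SearchState I M A σ)
    (hr : σ.reg .r = r) (hd : SearchDone I A r σ) :
    SearchState I M A (searchRound.ev σ) ∧ SearchDone I A (r + 1) (searchRound.ev σ) := by
  have key := forNodes_forall (σ := σ) (x := .a) (l := [
      .when (.eq (get1 .lev .a) (.add (rd .r) (num 1))) [forNodes .s [forNodes .t [visit]]]])
    hσ.ready.n_eq (Inv := SearchState I M A) (Vis := fun a τ => ∀ s t, Visited I A r a s t τ)
    (R := SearchLE n r) (SearchLE.refl r) SearchLE.trans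
    (fun a τ τ' hR hV s t => (hV s t).mono hR) h ?_
  · obtain ⟨h1, h2, h3⟩ := key
    refine ⟨h1, fun a s t ha hle he => ?_⟩
    rcases Nat.le_succ_iff.1 hle with hle | heq
    -- A middlebox on a level at most `r` was on it before the round, since new levels are `r + 2`.
    · refine h3.2.2 s t (hd a s t ?_ ?_ he)
      · intro h0
        rcases h3.2.1 a h0 with h4 | h4
        · exact ha h4
        · have : (searchRound.ev σ).arr .lev a 0 = r + 2 := h4
          omega
      · by_cases h0 : σ.arr .lev a 0 = 0
        · omega
        · rw [← h3.1 a h0]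
          exact hle
    · exact h2 a s t heq he
  intro a τ hfa hτ
  have hτi := hσ.of_frame hfa rfl rfl rfl
  have hτr := (hfa.1 .r rfl).trans hr
  rw [ev_block_cons, ev_block_nil, ev_when]
  by_cases ha : τ.arr .lev a 0 = r + 1
  swap
  · rw [if_neg (by simp [hτr, ha])]
    exact ⟨hτ, fun s t h1 => absurd h1 ha, SearchLE.refl r τ⟩
  rw [if_pos (by simp [hτr, ha]), ev_block_cons, ev_block_nil]
  have key := forNodes_forall (σ := τ.setReg .a a) (x := .s) (l := [forNodes .t [visit]]) (n := n)
    (by simpa using hτi.ready.n_eq)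
    (Inv := fun τ => SearchState I M A τ ∧ τ.arr .lev a 0 = r + 1)
    (Vis := fun s τ => ∀ t, Visited I A r a s t τ)
    (R := SearchLE n r) (SearchLE.refl r) SearchLE.trans
    (fun s τ τ' hR hV t => (hV t).mono hR) ⟨hτ, ha⟩ ?_
  · exact ⟨key.1.1, key.2.1, key.2.2⟩
  rintro s τ' hfs ⟨hτ', ha'⟩
  have hτi' := (hτi.setReg (x := .a) rfl a).of_frame hfs rfl rfl rfl
  have key := forNodes_forall (σ := τ'.setReg .s s) (x := .t) (l := [visit]) (n := n)
    (by simpa using hτi'.ready.n_eq)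
    (Inv := fun τ => SearchState I M A τ ∧ τ.arr .lev a 0 = r + 1)
    (Vis := fun t τ => Visited I A r a s t τ)
    (R := SearchLE n r) (SearchLE.refl r) SearchLE.trans
    (fun t τ τ' hR hV => hV.mono hR) ⟨hτ', ha'⟩ ?_
  · exact key
  rintro t τ'' hft ⟨hτ'', ha''⟩
  have hτi'' := ((hτi'.setReg (x := .s) rfl s).of_frame hft rfl rfl rfl).setReg (x := .t) rfl t
  have e1 : τ''.reg .r = r := by
    rw [hft.1 .r rfl]
    simp [hfs.1 .r rfl, hτr]
  have e2 : τ''.reg .a = a := by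
    rw [hft.1 .a rfl]
    simp [hfs.1 .a rfl]
  have e3 : τ''.reg .s = s := by
    rw [hft.1 .s rfl]
    simp
  obtain ⟨h1, h2, h3⟩ := visit_spec (r := r) (a := a) (s := s) (t := t) hτi'' hτ''
    (by simpa using e1) (by simpa using e2) (by simpa using e3) (by simp) ha''
  refine ⟨⟨h1, ?_⟩, h2, h3⟩
  rw [ev_block_cons, ev_block_nil, h3.1 a (by rw [State.setReg_arr, ha'']; omega)]
  exact ha''

end Prog

namespace Prog

open Stmt

variable {n : ℕ} {I : Instance n} {M : Finset (Fin n)} {A : Finset (Edge n)}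
  {σ : State Reg Arr}

theorem searchInit_spec (hσ : SearchInput I M A σ) :
    SearchInput I M A (searchInit.ev σ) ∧ SearchState I M A (searchInit.ev σ) := by
  have hout := hσ.of_frame (frame_ev σ searchInit) rfl rfl rfl
  refine ⟨hout, ?_⟩
  set τ := searchInit.ev σ with hτ
  rw [searchInit, ev_block_cons, ev_block_cons, ev_block_cons, ev_block_nil] at hτ
  set σ₁ := (Stmt.set .found (num 0) : S).ev σ
  have hσ₁ : SearchInput I M A σ₁ := hσ.of_frame (frame_ev σ _) rfl rfl rfl
  set σ₂ := (forNodes .s [forNodes .t [put2 .pre .s .t (num 0)]]).ev σ₁ with hσ₂def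
  have hσ₂ : SearchInput I M A σ₂ := hσ₁.of_frame (frame_ev σ₁ _) rfl rfl rfl
  have hfound : τ.reg .found = 0 := by
    rw [hτ, ev_reg _ rfl, hσ₂def, ev_reg _ rfl]
    simp [σ₁]
  have hpre : ∀ s t : Fin n, τ.arr .pre s t = 0 := by
    rw [hτ, ev_arr _ rfl]
    refine (forNodes_forall (n := n) (σ := σ₁) (x := .s) (l := [forNodes .t [put2 .pre .s .t (num 0)]])
      hσ₁.ready.n_eq (Inv := fun _ => True) (Vis := fun s τ => ∀ t : Fin n, τ.arr .pre s t = 0)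
      (R := fun τ τ' => ∀ s t : Fin n, τ.arr .pre s t = 0 → τ'.arr .pre s t = 0)
      (fun _ _ _ => id) (fun _ _ _ h h' s t h0 => h' s t (h s t h0))
      (fun s τ τ' hR hV t => hR s t (hV t)) trivial ?_).2.1
    intro s τ₁ hf _
    refine forNodes_forall (n := n) (σ := τ₁.setReg .s s) (x := .t) (l := [put2 .pre .s .t (num 0)])
      (by simpa using (hf.1 .n rfl).trans hσ₁.ready.n_eq) (Inv := fun _ => True)
      (Vis := fun t τ => τ.arr .pre s t = 0)
      (R := fun τ τ' => ∀ s t : Fin n, τ.arr .pre s t = 0 → τ'.arr .pre s t = 0)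
      (fun _ _ _ => id) (fun _ _ _ h h' s t h0 => h' s t (h s t h0))
      (fun t τ τ' hR hV => hR s t hV) trivial ?_
    intro t τ₂ hf₂ _
    have hs : τ₂.reg .s = s := by
      rw [hf₂.1 .s rfl]
      simp
    refine ⟨trivial, by simp [hs, update₂_fin], fun s' t' h0 => ?_⟩
    simp [hs, update₂_fin, h0]
  have hlev : ∀ a : Fin n, τ.arr .lev a 0 = if a ∈ M ∧ load A a < I.κ then 1 else 0 := by
    intro a
    have key := forNodes_induction (n := n) (σ := σ₂) (x := .a) (l := [put1 .lev .a (num 0),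
        .when (all [get1 .inM .a, .le (.add (get1 .loadT .a) (num 1)) (rd .kappa)]) [
          put1 .lev .a (num 1)]]) hσ₂.ready.n_eq
      (fun k τ => ∀ a : Fin n, (a : ℕ) < k →
        τ.arr .lev a 0 = if a ∈ M ∧ load A a < I.κ then 1 else 0)
      (fun a ha => absurd ha (Nat.not_lt_zero _)) ?_
    · exact key a a.2
    intro k τ₁ hf hτ₁ a ha
    have h1 := hσ₂.of_frame hf rfl rfl rfl
    have h2 : τ₁.arr .loadT k 0 = load A k := h1.load k
    rw [ev_block_cons, ev_block_cons, ev_block_nil, ev_when]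
    set τ₂ := (put1 .lev .a (num 0)).ev (τ₁.setReg .a k) with hτ₂
    have hcond : (all [get1 .inM .a, .le (.add (get1 .loadT .a) (num 1)) (rd .kappa)]).eval τ₂ ≠ 0 ↔
        k ∈ M ∧ load A k < I.κ := by
      rw [← h1.inM k]
      simp [hτ₂, h1.ready.kappa_eq, h2]
    have hne : ∀ v w, a ≠ k → (((τ₁.setReg .a k).setArr .lev k 0 v).setArr .lev k 0 w).arr .lev a 0 =
        if a ∈ M ∧ load A a < I.κ then 1 else 0 := by
      intro v w hak
      simp only [State.setArr_arr, if_true, update₂_fin_zero, if_neg hak, State.setReg_arr]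
      refine hτ₁ a ?_
      have := Fin.val_ne_of_ne hak
      omega
    by_cases hk : k ∈ M ∧ load A k < I.κ
    · rw [if_pos (hcond.2 hk)]
      by_cases hak : a = k
      · rw [hak, if_pos hk]
        simp [hτ₂, update₂_apply]
      · have := hne 0 1 hak
        simpa [hτ₂] using this
    · rw [if_neg fun h => hk (hcond.1 h)]
      by_cases hak : a = k
      · rw [hak, if_neg hk]
        simp [hτ₂, update₂_apply]
      · have := hne 0 0 hak
        simpa [hτ₂, update₂_fin_zero, hak] using this
  refine ⟨fun a => ?_, fun a ha => ?_, fun b hb => ?_, fun s t hst => absurd (hpre s t) hst,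
    fun h0 => absurd hfound h0⟩
  · rw [hlev]
    simp
  · rw [hlev] at ha
    by_contra hM
    simp [hM] at ha
  -- Initial levels are 0 or 1, so no parent pointer is required yet.
  · rw [hlev] at hb
    split_ifs at hb <;> omega

theorem search_invariant (hσ : SearchInput I M A σ) :
    SearchInput I M A (search.ev σ) ∧ SearchState I M A (search.ev σ) ∧
      SearchDone I A n (search.ev σ) := by
  refine ⟨hσ.of_frame (frame_ev σ search) rfl rfl rfl, ?_⟩
  rw [search_ev]
  obtain ⟨h1, h2⟩ := searchInit_spec hσ
  refine forNodes_induction (n := n) h1.ready.n_eq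
    (fun r τ => SearchState I M A τ ∧ SearchDone I A r τ)
    ⟨h2, fun a s t h h' => absurd (Nat.le_zero.1 h') h⟩ ?_
  rintro r τ hf ⟨h3, h4⟩
  exact searchRound_spec ((h1.of_frame hf rfl rfl rfl).setReg rfl r) h3 (by simp) h4

/-! ### Reading an augmenting path off the pointers -/

section Trace

variable {lev pre ps pt : ℕ → ℕ → ℕ} {found fs ft : ℕ}

/-- Following parents from `a` meets every level below that of `a`, and distinct levels belong to
distinct middleboxes. Hence `n` rounds exhaust the search, and traced paths have at most `n` odd
edges. -/
theorem Search.lev_le (h : Search I M A lev pre ps pt found fs ft) (a : Fin n) :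
    lev a 0 ≤ n := by
  have key : ∀ j, j < lev a 0 → ∃ b : Fin n, lev b 0 = lev a 0 - j := by
    intro j
    induction j with
    | zero => exact fun _ => ⟨a, rfl⟩
    | succ j ih =>
      intro hj
      obtain ⟨b, hb⟩ := ih (by omega)
      obtain ⟨c, s, t, -, -, -, -, hc⟩ := h.parent b (by omega)
      exact ⟨c, by omega⟩
  choose f hf using key
  have hinj : Function.Injective fun j : Fin (lev a 0) => f j j.2 := by
    intro i j hij
    have h1 := hf i i.2
    have h2 := hf j j.2
    simp only at hij
    rw [hij, h2] at h1
    ext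
    omega
  simpa using Fintype.card_le_of_injective _ hinj

/-- The path `π` is found by following the pointers of the search, starting at the pair
`(s, t)`. -/
inductive Trace (lev pre ps pt : ℕ → ℕ → ℕ) : Fin n → Fin n → List (Edge n) → Prop
  | start {m s t : Fin n} : pre s t = m + 1 → lev m 0 = 1 → Trace lev pre ps pt s t [(m, (s, t))]
  | step {m s t s' t' : Fin n} {π : List (Edge n)} : pre s t = m + 1 → lev m 0 ≠ 1 →
      ps m 0 = s' → pt m 0 = t' → Trace lev pre ps pt s' t' π →
      Trace lev pre ps pt s t (π ++ [(m, (s, t))])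

/-- Induction on the level: the parent pointer supplies the even edge, and the odd edges pass
through levels `1, …, k`. As levels increase strictly along the path, its middleboxes are distinct,
and level 1 means free capacity at the start. -/
theorem Search.exists_trace (h : Search I M A lev pre ps pt found fs ft) (k : ℕ) (m s t : Fin n)
    (hm : pre s t = m + 1) (hk : lev m 0 = k) :
    ∃ ρ, Trace lev pre ps pt s t (ρ ++ [(m, (s, t))]) ∧ ρ.length + 1 = k ∧
      (∀ e ∈ ρ ++ [(m, (s, t))], e ∈ I.B M ∧ e ∉ A) ∧
      (∀ e ∈ evenEdges (ρ ++ [(m, (s, t))]), e ∈ A) ∧ (∀ e ∈ ρ, lev e.1 0 < k) ∧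
      ((ρ ++ [(m, (s, t))]).map Prod.fst).Nodup ∧
      ∃ e ∈ (ρ ++ [(m, (s, t))]).head?, load A e.1 < I.κ := by
  induction k generalizing m s t with
  | zero =>
    obtain ⟨⟨a, ha, hl, -⟩, -⟩ := h.pre_spec s t (by omega)
    have : a = m := Fin.ext (by omega)
    rw [this] at hl
    exact absurd hk hl
  | succ k ih =>
    obtain ⟨⟨a, ha, hl, he⟩, -⟩ := h.pre_spec s t (by omega)
    obtain rfl : a = m := Fin.ext (by omega)
    have hB : (a, (s, t)) ∈ I.B M ∧ (a, (s, t)) ∉ A :=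
      ⟨Instance.mem_B.2 ⟨h.mem a hl, he.1⟩, he.2⟩
    rcases Nat.eq_zero_or_pos k with rfl | hpos
    · exact ⟨[], .start hm hk, rfl, by simpa using hB, by simp, by simp, by simp,
        by simpa using ((h.start a).1 hk).2⟩
    · obtain ⟨b, s', t', h1, h2, h3, h4, h5⟩ := h.parent a (by omega)
      obtain ⟨ρ, i1, i2, i3, i4, i5, i6, i7⟩ := ih b s' t' h4 (by omega)
      have hlt : ∀ e ∈ ρ ++ [(b, (s', t'))], lev e.1 0 < k + 1 := by
        intro e he
        rcases List.mem_append.1 he with he | he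
        · exact (i5 e he).trans (Nat.lt_succ_self _)
        · rw [List.mem_singleton.1 he]
          dsimp only
          omega
      refine ⟨ρ ++ [(b, (s', t'))], .step hm (by omega) h1 h2 i1, by simp; omega, ?_, ?_, hlt, ?_, ?_⟩
      · intro e he
        rcases List.mem_append.1 he with he | he
        · exact i3 e he
        · rw [List.mem_singleton.1 he]
          exact hB
      · rw [evenEdges_concat]
        intro e he
        rcases List.mem_append.1 he with he | he
        · exact i4 e he
        · rw [List.mem_singleton.1 he]
          exact h3
      · rw [List.map_append, List.nodup_append']
        refine ⟨i6, by simp, ?_⟩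
        rw [List.map_singleton, List.disjoint_singleton]
        intro hmem
        obtain ⟨e, he, hea⟩ := List.mem_map.1 hmem
        have := hlt e he
        rw [hea] at this
        dsimp only at this
        omega
      · obtain ⟨e, he, hload⟩ := i7
        refine ⟨e, ?_, hload⟩
        rw [Option.mem_def] at he ⊢
        rw [List.head?_append, he]
        rfl

end Trace

/-- If no free pair has been found, the assignment is maximum; otherwise the pointers describe an
augmenting path. -/
theorem search_spec (hσ : SearchInput I M A σ) {τ : State Reg Arr} (hτ : τ = search.ev σ) :
    SearchInput I M A τ ∧ (τ.reg .found = 0 → A.card = I.φ M) ∧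
      (τ.reg .found ≠ 0 → ∃ (s t : Fin n) (π : List (Edge n)),
        τ.reg .fs = s ∧ τ.reg .ft = t ∧ π.length ≤ n ∧
        Trace (τ.arr .lev) (τ.arr .pre) (τ.arr .ps) (τ.arr .pt) s t π ∧ I.IsAugPath M A π) := by
  obtain ⟨h1, h2, h3⟩ := search_invariant hσ
  rw [← hτ] at h1 h2 h3
  have hA := hσ.isPartial
  refine ⟨h1, fun h0 => le_antisymm hA.card_le_φ ?_, fun h0 => ?_⟩
  · obtain ⟨A', hA', hc⟩ := I.exists_card_eq_φ M
    rw [← hc]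
    -- The reached middleboxes form the cut. An unreached one is full, as it would otherwise be on
    -- level 1. Every edge outside `A` at a reached one has been inspected, so its pair is either
    -- free, which contradicts `found = 0`, or has its owner reached.
    refine hA.card_le_of_cut hA' (fun a => τ.arr .lev a 0 ≠ 0) (fun a ha hl => ?_) ?_
    · by_contra hlt
      have := (h2.start a).2 ⟨ha, not_le.1 hlt⟩
      omega
    · rintro a ⟨s, t⟩ hl hB
      by_cases hmem : (a, (s, t)) ∈ A
      · exact ⟨a, hl, hmem⟩
      have hpre := h3 a s t hl (h2.lev_le a) ⟨(Instance.mem_B.1 hB).2, hmem⟩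
      obtain ⟨-, h4, h5⟩ := h2.pre_spec s t hpre
      by_cases hs : (s, t) ∈ served A
      · obtain ⟨b, hb⟩ := mem_served.1 hs
        exact ⟨b, h4 b hb, hb⟩
      · exact absurd h0 (h5 hs)
  · obtain ⟨s, t, hs, ht, hfree, hpre⟩ := h2.found_spec h0
    obtain ⟨⟨m, hm, -, -⟩, -⟩ := h2.pre_spec s t hpre
    obtain ⟨ρ, i1, i2, i3, i4, i5, i6, i7⟩ := h2.exists_trace _ m s t hm rfl
    refine ⟨s, t, _, hs, ht, ?_, i1, i7, by simpa using hfree, i3, i4, i6,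
      Instance.nodup_right_of_nodup_left hA hfree i4 i6⟩
    rw [List.length_append, List.length_singleton, i2]
    exact h2.lev_le m

/-! ## Augmentation -/

def hop : S :=
  .when (rd .act) [
    .set .cur (.sub (get2 .pre .cs .ct) (num 1)),
    put2 .asgT .cs .ct (.add (rd .cur) (num 1)),
    .ite (.eq (get1 .lev .cur) (num 1))
      (.block [
        put1 .loadT .cur (.add (get1 .loadT .cur) (num 1)),
        .set .act (num 0)])
      (.block [
        .set .cs (get1 .ps .cur),
        .set .ct (get1 .pt .cur)])]

/-- The array `f` represents the assignment `A` after the pairs of the edges in `l` have been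
reassigned according to `l`. -/
def RepOverride (f : ℕ → ℕ → ℕ) (A : Finset (Edge n)) (l : List (Edge n)) : Prop :=
  (∀ m s t : Fin n, f s t = m + 1 ↔
    (m, (s, t)) ∈ l ∨ (m, (s, t)) ∈ A ∧ (s, t) ∉ l.map Prod.snd) ∧ ∀ s t : Fin n, f s t ≤ n

theorem RepAssign.override_nil {f : ℕ → ℕ → ℕ} (h : RepAssign f A) : RepOverride f A [] :=
  ⟨by simpa using h.1, h.2⟩

theorem RepOverride.cons {f : ℕ → ℕ → ℕ} {l : List (Edge n)} {m s t : Fin n}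
    (h : RepOverride f A l) (hl : (s, t) ∉ l.map Prod.snd) :
    RepOverride (update₂ f s t (m + 1)) A ((m, (s, t)) :: l) := by
  refine ⟨fun m' s' t' => ?_, fun s' t' => ?_⟩
  · rw [update₂_fin]
    split_ifs with h1
    · obtain ⟨rfl, rfl⟩ := h1
      have h2 : (m', (s', t')) ∉ l := fun h2 => hl (List.mem_map_of_mem (f := Prod.snd) h2)
      have h3 := Fin.val_inj (a := m) (b := m')
      simp only [List.mem_cons, Prod.mk.injEq, and_true, h2, or_false, List.map_cons, true_or,
        not_true_eq_false, and_false, Nat.add_right_cancel_iff, h3]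
      exact eq_comm
    · rw [h.1]
      have h2 : ¬ ((s', t') = (s, t)) := by simpa using h1
      simp only [List.mem_cons, Prod.mk.injEq, List.map_cons, h1, and_false, false_or]
  · rw [update₂_fin]
    split_ifs
    · exact m.2
    · exact h.2 s' t'

/-- By `flip_eq`, overwriting the entries along the odd edges already removes the even edges: each
pair has a single entry. -/
theorem RepOverride.repAssign {f : ℕ → ℕ → ℕ} {π : List (Edge n)} (h : RepOverride f A π)
    (hA : I.IsPartial M A) (hπ : I.IsAugPath M A π) : RepAssign f (flip A π) := by
  refine ⟨fun m s t => ?_, h.2⟩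
  rw [h.1, Instance.flip_eq hA hπ, Finset.mem_union, Finset.mem_filter, List.mem_toFinset, or_comm]

/-- The state of the exchange after `k` hops along the path `π`. -/
def HopState (A : Finset (Edge n)) (π : List (Edge n)) (k : ℕ) (τ : State Reg Arr) : Prop :=
  (τ.reg .act ≠ 0 ∧ RepLoad (τ.arr .loadT) A ∧ ∃ (s t : Fin n) (π₁ π₂ : List (Edge n)),
    π = π₁ ++ π₂ ∧ π₂.length = k ∧ τ.reg .cs = s ∧ τ.reg .ct = t ∧
    Trace (τ.arr .lev) (τ.arr .pre) (τ.arr .ps) (τ.arr .pt) s t π₁ ∧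
    RepOverride (τ.arr .asgT) A π₂) ∨
  (τ.reg .act = 0 ∧ RepOverride (τ.arr .asgT) A π ∧
    ∀ m : Fin n, τ.arr .loadT m 0 = load A m + if π.head?.map Prod.fst = some m then 1 else 0)

/-- The path is processed backwards from its free end, with `π₁` still to be traced and `π₂` already
reassigned. A hop does not touch the pointer arrays, so the rest of the trace stays valid;
distinctness of the pairs prevents a second write to the same entry. The load changes only at the
hop that reaches level 1. -/
theorem hop_spec {π : List (Edge n)} {k : ℕ} (hπ : (π.map Prod.snd).Nodup)
    (h : HopState A π k σ) : HopState A π (k + 1) (hop.ev σ) := by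
  rcases h with ⟨hact, hload, s, t, π₁, π₂, hsplit, hlen, hcs, hct, htr, hover⟩ | h
  swap
  · have : hop.ev σ = σ := by rw [hop, ev_when, if_neg (by simp [h.1])]
    rw [this]
    exact Or.inr h
  have hev := ev_when σ (rd .act) [
    .set .cur (.sub (get2 .pre .cs .ct) (num 1)),
    put2 .asgT .cs .ct (.add (rd .cur) (num 1)),
    .ite (.eq (get1 .lev .cur) (num 1))
      (.block [
        put1 .loadT .cur (.add (get1 .loadT .cur) (num 1)),
        .set .act (num 0)])
      (.block [
        .set .cs (get1 .ps .cur),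
        .set .ct (get1 .pt .cur)])]
  rw [if_pos (by simpa using hact)] at hev
  change hop.ev σ = _ at hev
  simp only [ev_block_cons, ev_block_nil, ev_set, ev_put, eval_sub, eval_get, eval_reg, eval_lit,
    eval_add, hcs, hct] at hev
  cases htr with
  | @start m _ _ hpre hlev =>
    have hcur : σ.arr .pre s t - 1 = m := by omega
    rw [hcur, ev_ite, if_pos (by simp [hlev])] at hev
    have hnd : (s, t) ∉ π₂.map Prod.snd := by
      rw [hsplit, List.map_append, List.nodup_append'] at hπ
      simpa using hπ.2.2
    right
    have h1 : (hop.ev σ).reg .act = 0 := by rw [hev]; simp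
    have h2 : (hop.ev σ).arr .asgT = update₂ (σ.arr .asgT) s t (m + 1) := by
      rw [hev]; simp [hcs, hct]
    have h3 : (hop.ev σ).arr .loadT =
        update₂ (σ.arr .loadT) m 0 (σ.arr .loadT m 0 + 1) := by
      rw [hev]; simp
    refine ⟨h1, ?_, fun m' => ?_⟩
    · rw [h2, hsplit]
      exact hover.cons hnd
    · rw [h3, update₂_fin_zero, hsplit, hload m, hload m']
      by_cases hmm : m' = m
      · simp [hmm]
      · have : ¬ m = m' := fun h => hmm h.symm
        simp [hmm, this]
  | @step m _ _ s' t' π₁ hpre hlev hps hpt htr =>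
    have hcur : σ.arr .pre s t - 1 = m := by omega
    rw [hcur, ev_ite, if_neg (by simp [hlev])] at hev
    have hnd : (s, t) ∉ π₂.map Prod.snd := by
      rw [hsplit, List.map_append, List.nodup_append', List.map_append] at hπ
      exact fun h => hπ.2.2 (by simp) h
    left
    have h1 : (hop.ev σ).reg .act = σ.reg .act := by rw [hev]; simp
    have h2 : (hop.ev σ).arr = fun a => if a = .asgT then update₂ (σ.arr .asgT) s t (m + 1)
        else σ.arr a := by
      funext a
      rw [hev]; simp [hcs, hct]
    have h3 : (hop.ev σ).reg .cs = s' ∧ (hop.ev σ).reg .ct = t' := by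
      rw [hev]; simp [hps, hpt]
    refine ⟨by rwa [h1], by simpa [h2] using hload, s', t', π₁, (m, (s, t)) :: π₂, ?_, by simp [hlen],
      h3.1, h3.2, by simpa [h2] using htr, ?_⟩
    · rw [hsplit]
      simp
    · have := hover.cons (m := m) hnd
      simpa [h2] using this

theorem Trace.ne_nil {lev pre ps pt : ℕ → ℕ → ℕ} {s t : Fin n} {π : List (Edge n)}
    (h : Trace lev pre ps pt s t π) : π ≠ [] := by
  cases h <;> simp

theorem exchange_eq : exchange = .when (rd .found) [
    .set .doneT (.add (rd .doneT) (num 1)),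
    .set .cs (rd .fs),
    .set .ct (rd .ft),
    .set .act (num 1),
    forNodes .r [hop]] := rfl

theorem exchange_spec (hσ : SearchInput I M A σ) {s t : Fin n} {π : List (Edge n)}
    (hfound : σ.reg .found ≠ 0) (hfs : σ.reg .fs = s) (hft : σ.reg .ft = t) (hlen : π.length ≤ n)
    (htr : Trace (σ.arr .lev) (σ.arr .pre) (σ.arr .ps) (σ.arr .pt) s t π)
    (hπ : I.IsAugPath M A π) :
    SearchInput I M (flip A π) (exchange.ev σ) ∧
      (exchange.ev σ).reg .doneT = σ.reg .doneT + 1 := by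
  have hf := frame_ev σ exchange
  have hA := hσ.isPartial
  have hev : exchange.ev σ = (forNodes .r [hop]).ev
      ((((σ.setReg .doneT (σ.reg .doneT + 1)).setReg .cs s).setReg .ct t).setReg .act 1) := by
    rw [exchange_eq, ev_when, if_pos (by simpa using hfound)]
    simp [hfs, hft]
  set σ' := (((σ.setReg .doneT (σ.reg .doneT + 1)).setReg .cs s).setReg .ct t).setReg .act 1
    with hσ'
  have key := forNodes_induction (n := n) (σ := σ') (x := .r) (l := [hop])
    (by simpa [hσ'] using hσ.ready.n_eq) (HopState A π)
    (Or.inl ⟨by simp [hσ'], hσ.load, s, t, π, [], by simp, rfl, by simp [hσ'], by simp [hσ'], htr,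
      hσ.asg.override_nil⟩)
    (fun k τ _ hτ => hop_spec (σ := τ.setReg .r k) hπ.nodup_right (by simpa [HopState] using hτ))
  rw [← hev] at key
  have hdone : (exchange.ev σ).reg .doneT = σ.reg .doneT + 1 := by
    rw [hev, ev_reg _ rfl]
    simp [hσ']
  refine ⟨⟨hσ.ready.of_frame hf rfl rfl, ?_, ?_, ?_, hA.flip hπ⟩, hdone⟩
  · rw [hf.2 .inM rfl]
    exact hσ.inM
  all_goals
    -- After `n` hops nothing can be left to trace: a nonempty `π₁` besides `n` processed edges
    -- would exceed the length bound.
    rcases key with ⟨-, -, s', t', π₁, π₂, hs, hl, -, -, htr', -⟩ | ⟨-, h1, h2⟩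
    · have := List.length_pos_of_ne_nil htr'.ne_nil
      rw [hs, List.length_append] at hlen
      omega
  · exact h1.repAssign hA hπ
  · intro m
    rw [h2, Instance.load_flip hπ]

/-- Copy an assignment together with its loads. -/
def copyAssign (l' f' l f : Arr) : S := forNodes .s [put1 l' .s (get1 l .s),
    forNodes .t [put2 f' .s .t (get2 f .s .t)]]

theorem augment_eq : augment = .block [copyAssign .loadT .asgT .load .asg, .set .doneT (rd .done),
  .loop .q (rd .total) (.block [search, exchange])] := rfl

/-- The arrays are parameters because the copy is needed in both directions: to start a trial and to
accept its result. -/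
theorem copyAssign_spec {l' f' l f : Arr} (hn : σ.reg .n = n) (h1 : l ≠ l') (h2 : l ≠ f')
    (h3 : f ≠ l') (h4 : f ≠ f') (h5 : l' ≠ f') :
    (∀ s : Fin n, ((copyAssign l' f' l f).ev σ).arr l' s 0 = σ.arr l s 0) ∧
      ∀ s t : Fin n, ((copyAssign l' f' l f).ev σ).arr f' s t = σ.arr f s t := by
  have hkeep : ∀ {a : Arr}, a ≠ l' → a ≠ f' → (copyAssign l' f' l f).keepsArr a = true := by
    intro a ha ha'
    simp [copyAssign, keepsArr, block, ha, ha']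
  have key := forNodes_induction (n := n) (σ := σ) (x := .s) (l := [put1 l' .s (get1 l .s),
      forNodes .t [put2 f' .s .t (get2 f .s .t)]]) hn
    (fun k τ => ∀ s : Fin n, (s : ℕ) < k → τ.arr l' s 0 = σ.arr l s 0 ∧
      ∀ t : Fin n, τ.arr f' s t = σ.arr f s t)
    (fun s hs => absurd hs (Nat.not_lt_zero _)) ?_
  · exact ⟨fun s => (key s s.2).1, fun s => (key s s.2).2⟩
  intro k τ hf hτ
  rw [ev_block_cons, ev_block_cons, ev_block_nil]
  have hload := hf.2 l (hkeep h1 h2)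
  have hasg := hf.2 f (hkeep h3 h4)
  set τ₁ := (put1 l' .s (get1 l .s)).ev (τ.setReg .s k) with hτ₁
  have hn₁ : τ₁.reg .n = n := by simpa [hτ₁] using (hf.1 .n rfl).trans hn
  have hl : ∀ s : Fin n, (s : ℕ) < k + 1 → τ₁.arr l' s 0 = σ.arr l s 0 := by
    intro s hs
    simp only [hτ₁, ev_put, State.setArr_arr, if_true, eval_reg, eval_lit, eval_get,
      State.setReg_reg, State.setReg_arr, update₂_fin_zero, hload]
    split_ifs with hsk
    · rw [hsk]
    · have := Fin.val_ne_of_ne hsk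
      exact (hτ s (by omega)).1
  have key := forNodes_induction (n := n) (σ := τ₁) (x := .t)
    (l := [put2 f' .s .t (get2 f .s .t)]) hn₁
    (fun j τ' => ∀ s t : Fin n, (s : ℕ) < k ∨ s = k ∧ (t : ℕ) < j →
      τ'.arr f' s t = σ.arr f s t) ?_ ?_
  · intro s hs
    refine ⟨?_, fun t => key s t ?_⟩
    · rw [ev_arr _ (by simp [keepsArr, block, h5])]
      exact hl s hs
    · rcases Nat.lt_succ_iff_lt_or_eq.1 hs with h | h
      · exact Or.inl h
      · exact Or.inr ⟨Fin.ext h, t.2⟩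
  · intro s t hst
    simpa [hτ₁, h5.symm] using (hτ s (by simpa using hst)).2 t
  · intro j τ' hf' hτ' s t hst
    have hs : τ'.reg .s = k := by
      rw [hf'.1 .s rfl]
      simp [hτ₁]
    have hasg' : τ'.arr f = σ.arr f := by
      rw [hf'.2 f (by simp [keepsArr, block, h4])]
      simpa [hτ₁, h3] using hasg
    simp only [ev_block_cons, ev_block_nil, ev_put, State.setArr_arr, if_true, eval_reg, eval_get,
      State.setReg_reg, State.setReg_arr, reduceCtorEq, if_false, hs, update₂_fin, hasg']
    split_ifs with hsk
    · rw [hsk.1, hsk.2]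
    · refine hτ' s t ?_
      rcases hst with h | ⟨h, h'⟩
      · exact Or.inl h
      · refine Or.inr ⟨h, ?_⟩
        have : (t : ℕ) ≠ j := fun h2 => hsk ⟨h, Fin.ext h2⟩
        omega

/-- The procedure `augment` computes a maximum assignment by augmenting paths. -/
theorem augment_spec (hσ : Ready I σ) (hM : RepSet (σ.arr .inM) M) (hasg : RepAssign (σ.arr .asg) A)
    (hload : RepLoad (σ.arr .load) A) (hdone : σ.reg .done = A.card) (hA : I.IsPartial M A) :
    ∃ A', I.AugmentTo M A A' ∧ RepAssign ((augment.ev σ).arr .asgT) A' ∧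
      RepLoad ((augment.ev σ).arr .loadT) A' ∧ (augment.ev σ).reg .doneT = A'.card := by
  rw [augment_eq, ev_block_cons, ev_block_cons, ev_block_cons, ev_block_nil]
  have hf := frame_ev σ (copyAssign .loadT .asgT .load .asg)
  obtain ⟨h1, h2⟩ := copyAssign_spec (l' := .loadT) (f' := .asgT) (l := .load) (f := .asg) (σ := σ)
    hσ.n_eq (by simp) (by simp) (by simp) (by simp) (by simp)
  set σ₁ := (copyAssign .loadT .asgT .load .asg).ev σ
  have hin : SearchInput I M A σ₁ := by
    refine ⟨hσ.of_frame hf rfl rfl, ?_, ⟨?_, ?_⟩, ?_, hA⟩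
    · rw [hf.2 .inM rfl]
      exact hM
    · intro m s t
      rw [h2]
      exact hasg.1 m s t
    · intro s t
      rw [h2]
      exact hasg.2 s t
    · intro m
      rw [h1]
      exact hload m
  set σ₂ := (Stmt.set .doneT (rd .done) : S).ev σ₁ with hσ₂
  have hin₂ : SearchInput I M A σ₂ := hin.of_frame (frame_ev σ₁ _) rfl rfl rfl
  have hdone₂ : σ₂.reg .doneT = A.card := by
    simp [hσ₂, hf.1 .done rfl, hdone]
  -- After `q` rounds the assignment is maximum or has at least `q` edges. Since no assignment has
  -- more than `|P|` edges, `total` rounds suffice.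
  have key := ev_loop_induction (σ := σ₂) (x := .q) (e := rd .total)
    (s := .block [search, exchange])
    (fun q τ => ∃ A', Relation.ReflTransGen (I.AugStep M) A A' ∧ SearchInput I M A' τ ∧
      τ.reg .doneT = A'.card ∧ (A'.card = I.φ M ∨ q ≤ A'.card))
    ⟨A, .refl, hin₂, hdone₂, Or.inr (Nat.zero_le _)⟩ ?_
  · obtain ⟨A', g1, g2, g3, g4⟩ := key
    refine ⟨A', ⟨g1, g2.isPartial.not_isAugPath ?_⟩, g2.asg, g2.load, g3⟩
    rcases g4 with g4 | g4
    · exact g4.ge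
    · rw [eval_reg, hin₂.ready.total_eq] at g4
      exact (I.φ_le M).trans g4
  rintro q τ - - ⟨A', g1, g2, g3, g4⟩
  rw [ev_block_cons, ev_block_cons, ev_block_nil]
  obtain ⟨i1, i2, i3⟩ := search_spec (g2.setReg (x := .q) rfl q) rfl
  have hdoneT : (search.ev (τ.setReg .q q)).reg .doneT = A'.card := by
    rw [ev_reg _ rfl]
    simpa using g3
  set τ₁ := search.ev (τ.setReg .q q)
  by_cases hfound : τ₁.reg .found = 0
  · have : exchange.ev τ₁ = τ₁ := by rw [exchange, ev_when, if_neg (by simp [hfound])]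
    rw [this]
    exact ⟨A', g1, i1, hdoneT, Or.inl (i2 hfound)⟩
  · obtain ⟨s, t, π, j1, j2, j3, j4, j5⟩ := i3 hfound
    obtain ⟨k1, k2⟩ := exchange_spec i1 hfound j1 j2 j3 j4 j5
    have hcard := Instance.card_flip i1.isPartial j5
    refine ⟨_, g1.tail ⟨π, j5, rfl⟩, k1, by rw [k2, hdoneT, hcard], ?_⟩
    -- If the assignment was already maximum, the flip would exceed `φ M`; otherwise it adds the
    -- edge required for `q + 1`.
    rcases g4 with g4 | g4
    · have := k1.isPartial.card_le_φ
      omega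
    · right
      omega

end Prog

/-! ## The greedy program -/

namespace Prog

open Stmt

variable {n : ℕ} {I : Instance n} {M : Finset (Fin n)} {x : Config n} {σ : State Reg Arr}

/-- The state represents the configuration `x`. -/
structure RepConfig (I : Instance n) (x : Config n) (σ : State Reg Arr) : Prop where
  ready : Ready I σ
  cnt : σ.reg .cnt = x.order.length
  ord : ∀ (i : ℕ) (hi : i < x.order.length), σ.arr .ord i 0 = ((x.order[i] : Fin n) : ℕ)
  inM : RepSet (σ.arr .inM) x.placed
  asg : RepAssign (σ.arr .asg) x.assign
  load : RepLoad (σ.arr .load) x.assign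
  done : σ.reg .done = x.assign.card

theorem RepConfig.setReg (h : RepConfig I x σ) {y : Reg}
    (hy : ([.n, .kappa, .total].all fun z => z != y) = true)
    (hy' : ([.cnt, .done].all fun z => z != y) = true) (v : ℕ) : RepConfig I x (σ.setReg y v) := by
  simp only [List.all_cons, List.all_nil, Bool.and_eq_true, and_true, bne_iff_ne, ne_eq] at hy'
  exact ⟨h.ready.setReg hy v, by simpa [hy'] using h.cnt, h.ord, h.inM, h.asg, h.load,
    by simpa [hy'] using h.done⟩

theorem RepSet.insert {f : ℕ → ℕ → ℕ} (h : RepSet f M) (m : Fin n) :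
    RepSet (update₂ f m 0 1) (insert m M) := by
  intro a
  rw [update₂_fin_zero, Finset.mem_insert, ← h a]
  split_ifs with ha <;> simp [ha]

theorem RepSet.erase {f : ℕ → ℕ → ℕ} {m : Fin n} (h : RepSet f (Insert.insert m M)) (hm : m ∉ M) :
    RepSet (update₂ f m 0 0) M := by
  intro a
  rw [update₂_fin_zero]
  split_ifs with ha
  · simp [ha, hm]
  · rw [h a, Finset.mem_insert, or_iff_right ha]

def tryNode : S :=
  .when (all [get1 .loc .m, .eq (get1 .inM .m) (num 0)]) [
    put1 .inM .m (num 1),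
    augment,
    put1 .inM .m (num 0),
    .set .tmp (.sub (rd .doneT) (rd .done)),
    .when (.le (.add (rd .opt) (num 1)) (rd .tmp)) [
      .set .opt (rd .tmp),
      .set .best (rd .m)]]

def deployBest : S :=
  .when (rd .opt) [
    put1 .inM .best (num 1),
    put1 .ord .cnt (rd .best),
    .set .cnt (.add (rd .cnt) (num 1)),
    augment,
    copyAssign .load .asg .loadT .asgT,
    .set .done (rd .doneT)]

theorem greedyStep_eq :
    greedyStep = .block [.set .opt (num 0), forNodes .m [tryNode], deployBest] := rfl

/-- The best middlebox among the first `k` nodes has been determined. -/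
def TryState (I : Instance n) (x : Config n) (k : ℕ) (τ : State Reg Arr) : Prop :=
  RepConfig I x τ ∧
    (∀ m : Fin n, (m : ℕ) < k → m ∈ I.U \ x.placed → I.gain x.placed m ≤ τ.reg .opt) ∧
    (τ.reg .opt ≠ 0 → ∃ b : Fin n, τ.reg .best = b ∧ b ∈ I.U \ x.placed ∧
      I.gain x.placed b = τ.reg .opt)

/-- A trial works on `asgT`, `loadT` and `doneT` and resets `inM`, so the represented configuration
is unchanged. Since both assignments are maximum, `doneT - done` is exactly the gain. -/
theorem tryNode_spec (hx : I.IsGreedy x) {m : Fin n} (hm : σ.reg .m = m) (h : TryState I x m σ) :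
    TryState I x (m + 1) (tryNode.ev σ) := by
  obtain ⟨hc, hle, hbest⟩ := h
  have hcond : (all [get1 .loc .m, .eq (get1 .inM .m) (num 0)]).eval σ ≠ 0 ↔
      m ∈ I.U \ x.placed := by
    rw [Finset.mem_sdiff, ← hc.ready.loc_iff, ← hc.inM m]
    simp [hm]
  by_cases hmem : m ∈ I.U \ x.placed
  swap
  · have : tryNode.ev σ = σ := by rw [tryNode, ev_when, if_neg fun h => hmem (hcond.1 h)]
    rw [this]
    refine ⟨hc, fun a ha hau => ?_, hbest⟩
    rcases Nat.lt_succ_iff_lt_or_eq.1 ha with h | h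
    · exact hle a h hau
    · rw [Fin.ext h] at hau
      exact absurd hau hmem
  have hev := ev_when σ (all [get1 .loc .m, .eq (get1 .inM .m) (num 0)]) [
    put1 .inM .m (num 1),
    augment,
    put1 .inM .m (num 0),
    .set .tmp (.sub (rd .doneT) (rd .done)),
    .when (.le (.add (rd .opt) (num 1)) (rd .tmp)) [
      .set .opt (rd .tmp),
      .set .best (rd .m)]]
  rw [if_pos (hcond.2 hmem), ← tryNode, ev_block_cons, ev_block_cons, ev_block_cons, ev_block_cons,
    ev_block_cons, ev_block_nil, ev_when] at hev
  set σ₁ := (put1 .inM .m (num 1)).ev σ with hσ₁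
  set σ₂ := augment.ev σ₁ with hσ₂
  set σ₃ := (put1 .inM .m (num 0)).ev σ₂ with hσ₃
  set σ₄ := (Stmt.set .tmp (.sub (rd .doneT) (rd .done)) : S).ev σ₃ with hσ₄
  have hinM₁ : σ₁.arr .inM = update₂ (σ.arr .inM) m 0 1 := by simp [hσ₁, hm]
  have hset₁ : RepSet (σ₁.arr .inM) (insert m x.placed) := hinM₁ ▸ hc.inM.insert m
  have hready₁ : Ready I σ₁ := hc.ready.of_frame (frame_ev σ _) rfl rfl
  obtain ⟨A', hA', -, -, hdoneT⟩ := augment_spec (A := x.assign) hready₁ hset₁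
    (by simpa [hσ₁] using hc.asg) (by simpa [hσ₁] using hc.load) (by simpa [hσ₁] using hc.done)
    (hx.isPartial.mono (Finset.subset_insert _ _))
  rw [((hx.isPartial.mono (Finset.subset_insert m _)).augmentTo hA').2.1, ← hσ₂] at hdoneT
  have hf₂ : augment.Frame σ₁ σ₂ := frame_ev _ _
  have hready₂ : Ready I σ₂ := hready₁.of_frame hf₂ rfl rfl
  have hready₄ : Ready I σ₄ := (hready₂.of_frame (frame_ev σ₂ _) rfl rfl).of_frame
    (frame_ev σ₃ _) rfl rfl
  have hm₂ : σ₂.reg .m = m := by rw [hf₂.1 .m rfl]; simpa [hσ₁] using hm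
  have hdone₂ : σ₂.reg .done = x.assign.card := by rw [hf₂.1 .done rfl]; simpa [hσ₁] using hc.done
  have hc₄ : RepConfig I x σ₄ := by
    refine ⟨hready₄, ?_, fun i hi => ?_, ?_, ?_, ?_, ?_⟩
    · simp only [hσ₄, hσ₃, ev_set, ev_put, State.setReg_reg, reduceCtorEq, if_false,
        State.setArr_reg]
      rw [hf₂.1 .cnt rfl]
      simpa [hσ₁] using hc.cnt
    · simp only [hσ₄, hσ₃, ev_set, ev_put, State.setReg_arr, State.setArr_arr, reduceCtorEq,
        if_false]
      rw [hf₂.2 .ord rfl]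
      simpa [hσ₁] using hc.ord i hi
    · simp only [hσ₄, hσ₃, ev_set, ev_put, State.setReg_arr, State.setArr_arr, if_true, eval_reg,
        eval_lit, hm₂]
      rw [hf₂.2 .inM rfl]
      exact hset₁.erase (Finset.mem_sdiff.1 hmem).2
    · simp only [hσ₄, hσ₃, ev_set, ev_put, State.setReg_arr, State.setArr_arr, reduceCtorEq,
        if_false]
      rw [hf₂.2 .asg rfl]
      simpa [hσ₁] using hc.asg
    · simp only [hσ₄, hσ₃, ev_set, ev_put, State.setReg_arr, State.setArr_arr, reduceCtorEq,
        if_false]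
      rw [hf₂.2 .load rfl]
      simpa [hσ₁] using hc.load
    · simpa [hσ₄, hσ₃] using hdone₂
  have htmp : σ₄.reg .tmp = I.gain x.placed m := by
    rw [Instance.gain, ← hx.card_eq]
    simp [hσ₄, hσ₃, hdoneT, hdone₂]
  have hopt : σ₄.reg .opt = σ.reg .opt := by
    simp only [hσ₄, hσ₃, ev_set, ev_put, State.setReg_reg, reduceCtorEq, if_false, State.setArr_reg]
    rw [hf₂.1 .opt rfl]
    simp [hσ₁]
  have hbest₄ : σ₄.reg .best = σ.reg .best := by
    simp only [hσ₄, hσ₃, ev_set, ev_put, State.setReg_reg, reduceCtorEq, if_false, State.setArr_reg]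
    rw [hf₂.1 .best rfl]
    simp [hσ₁]
  have hm₄ : σ₄.reg .m = m := by simpa [hσ₄, hσ₃] using hm₂
  rw [hev]
  by_cases hlt : σ.reg .opt + 1 ≤ I.gain x.placed m
  · rw [if_pos (by simpa [hopt, htmp, Nat.succ_le_iff] using hlt)]
    simp only [ev_block_cons, ev_block_nil, ev_set, eval_reg]
    refine ⟨(hc₄.setReg rfl rfl _).setReg rfl rfl _, fun a ha hau => ?_, fun _ => ⟨m, ?_, hmem, ?_⟩⟩
    · simp only [State.setReg_reg, reduceCtorEq, if_false, if_true, htmp]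
      rcases Nat.lt_succ_iff_lt_or_eq.1 ha with h | h
      · have := hle a h hau
        omega
      · rw [Fin.ext h]
    · simp [hm₄]
    · simp [htmp]
  · rw [if_neg (by simpa [hopt, htmp, Nat.succ_le_iff] using hlt)]
    refine ⟨hc₄, fun a ha hau => ?_, by rwa [hopt, hbest₄]⟩
    rw [hopt]
    rcases Nat.lt_succ_iff_lt_or_eq.1 ha with h | h
    · exact hle a h hau
    · rw [Fin.ext h]
      omega

/-- If `opt` is 0 there is no positive gain, so no greedy step exists; otherwise `best` attains the
maximum. The augmentation is repeated because the trial arrays hold the result of the last candidate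
tried, not of the best one. -/
theorem deployBest_spec (hx : I.IsGreedy x) (hcompl : ¬ I.Complete x.assign)
    (h : TryState I x n σ) :
    (RepConfig I x (deployBest.ev σ) ∧ ¬ ∃ y, I.Step x y) ∨
      ∃ y, I.Step x y ∧ RepConfig I y (deployBest.ev σ) := by
  obtain ⟨hc, hle, hbest⟩ := h
  by_cases hopt : σ.reg .opt = 0
  · left
    have : deployBest.ev σ = σ := by rw [deployBest, ev_when, if_neg (by simp [hopt])]
    rw [this]
    refine ⟨hc, ?_⟩
    rintro ⟨y, -, m, hm, hpos, -⟩
    have := hle m m.2 hm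
    omega
  right
  obtain ⟨b, hb, hbU, hgain⟩ := hbest hopt
  have hev := ev_when σ (rd .opt) [
    put1 .inM .best (num 1),
    put1 .ord .cnt (rd .best),
    .set .cnt (.add (rd .cnt) (num 1)),
    augment,
    copyAssign .load .asg .loadT .asgT,
    .set .done (rd .doneT)]
  rw [if_pos (by simpa using hopt), ← deployBest, ev_block_cons, ev_block_cons, ev_block_cons,
    ev_block_cons, ev_block_cons, ev_block_cons, ev_block_nil] at hev
  set σ₁ := (Stmt.set .cnt (.add (rd .cnt) (num 1)) : S).ev
    ((put1 .ord .cnt (rd .best)).ev ((put1 .inM .best (num 1)).ev σ)) with hσ₁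
  have hready₁ : Ready I σ₁ := ((hc.ready.of_frame (frame_ev σ _) rfl rfl).of_frame
    (frame_ev _ _) rfl rfl).of_frame (frame_ev _ _) rfl rfl
  have hset₁ : RepSet (σ₁.arr .inM) (insert b x.placed) := by
    have := hc.inM.insert b
    simpa [hσ₁, hb] using this
  obtain ⟨A', hA', hasgT, hloadT, hdoneT⟩ := augment_spec (A := x.assign) hready₁ hset₁
    (by simpa [hσ₁] using hc.asg) (by simpa [hσ₁] using hc.load) (by simpa [hσ₁] using hc.done)
    (hx.isPartial.mono (Finset.subset_insert _ _))
  set σ₂ := augment.ev σ₁ with hσ₂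
  have hf₂ : augment.Frame σ₁ σ₂ := frame_ev _ _
  have hready₂ : Ready I σ₂ := hready₁.of_frame hf₂ rfl rfl
  obtain ⟨hl₃, ha₃⟩ := copyAssign_spec (l' := .load) (f' := .asg) (l := .loadT) (f := .asgT)
    hready₂.n_eq (by simp) (by simp) (by simp) (by simp) (by simp)
  have hf₃ := frame_ev σ₂ (copyAssign .load .asg .loadT .asgT)
  set σ₃ := (copyAssign .load .asg .loadT .asgT).ev σ₂ with hσ₃
  have hready₃ : Ready I σ₃ := hready₂.of_frame hf₃ rfl rfl
  rw [ev_set] at hev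
  refine ⟨⟨x.order ++ [b], A'⟩, ⟨hcompl, b, hbU, by omega, fun m hm => ?_, rfl, hA'⟩, ?_⟩
  · rw [hgain]
    exact hle m m.2 hm
  rw [hev]
  refine ⟨hready₃.setReg rfl _, ?_, fun i hi => ?_, ?_, ⟨?_, ?_⟩, ?_, ?_⟩
  · simp only [State.setReg_reg, reduceCtorEq, if_false]
    rw [hf₃.1 .cnt rfl, hf₂.1 .cnt rfl]
    simp [hσ₁, hc.cnt]
  · rw [State.setReg_arr, hf₃.2 .ord rfl, hf₂.2 .ord rfl]
    have hord : σ₁.arr .ord = update₂ (σ.arr .ord) x.order.length 0 b := by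
      simp [hσ₁, hb, hc.cnt]
    rw [hord, update₂_apply]
    simp only [List.length_append, List.length_singleton] at hi
    by_cases hi' : i = x.order.length
    · subst hi'
      simp
    · have hi'' : i < x.order.length := by omega
      rw [if_neg fun h => hi' h.1, hc.ord i hi'']
      simp [List.getElem_append_left hi'']
  · rw [State.setReg_arr, hf₃.2 .inM rfl, hf₂.2 .inM rfl,
      Instance.placed_concat (x := x) (m := b) rfl]
    exact hset₁
  · intro m s t
    rw [State.setReg_arr, ha₃]
    exact hasgT.1 m s t
  · intro s t
    rw [State.setReg_arr, ha₃]
    exact hasgT.2 s t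
  · intro m
    rw [State.setReg_arr, hl₃]
    exact hloadT m
  · simp only [State.setReg_reg, if_true, eval_reg]
    rw [hf₃.1 .doneT rfl, hdoneT]

theorem greedyStep_spec (hx : I.IsGreedy x) (hcompl : ¬ I.Complete x.assign)
    (h : RepConfig I x σ) :
    (RepConfig I x (greedyStep.ev σ) ∧ ¬ ∃ y, I.Step x y) ∨
      ∃ y, I.Step x y ∧ RepConfig I y (greedyStep.ev σ) := by
  rw [greedyStep_eq, ev_block_cons, ev_block_cons, ev_block_cons, ev_block_nil, ev_set]
  refine deployBest_spec hx hcompl ?_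
  refine forNodes_induction (n := n) (σ := σ.setReg .opt ((num 0).eval σ)) (x := .m)
    (l := [tryNode]) (by simpa using h.ready.n_eq) (TryState I x) ?_ ?_
  · exact ⟨h.setReg rfl rfl _, fun m hm => absurd hm (Nat.not_lt_zero _), fun h0 => by simp at h0⟩
  · rintro k τ - ⟨h1, h2, h3⟩
    rw [ev_block_cons, ev_block_nil]
    exact tryNode_spec hx (by simp) ⟨h1.setReg rfl rfl _, by simpa using h2, by simpa using h3⟩

/-! ### The main loop -/

def greedyLoop : S := forNodes .it [
  .when (.le (.add (rd .done) (num 1)) (rd .total)) [greedyStep]]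

/-- After `k` rounds the run is complete, or stuck, or has deployed at least `k` middleboxes. If a
solution exists, an incomplete run is never stuck, which leaves only the last alternative to be
excluded for `k = n`. -/
theorem greedyLoop_spec (h : RepConfig I ⟨[], ∅⟩ σ) :
    ∃ x, I.Reach x ∧ RepConfig I x (greedyLoop.ev σ) ∧
      ((∃ M, I.IsDeployment M) → I.Complete x.assign) := by
  have key := forNodes_induction (n := n) (σ := σ) (x := .it) (l := [
      .when (.le (.add (rd .done) (num 1)) (rd .total)) [greedyStep]]) h.ready.n_eq
    (fun k τ => ∃ x, I.Reach x ∧ RepConfig I x τ ∧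
      (I.Complete x.assign ∨ (¬ ∃ y, I.Step x y) ∨ k ≤ x.order.length))
    ⟨_, .refl, h, Or.inr (Or.inr (Nat.zero_le _))⟩ ?_
  · obtain ⟨x, h1, h2, h3⟩ := key
    refine ⟨x, h1, h2, fun ⟨M, hM⟩ => ?_⟩
    by_contra hcompl
    obtain ⟨y, hy⟩ := (Instance.Reach.isGreedy h1).exists_step hM hcompl
    rcases h3 with h3 | h3 | h3
    · exact hcompl h3
    · exact h3 ⟨y, hy⟩
    · obtain ⟨-, m, hm, -⟩ := hy
      -- With `n` distinct middleboxes deployed no location remains for the supposed step.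
      have huniv : x.placed = Finset.univ := by
        rw [← Finset.card_eq_iff_eq_univ, Config.placed,
          List.toFinset_card_of_nodup (Instance.Reach.isGreedy h1).nodup]
        refine le_antisymm ?_ (by simpa using h3)
        exact (Instance.Reach.isGreedy h1).nodup.length_le_card
      rw [huniv] at hm
      simp at hm
  rintro k τ - ⟨x, h1, h2, h3⟩
  have hg := Instance.Reach.isGreedy h1
  have h2' := h2.setReg (y := .it) rfl rfl k
  rw [ev_block_cons, ev_block_nil, ev_when]
  have hcond : (.le (.add (rd .done) (num 1)) (rd .total) : E).eval (τ.setReg .it k) ≠ 0 ↔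
      ¬ I.Complete x.assign := by
    rw [hg.isPartial.complete_iff]
    simp [h2.done, h2.ready.total_eq]
  by_cases hcompl : I.Complete x.assign
  · rw [if_neg fun h => hcond.1 h hcompl]
    exact ⟨x, h1, h2', Or.inl hcompl⟩
  rw [if_pos (hcond.2 hcompl), ev_block_cons, ev_block_nil]
  rcases greedyStep_spec hg hcompl h2' with ⟨h4, h5⟩ | ⟨y, hy, h4⟩
  · exact ⟨x, h1, h4, Or.inr (Or.inl h5)⟩
  · refine ⟨y, h1.tail hy, h4, ?_⟩
    rcases h3 with h3 | h3 | h3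
    · exact absurd h3 hcompl
    · exact absurd ⟨y, hy⟩ h3
    · right; right
      obtain ⟨-, m, -, -, -, ho, -⟩ := hy
      rw [ho, List.length_append, List.length_singleton]
      omega

theorem greedy_ev (σ : State Reg Arr) :
    greedy.ev σ = greedyLoop.ev ((block [shortestPaths, countPairs]).ev σ) := by
  simp only [greedy, greedyLoop, ev_block_cons, ev_block_nil]

theorem greedy_spec {ℓ : Sym2 (Fin n) → ℕ} (hℓ : ∀ e, I.len e = ℓ e) {a b : ℕ} (hb : 0 < b)
    (hρ : I.ρ = a / b) :
    ∃ x, I.Reach x ∧ Outputs (greedy.run (I.input ℓ a b)).1 x ∧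
      ((∃ M, I.IsDeployment M) → I.Complete x.assign) := by
  have hready := ready_preprocess hℓ hb hρ
  have hf := frame_ev (I.input ℓ a b) (block [shortestPaths, countPairs])
  obtain ⟨x, h1, h2, h3⟩ := greedyLoop_spec (I := I)
    (σ := (block [shortestPaths, countPairs]).ev (I.input ℓ a b)) (by
      refine ⟨hready, ?_, fun i hi => absurd hi (Nat.not_lt_zero _), fun m => ?_,
        ⟨fun m s t => ?_, fun s t => ?_⟩, fun m => ?_, ?_⟩
      · rw [hf.1 .cnt rfl]; rfl
      · rw [hf.2 .inM rfl]
        simp [Instance.input, Config.placed]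
      · rw [hf.2 .asg rfl]
        simp [Instance.input]
      · rw [hf.2 .asg rfl]
        simp [Instance.input]
      · rw [hf.2 .load rfl]
        simp [Instance.input, Middlebox.load]
      · rw [hf.1 .done rfl]; rfl)
  refine ⟨x, h1, ?_, h3⟩
  change Outputs (greedy.ev (I.input ℓ a b)) x
  rw [greedy_ev]
  exact ⟨h2.cnt, h2.ord, h2.asg.1⟩

end Prog

/-! ## The running time -/

namespace Prog

open Stmt

variable {n : ℕ} {I : Instance n} {ℓ : Sym2 (Fin n) → ℕ} {σ : State Reg Arr}

def isBound : E → Bool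
  | .reg .n => true
  | .reg .total => true
  | _ => false

/-- The program has no multiplications, its loops are bounded by `n` or `total`, and it writes to
neither of these registers. -/
def plain : S → Bool
  | .skip => true
  | .set x e => x != .n && x != .total && e.mulFree
  | .put _ i j e => i.mulFree && j.mulFree && e.mulFree
  | .seq s t => plain s && plain t
  | .ite e s t => e.mulFree && plain s && plain t
  | .loop x e s => x != .n && x != .total && isBound e && plain s

theorem isBound_iff {e : E} : isBound e = true ↔ e = .reg .n ∨ e = .reg .total := by
  unfold isBound
  split <;> simp_all

/-- Without multiplications only the loop bounds matter, and they are registers the program never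
changes. For concrete programs `plain` is checked by `rfl`. -/
theorem safe_of_plain {s : S} (h : plain s = true) (N : ℕ) :
    s.Safe (fun σ => σ.reg .n ≤ N ∧ σ.reg .total ≤ N) N := by
  induction s with
  | skip => trivial
  | set x e =>
    simp only [plain, Bool.and_eq_true, bne_iff_ne, ne_eq] at h
    refine fun σ hσ => ⟨.of_mulFree h.2 _ _, ?_⟩
    dsimp only
    rw [State.setReg_reg, State.setReg_reg, if_neg (Ne.symm h.1.1), if_neg (Ne.symm h.1.2)]
    exact hσ
  | put a i j e =>
    simp only [plain, Bool.and_eq_true] at h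
    exact fun σ hσ => ⟨.of_mulFree h.1.1 _ _, .of_mulFree h.1.2 _ _, .of_mulFree h.2 _ _, hσ⟩
  | seq s t ihs iht =>
    simp only [plain, Bool.and_eq_true] at h
    exact ⟨ihs h.1, iht h.2⟩
  | ite e s t ihs iht =>
    simp only [plain, Bool.and_eq_true] at h
    exact ⟨fun σ _ => .of_mulFree h.1.1 _ _, ihs h.1.2, iht h.2⟩
  | loop x e s ih =>
    simp only [plain, Bool.and_eq_true, bne_iff_ne, ne_eq, isBound_iff] at h
    refine ⟨fun σ hσ => ⟨?_, ?_, fun k => ?_⟩, ih h.2⟩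
    · rcases h.1.2 with rfl | rfl <;> trivial
    · rcases h.1.2 with rfl | rfl
      · exact hσ.1
      · exact hσ.2
    · dsimp only
      rw [State.setReg_reg, State.setReg_reg, if_neg (Ne.symm h.1.1.1), if_neg (Ne.symm h.1.1.2)]
      exact hσ

theorem plain_cost_le {s : S} (h : plain s = true) {N : ℕ} (hN : 1 ≤ N) (hn : σ.reg .n ≤ N)
    (ht : σ.reg .total ≤ N) : (s.run σ).2 ≤ s.weight * N ^ s.depth :=
  ((safe_of_plain h N).cost_le hN ⟨hn, ht⟩).2

/-- This phase writes `total` and so is not `plain`; but its loops are bounded by `n` alone. -/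
theorem countPairs_cost_le {N : ℕ} (hN : 1 ≤ N) (hn : σ.reg .n ≤ N) :
    (countPairs.run σ).2 ≤ countPairs.weight * N ^ countPairs.depth := by
  have h : countPairs.Safe (fun σ => σ.reg .n ≤ N) N := by
    simp [countPairs, Safe, block, Stmt.when, Expr.SmallFactors, State.setReg]
  exact (h.cost_le hN hn).2

/-- Unlike `Safe.cost_le`, this bound lets the cost of the body depend on what the frame condition
says about the memory, as needed for the factors in `scale`. -/
theorem loop_cost_le {x : Reg} {e : E} {s : S} {c : ℕ}
    (h : ∀ k < e.eval σ, ∀ τ, (Stmt.loop x e s).Frame σ τ → (s.run (τ.setReg x k)).2 ≤ c) :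
    ((Stmt.loop x e s).run σ).2 ≤ e.cost σ + e.eval σ * (c + 1) + 1 := by
  have key : ∀ k ≤ e.eval σ,
      (Stmt.loop x e s).Frame σ (iter (fun k τ => s.run (τ.setReg x k)) σ k).1 ∧
        (iter (fun k τ => s.run (τ.setReg x k)) σ k).2 ≤ k * c := by
    intro k
    induction k with
    | zero => exact fun _ => ⟨⟨fun _ _ => rfl, fun _ _ => rfl⟩, by simp [iter]⟩
    | succ k ih =>
      intro hk
      obtain ⟨hf, hc⟩ := ih (by omega)
      refine ⟨⟨fun y hy => ?_, fun a ha => ?_⟩, ?_⟩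
      · have hy' := hy
        simp only [keepsReg, Bool.and_eq_true, bne_iff_ne, ne_eq] at hy'
        rw [iter_fst_succ, ev_reg _ hy'.2, State.setReg_reg, if_neg hy'.1, hf.1 y hy]
      · have ha' := ha
        simp only [keepsArr] at ha'
        rw [iter_fst_succ, ev_arr _ ha', State.setReg_arr, hf.2 a ha]
      · rw [add_mul, one_mul]
        exact add_le_add hc (h k (by omega) _ hf)
  have := (key _ le_rfl).2
  simp only [run]
  rw [mul_add, mul_one]
  omega

/-- One inner pass costs at most `21 + 4 N ≤ 25 N`, the `4 N` being the bit lengths of four factors.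
The two loops then give at most `25 N³ + N² + 4 N + 2 ≤ 40 N³`. -/
theorem scale_cost_le {N : ℕ} (hN : 1 ≤ N) (hnN : n ≤ N) (hn : σ.reg .n = n)
    (hden : (σ.reg .den).size ≤ N) (hnum : (σ.reg .num).size ≤ N)
    (hdist : ∀ u v : Fin n, (σ.arr .dist u v - 1).size ≤ N) :
    (scale.run σ).2 ≤ 40 * N ^ 3 := by
  have hinner : ∀ k < n, ∀ τ, scale.Frame σ τ →
      ((block [forNodes .v [
        put2 .lo .u .v (.mul (rd .den) (.sub (get2 .dist .u .v) (num 1))),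
        put2 .hi .u .v (.mul (rd .num) (.sub (get2 .dist .u .v) (num 1)))]]).run
          (τ.setReg .u k)).2 ≤ 1 + N * (25 * N + 1) + 1 + 1 := by
    intro k hk τ hf
    have hn' : (τ.setReg .u k).reg .n = n := by simpa using (hf.1 .n rfl).trans hn
    have := loop_cost_le (σ := τ.setReg .u k) (x := .v) (e := .reg .n) (s := block [
        put2 .lo .u .v (.mul (rd .den) (.sub (get2 .dist .u .v) (num 1))),
        put2 .hi .u .v (.mul (rd .num) (.sub (get2 .dist .u .v) (num 1)))]) (c := 25 * N) ?_
    · rw [eval_reg, hn'] at this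
      have h2 : n * (25 * N + 1) ≤ N * (25 * N + 1) := Nat.mul_le_mul_right _ hnN
      simp only [Expr.cost] at this
      simp only [block, run] at this ⊢
      omega
    intro j hj τ' hf'
    rw [eval_reg, hn'] at hj
    have h1 : τ'.reg .u = k := by simpa using hf'.1 .u rfl
    have h2 : τ'.arr .dist = σ.arr .dist := by
      rw [hf'.2 .dist rfl]
      simpa using hf.2 .dist rfl
    have h3 : τ'.reg .den = σ.reg .den := by
      rw [hf'.1 .den rfl]
      simpa using hf.1 .den rfl
    have h4 : τ'.reg .num = σ.reg .num := by
      rw [hf'.1 .num rfl]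
      simpa using hf.1 .num rfl
    have h5 : (σ.arr .dist k j - 1).size ≤ N := hdist ⟨k, hk⟩ ⟨j, hj⟩
    simp only [block, run, Expr.cost, eval_reg, eval_sub, eval_get, eval_lit, State.setReg_reg,
      State.setReg_arr, State.setArr_reg, State.setArr_arr, reduceCtorEq, if_false, if_true, h1, h2,
      h3, h4]
    omega
  have := loop_cost_le (σ := σ) (x := .u) (e := .reg .n) (s := block [forNodes .v [
        put2 .lo .u .v (.mul (rd .den) (.sub (get2 .dist .u .v) (num 1))),
        put2 .hi .u .v (.mul (rd .num) (.sub (get2 .dist .u .v) (num 1)))]])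
        (by rw [eval_reg, hn]; exact hinner)
  rw [eval_reg, hn] at this
  have h2 := Nat.mul_le_mul_right (1 + N * (25 * N + 1) + 1 + 1 + 1) hnN
  simp only [Expr.cost] at this
  refine this.trans ?_
  nlinarith [Nat.one_le_pow 2 N hN, Nat.one_le_pow 3 N hN, Nat.pow_le_pow_right hN (show 2 ≤ 3 by omega),
    Nat.le_self_pow (show 3 ≠ 0 by omega) N]

/-- The constants 40 here and 3 in `greedyDepth` come from `scale_cost_le`; the final 3 covers the
`skip` steps that end the blocks. Depths are added only to dominate each of them. -/
def greedyWeight : ℕ :=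
  distInit.weight + (forNodes .r [relaxAll]).weight + 40 + countPairs.weight + greedyLoop.weight + 3

def greedyDepth : ℕ :=
  distInit.depth + (forNodes .r [relaxAll]).depth + 3 + countPairs.depth + greedyLoop.depth

theorem greedy_cost_eq (σ : State Reg Arr) : (greedy.run σ).2 =
    (distInit.run σ).2 + (((forNodes .r [relaxAll]).run (distInit.ev σ)).2 +
      ((scale.run ((forNodes .r [relaxAll]).ev (distInit.ev σ))).2 + 1)) +
    ((countPairs.run (shortestPaths.ev σ)).2 +
      ((greedyLoop.run ((block [shortestPaths, countPairs]).ev σ)).2 + 1)) := by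
  rw [show greedy = block [shortestPaths, countPairs, greedyLoop] from rfl, shortestPaths_eq]
  simp only [block, run, ev]

theorem greedy_cost_le (hℓ : ∀ e, I.len e = ℓ e) {a b L : ℕ} (hb : 0 < b) (hρ : I.ρ = a / b)
    (hL : ∀ e, (ℓ e).size ≤ L) (ha : a.size ≤ L) (hbL : b.size ≤ L) :
    (greedy.run (I.input ℓ a b)).2 ≤ greedyWeight * (n + L + 1) ^ (2 * greedyDepth) := by
  rw [pow_mul]
  -- The square makes `N` large enough for both the bit lengths, at most `n + L`, and the number of
  -- pairs, at most `n²`; hence the factor 2 in the exponent.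
  obtain ⟨N, hNdef⟩ : ∃ N, N = (n + L + 1) ^ 2 := ⟨_, rfl⟩
  have hN : 1 ≤ N := hNdef ▸ Nat.one_le_pow _ _ (by omega)
  have hnL : n + L ≤ N := by rw [hNdef]; nlinarith
  have hn2 : n * n ≤ N := by rw [hNdef]; nlinarith
  rw [← hNdef, greedy_cost_eq]
  set σ₀ := I.input ℓ a b with hσ₀
  have hn0 : σ₀.reg .n = n := rfl
  have htotal0 : σ₀.reg .total = 0 := rfl
  have hf1 := frame_ev σ₀ distInit
  have h1 : Approx I ℓ 0 (distInit.ev σ₀) := distInit_spec hn0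
    (by intro u v; simp [hσ₀, Instance.input]) (by intro u v; simp [hσ₀, Instance.input])
    (by intro u v; simp [hσ₀, Instance.input])
  have c1 := plain_cost_le (σ := σ₀) (s := distInit) rfl hN (by omega) (by omega)
  set σ₁ := distInit.ev σ₀
  have hn1 : σ₁.reg .n = n := (hf1.1 .n rfl).trans hn0
  have htotal1 : σ₁.reg .total = 0 := (hf1.1 .total rfl).trans htotal0
  have h2 := relaxRounds_spec hn1 h1
  have hf2 := frame_ev σ₁ (forNodes .r [relaxAll])
  have c2 := plain_cost_le (σ := σ₁) (s := forNodes .r [relaxAll]) rfl hN (by omega) (by omega)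
  set σ₂ := (forNodes .r [relaxAll]).ev σ₁
  have hn2' : σ₂.reg .n = n := (hf2.1 .n rfl).trans hn1
  have hden : σ₂.reg .den = b := by rw [hf2.1 .den rfl, hf1.1 .den rfl]; rfl
  have hnum : σ₂.reg .num = a := by rw [hf2.1 .num rfl, hf1.1 .num rfl]; rfl
  have c3 := scale_cost_le (σ := σ₂) hN (by omega) hn2' (by rw [hden]; omega) (by rw [hnum]; omega)
    fun u v => (h2.size_dist_le hL u v).trans hnL
  have hn3 : (shortestPaths.ev σ₀).reg .n = n := (ev_reg σ₀ rfl).trans hn0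
  have c4 := countPairs_cost_le (σ := shortestPaths.ev σ₀) hN (by omega)
  have hready : Ready I ((block [shortestPaths, countPairs]).ev σ₀) := ready_preprocess hℓ hb hρ
  have hP : I.P.card ≤ n * n := by
    refine (Finset.card_le_univ I.P).trans_eq ?_
    rw [Fintype.card_prod, Fintype.card_fin]
  have c5 := plain_cost_le (σ := (block [shortestPaths, countPairs]).ev σ₀) (s := greedyLoop) rfl hN
    (by rw [hready.n_eq]; omega) (by rw [hready.total_eq]; omega)
  have hpow : ∀ d, d ≤ greedyDepth → N ^ d ≤ N ^ greedyDepth :=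
    fun d hd => Nat.pow_le_pow_right hN hd
  have e1 := c1.trans (Nat.mul_le_mul_left _ (hpow _ (by unfold greedyDepth; omega)))
  have e2 := c2.trans (Nat.mul_le_mul_left _ (hpow _ (by unfold greedyDepth; omega)))
  have e3 := c3.trans (Nat.mul_le_mul_left _ (hpow _ (by unfold greedyDepth; omega)))
  have e4 := c4.trans (Nat.mul_le_mul_left _ (hpow _ (by unfold greedyDepth; omega)))
  have e5 := c5.trans (Nat.mul_le_mul_left _ (hpow _ (by unfold greedyDepth; omega)))
  have e6 : 1 ≤ N ^ greedyDepth := Nat.one_le_pow _ _ hN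
  simp only [greedyWeight, add_mul]
  omega

end Prog

end Middlebox

/-! ### The main theorem -/

theorem mainTheorem2 :
    ∃ (C : ℝ) (c k : ℕ), ∀ (n : ℕ) (I : Middlebox.Instance n),
      -- the algorithm keeps a maximum assignment, and pairs once served remain served
      (∀ x, I.Reach x →
        x.order.Nodup ∧ x.placed ⊆ I.U ∧
        I.IsPartial x.placed x.assign ∧ x.assign.card = I.φ x.placed ∧
        ∀ y, I.Step x y → Middlebox.served x.assign ⊆ Middlebox.served y.assign) ∧
      -- if there is a solution, the algorithm does not get stuck before all pairs are served
      ((∃ M, I.IsDeployment M) →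
        ∀ x, I.Reach x → ¬ I.Complete x.assign → ∃ y, I.Step x y) ∧
      -- the result is a solution, and the approximation ratio is logarithmic
      (∀ x, I.Reach x → I.Complete x.assign →
        I.IsDeployment x.placed ∧
        ∀ M, I.IsDeployment M →
          (x.order.length : ℝ) ≤ (1 + C * Real.log (min I.κ n : ℕ)) * M.card ∧
          (x.order.length : ℝ) ≤ (1 + C * Real.log n) * M.card) ∧
      -- the program carries out the algorithm in polynomial time
      (∀ (ℓ : Sym2 (Fin n) → ℕ) (a b L : ℕ),
        (∀ e, I.len e = ℓ e) → 0 < b → I.ρ = a / b →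
        (∀ e, (ℓ e).size ≤ L) → a.size ≤ L → b.size ≤ L →
        (∃ x, I.Reach x ∧
          Middlebox.Outputs (Middlebox.Prog.greedy.run (I.input ℓ a b)).1 x ∧
          ((∃ M, I.IsDeployment M) → I.Complete x.assign)) ∧
        (Middlebox.Prog.greedy.run (I.input ℓ a b)).2 ≤ c * (n + L + 1) ^ k) := by
  refine ⟨2, Middlebox.Prog.greedyWeight, 2 * Middlebox.Prog.greedyDepth, fun n I =>
    ⟨fun x hx => ?_, ?_, fun x hx hc => ?_, ?_⟩⟩
  · have hg := Middlebox.Instance.Reach.isGreedy hx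
    exact ⟨hg.nodup, hg.sub, hg.isPartial, hg.card_eq, fun y hy => (hg.step hy).2⟩
  · rintro ⟨M, hM⟩ x hx hc
    exact (Middlebox.Instance.Reach.isGreedy hx).exists_step hM hc
  · exact ⟨(Middlebox.Instance.Reach.isGreedy hx).isDeployment hc,
      fun M hM => Middlebox.Instance.Reach.length_le hx hc hM⟩
  · intro ℓ a b L hℓ hb hρ hL ha hbL
    exact ⟨Middlebox.Prog.greedy_spec hℓ hb hρ,
      Middlebox.Prog.greedy_cost_le hℓ hb hρ hL ha hbL⟩
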